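/- **Setting.** $B_n$ is the group of $n$-braids with Artin generators $\sigma_1,\dots,\sigma_{n-1}$, products being read from left to right (braids act from the right). A *permutation braid* is a positive braid in which any two strands cross at most once; it is determined by its permutation ($i\mapsto j$ if the strand starting at position $i$ ends at position $j$). For a braid $\beta$ let $S(\beta)$ (resp. $F(\beta)$) be the set of $i$ such that $\beta=\sigma_i\beta'$ (resp. $\beta=\beta'\sigma_i$) with $\beta'$ a permutation braid. Let $\Delta$ be the half twist and $\tau(\beta)=\Delta^{-1}\beta\Delta$. An expression $\beta=\Delta^m\beta_1\cdots\beta_\ell$ is the *left canonical form* of $\beta$ if the $\beta_i$ are permutation braids different from $1$ and $\Delta$ and it is left weighted, i.e. $F(\beta_i)\supseteq S(\beta_{i+1})$ for $1\le i<\ell$. If $\ell\ge1$ and moreover $F(\beta_\ell)\supseteq S(\tau^m(\beta_1))$, then $\beta$ is *rigid*. A *standard circle* in the disk with punctures $1,\dots,n$ on an axis is a circle meeting the axis exactly twice and enclosing at least two but not all of the punctures (so it encloses consecutive punctures $i,\dots,j$). A *standard reduction system* for $\beta$ is a non-empty family of pairwise disjoint standard circles that is preserved, up to isotopy, by the action of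 $\beta$ on the punctured disk. **The braids.** For $\mathbf a=(a_1,\dots,a_p)\in\{0,1\}^p$ let $\alpha(\mathbf a)$ be the permutation braid on $2p+2$ strands whose strands run as follows. * If $a_j=0$, the strand $2j+1$ ends at $2j$, and the strand $2j$ ends at $2j'+1$, where $j'>j$ is the smallest index with $a_{j'}=0$, or at $2p+2$ if there is none. * If $a_j=1$, the strand $2j$ ends at $2j+1$, and the strand $2j+1$ ends at $2j'$, where $j'<j$ is the largest index with $a_{j'}=1$, or at $1$ if there is none. * The strand $1$ ends at $2j'+1$ for the smallest $j'$ with $a_{j'}=0$, or at $2p+2$ if there is none; the strand $2p+2$ ends at $2j'$ for the largest $j'$ with $a_{j'}=1$, or at $1$ if there is none. For $b\in\{0,\dots,p\}$ let $\alpha(\mathbf a,b)$ be the permutation braid on $2p+3$ strands obtained from $\alpha(\mathbf a)$, drawn with straight strands, by adding a straight vertical strand between the $(2b+1)$-st and the $(2b+2)$-nd position. For a binary $k\times p$ matrix $A$ with rows $A_1,\dots,A_k$ put $\alpha(A)=\alpha(A_1)\cdots\alpha(A_k)$ and $\alpha(A,b)=\alpha(A_1,b)\cdots\alpha(A_k,b)$,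 which is $\alpha(A)$ with a straight vertical strand added. For $k\ge1$ and $n\ge6$ let $\mathcal M_{k,n}$ be the set of binary $k\times p$ matrices $A$ whose first column is $\mathbf 0$ and whose last column is $\mathbf 1$ if $n=2p+2$, and the set of pairs $(A,b)$ of such a matrix and $b\in\{0,\dots,p\}$ if $n=2p+3$. This gives a function $\alpha:\mathcal M_{k,n}\to B_n$. **Lemma 2.2.** Let $k\ge1$ and $n\ge6$. 1. For every element of $\mathcal M_{k,n}$ the product $\alpha(A)=\alpha(A_1)\cdots\alpha(A_k)$ (if $n$ is even), respectively $\alpha(A,b)=\alpha(A_1,b)\cdots\alpha(A_k,b)$ (if $n$ is odd), is a left canonical form as written (with $m=0$ and $\ell=k$), and this braid is rigid. In fact $F(\alpha(A_i))\supseteq S(\alpha(A_j))$, respectively $F(\alpha(A_i,b))\supseteq S(\alpha(A_j,b))$, for all $i,j\in\{1,\dots,k\}$. The function $\alpha:\mathcal M_{k,n}\to B_n$ is injective. 2. None of the braids $\alpha(A)$, respectively $\alpha(A,b)$, in $\alpha(\mathcal M_{k,n})$ has a standard reduction system. -/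

import Mathlib

noncomputable section

/-! ### The braid group

Punctures, positions of strands and Artin generators are numbered from `0`: the Artin generator
`σ_{i+1}` of the usual numbering is `Braid.σ i`, and it exchanges the positions `i` and `i+1`. -/

/-- The position `s` (out of `n`) on the left of the `s`-th gap. -/
def leftPos {n : ℕ} (s : Fin (n - 1)) : Fin n := ⟨s.1, by omega⟩

/-- The position `s + 1` (out of `n`) on the right of the `s`-th gap. -/
def rightPos {n : ℕ} (s : Fin (n - 1)) : Fin n := ⟨s.1 + 1, by omega⟩

/-- Artin's relators: `σᵢ σⱼ = σⱼ σᵢ` for `|i - j| > 1`, `σᵢ σⱼ σᵢ = σⱼ σᵢ σⱼ` for `|i - j| = 1`. -/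
def braidRels (n : ℕ) : Set (FreeGroup (Fin (n - 1))) :=
  {r | ∃ i j : Fin (n - 1),
    (i.1 + 1 < j.1 ∧ r = (FreeGroup.of i * FreeGroup.of j) *
      (FreeGroup.of j * FreeGroup.of i)⁻¹) ∨
    (i.1 + 1 = j.1 ∧ r = (FreeGroup.of i * FreeGroup.of j * FreeGroup.of i) *
      (FreeGroup.of j * FreeGroup.of i * FreeGroup.of j)⁻¹)}

/-- The group of braids on `n` strands. -/
abbrev Braid (n : ℕ) : Type := PresentedGroup (braidRels n)

namespace Braid

variable {n : ℕ}

/-- The Artin generators. -/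
def σ (i : Fin (n - 1)) : Braid n := PresentedGroup.of i

/-- The positive braid represented by a word in the Artin generators, read from left to right. -/
def ofWord (w : List (Fin (n - 1))) : Braid n := (w.map σ).prod

/-- The number of times the strands starting at the positions `i` and `j` cross each other in a
positive braid word. -/
def crossings : List (Fin (n - 1)) → Fin n → Fin n → ℕ
  | [], _, _ => 0
  | s :: w, i, j =>
    (if (i = leftPos s ∧ j = rightPos s) ∨ (i = rightPos s ∧ j = leftPos s) then 1 else 0) +
      crossings w (Equiv.swap (leftPos s) (rightPos s) i) (Equiv.swap (leftPos s) (rightPos s) j)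

/-- A permutation braid: a positive braid in which any two strands cross at most once. -/
def IsPermutationBraid (β : Braid n) : Prop :=
  ∃ w : List (Fin (n - 1)), ofWord w = β ∧ ∀ i j : Fin n, i ≠ j → crossings w i j ≤ 1

/-- The starting set `S(β)`. -/
def startingSet (β : Braid n) : Set (Fin (n - 1)) :=
  {i | ∃ β' : Braid n, IsPermutationBraid β' ∧ β = σ i * β'}

/-- The finishing set `F(β)`. -/
def finishingSet (β : Braid n) : Set (Fin (n - 1)) :=
  {i | ∃ β' : Braid n, IsPermutationBraid β' ∧ β = β' * σ i}

/-- The number of strands that start to the left of the strand `j` and end to its right when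
every strand `i` ends at the position `f i`. -/
def crossedFromLeft (f : Equiv.Perm (Fin n)) (j : Fin n) : ℕ :=
  (Finset.univ.filter fun i : Fin n => i < j ∧ f j < f i).card

/-- A positive word for the braid in which the strand starting at `i` runs straight to `f i`.
The strands are put in place one after the other: when the strands `0, …, j - 1` have been brought
into their final relative order, the strand `j` moves to the left across the `c` strands among them
which have to end on its right, which contributes the letters `σ (j-1), σ (j-2), …, σ (j-c)`. -/
def permWord (f : Equiv.Perm (Fin n)) : List (Fin (n - 1)) :=
  (List.finRange n).flatMap fun j =>
    (List.finRange (n - 1)).reverse.filter fun s =>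
      decide (j.1 - crossedFromLeft f j ≤ s.1 ∧ s.1 < j.1)

/-- The permutation braid whose strand starting at position `i` ends at position `f i`. -/
def permBraid (f : Equiv.Perm (Fin n)) : Braid n := ofWord (permWord f)

/-- The half twist `Δ`. -/
def halfTwist (n : ℕ) : Braid n := permBraid Fin.revPerm

/-- The involution `τ(β) = Δ⁻¹ β Δ`, iterated `m` times. -/
def tauPow (m : ℤ) (β : Braid n) : Braid n := (halfTwist n ^ m)⁻¹ * β * halfTwist n ^ m

/-- `β = Δ^m β₁ ⋯ β_ℓ` is the left canonical form of `β`, where `L = [β₁, …, β_ℓ]`: the factors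
are permutation braids other than `1` and `Δ`, and consecutive factors are left weighted, that is,
`F(βᵢ) ⊇ S(βᵢ₊₁)`. -/
structure IsLeftCanonicalForm (β : Braid n) (m : ℤ) (L : List (Braid n)) : Prop where
  eq_prod : β = halfTwist n ^ m * L.prod
  isPermutationBraid : ∀ x ∈ L, IsPermutationBraid x
  ne_one : ∀ x ∈ L, x ≠ 1
  ne_halfTwist : ∀ x ∈ L, x ≠ halfTwist n
  leftWeighted : L.IsChain fun x y => startingSet y ⊆ finishingSet x

/-- A braid with left canonical form `Δ^m β₁ ⋯ β_ℓ`, `ℓ ≥ 1`, is rigid if the form stays left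
weighted when it is closed up cyclically: `F(β_ℓ) ⊇ S(τ^m(β₁))`. -/
def IsRigid (β : Braid n) : Prop :=
  ∃ (m : ℤ) (L : List (Braid n)) (hL : L ≠ []), IsLeftCanonicalForm β m L ∧
    startingSet (tauPow m (L.head hL)) ⊆ finishingSet (L.getLast hL)

/-! ### The action on curves in the punctured disk

The fundamental group of the `n`-punctured disk is free on the classes `x₀, …, x_{n-1}` of loops
around the punctures, chosen so that `x₀ x₁ ⋯ x_{n-1}` is the class of the boundary. -/

/-- Images of the free generators under the half twist exchanging two neighbouring punctures. -/
def artinFun (s : Fin (n - 1)) (k : Fin n) : FreeGroup (Fin n) :=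
  if k = leftPos s then
    FreeGroup.of (leftPos s) * FreeGroup.of (rightPos s) * (FreeGroup.of (leftPos s))⁻¹
  else if k = rightPos s then FreeGroup.of (leftPos s)
  else FreeGroup.of k

/-- Images of the free generators under the inverse half twist. -/
def artinInvFun (s : Fin (n - 1)) (k : Fin n) : FreeGroup (Fin n) :=
  if k = leftPos s then FreeGroup.of (rightPos s)
  else if k = rightPos s then
    (FreeGroup.of (rightPos s))⁻¹ * FreeGroup.of (leftPos s) * FreeGroup.of (rightPos s)
  else FreeGroup.of k

lemma leftPos_ne_rightPos (s : Fin (n - 1)) : leftPos s ≠ rightPos s := by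
  simp [leftPos, rightPos, Fin.ext_iff]

/-- The automorphism of the fundamental group induced by the half twist exchanging two
neighbouring punctures: `xₛ ↦ xₛ xₛ₊₁ xₛ⁻¹`, `xₛ₊₁ ↦ xₛ`. -/
def artinAut (s : Fin (n - 1)) : MulAut (FreeGroup (Fin n)) :=
  MonoidHom.toMulEquiv (FreeGroup.lift (artinFun s)) (FreeGroup.lift (artinInvFun s))
    (by
      have h := leftPos_ne_rightPos s
      ext k
      by_cases h1 : k = leftPos s
      · subst h1; simp [artinFun, artinInvFun, h.symm, mul_assoc]
      · by_cases h2 : k = rightPos s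
        · subst h2; simp [artinFun, artinInvFun, h.symm]
        · simp [artinFun, artinInvFun, h1, h2])
    (by
      have h := leftPos_ne_rightPos s
      ext k
      by_cases h1 : k = leftPos s
      · subst h1; simp [artinFun, artinInvFun, h.symm]
      · by_cases h2 : k = rightPos s
        · subst h2; simp [artinFun, artinInvFun, h.symm, mul_assoc]
        · simp [artinFun, artinInvFun, h1, h2])

lemma artinAut_of (s : Fin (n - 1)) (k : Fin n) :
    artinAut s (FreeGroup.of k) = artinFun s k := by
  simp [artinAut]

lemma mulAut_ext {f g : MulAut (FreeGroup (Fin n))}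
    (h : ∀ k, f (FreeGroup.of k) = g (FreeGroup.of k)) : f = g := by
  have : f.toMonoidHom = g.toMonoidHom := by
    ext k; exact h k
  exact MulEquiv.toMonoidHom_injective this

lemma artinAut_comm {i j : Fin (n - 1)} (hij : i.1 + 1 < j.1) :
    artinAut i * artinAut j = artinAut j * artinAut i := by
  have h1 : leftPos i ≠ leftPos j := by simp [leftPos, Fin.ext_iff]; omega
  have h2 : leftPos i ≠ rightPos j := by simp [leftPos, rightPos, Fin.ext_iff]; omega
  have h3 : rightPos i ≠ leftPos j := by simp [leftPos, rightPos, Fin.ext_iff]; omega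
  have h4 : rightPos i ≠ rightPos j := by simp [rightPos, Fin.ext_iff]; omega
  have h5 := leftPos_ne_rightPos i
  have h6 := leftPos_ne_rightPos j
  apply mulAut_ext
  intro k
  simp only [MulAut.mul_apply, artinAut_of]
  by_cases e1 : k = leftPos i
  · subst e1
    simp [artinFun, artinAut_of, h1, h2, h3, h4]
  by_cases e2 : k = rightPos i
  · subst e2
    simp [artinFun, artinAut_of, h1, h2, h3, h4, h5.symm]
  by_cases e3 : k = leftPos j
  · subst e3
    simp [artinFun, artinAut_of, h1.symm, h2.symm, h3.symm, h4.symm]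
  by_cases e4 : k = rightPos j
  · subst e4
    simp [artinFun, artinAut_of, h1.symm, h2.symm, h3.symm, h4.symm, h6.symm]
  simp [artinFun, artinAut_of, e1, e2, e3, e4]

lemma artinAut_braid {i j : Fin (n - 1)} (hij : i.1 + 1 = j.1) :
    artinAut i * artinAut j * artinAut i = artinAut j * artinAut i * artinAut j := by
  have h0 : rightPos i = leftPos j := by simp [leftPos, rightPos, Fin.ext_iff]; omega
  have h1 : leftPos i ≠ leftPos j := by simp [leftPos, Fin.ext_iff]; omega
  have h2 : leftPos i ≠ rightPos j := by simp [leftPos, rightPos, Fin.ext_iff]; omega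
  have h6 := leftPos_ne_rightPos j
  apply mulAut_ext
  intro k
  simp only [MulAut.mul_apply, artinAut_of]
  by_cases e1 : k = leftPos i
  · subst e1
    simp [artinFun, artinAut_of, h0, h1, h2, h1.symm, h2.symm, h6.symm, mul_assoc]
  by_cases e2 : k = leftPos j
  · subst e2
    simp [artinFun, artinAut_of, h0, h1, h2, h1.symm, h2.symm, h6.symm, mul_assoc]
  by_cases e3 : k = rightPos j
  · subst e3
    simp [artinFun, artinAut_of, h0, h1, h2, h1.symm, h2.symm, h6.symm]
  simp [artinFun, artinAut_of, h0, e1, e2, e3]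

lemma lift_artinAut_eq_one (r : FreeGroup (Fin (n - 1))) (hr : r ∈ braidRels n) :
    FreeGroup.lift (fun s => MulOpposite.op (artinAut s)) r = 1 := by
  obtain ⟨i, j, ⟨h, rfl⟩ | ⟨h, rfl⟩⟩ := hr
  · rw [map_mul, map_inv, mul_inv_eq_one]
    simp only [map_mul, FreeGroup.lift_apply_of, ← MulOpposite.op_mul]
    rw [artinAut_comm h]
  · rw [map_mul, map_inv, mul_inv_eq_one]
    simp only [map_mul, FreeGroup.lift_apply_of, ← MulOpposite.op_mul, ← mul_assoc]
    rw [artinAut_braid h]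

/-- Artin's representation: the action of braids, from the right, on the fundamental group of the
punctured disk. -/
def artinRep (n : ℕ) : Braid n →* (MulAut (FreeGroup (Fin n)))ᵐᵒᵖ :=
  PresentedGroup.toGroup (f := fun s => MulOpposite.op (artinAut s)) lift_artinAut_eq_one

/-- Free homotopy of unoriented loops: conjugacy in the fundamental group up to inversion. -/
def loopSetoid (n : ℕ) : Setoid (FreeGroup (Fin n)) where
  r g h := IsConj g h ∨ IsConj g h⁻¹
  iseqv := by
    have hinv : ∀ {a b : FreeGroup (Fin n)}, IsConj a b → IsConj a⁻¹ b⁻¹ := by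
      intro a b h
      obtain ⟨c, hc⟩ := isConj_iff.1 h
      exact isConj_iff.2 ⟨c, by rw [← hc]; group⟩
    refine ⟨fun g => Or.inl (IsConj.refl g), ?_, ?_⟩
    · rintro g h (h1 | h1)
      · exact Or.inl h1.symm
      · exact Or.inr (by simpa using (hinv h1).symm)
    · rintro g h k (h1 | h1) (h2 | h2)
      · exact Or.inl (h1.trans h2)
      · exact Or.inr (h1.trans h2)
      · exact Or.inr (h1.trans (hinv h2))
      · exact Or.inl (h1.trans (by simpa using hinv h2))

/-- Free homotopy classes of unoriented loops in the `n`-punctured disk. Isotopy classes of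
essential simple closed curves are among them, as homotopic essential simple closed curves are
isotopic. -/
def LoopClass (n : ℕ) : Type := Quotient (loopSetoid n)

/-- The image of a curve under a braid, which acts from the right. -/
def actOnLoop (β : Braid n) : LoopClass n → LoopClass n :=
  Quotient.map (artinRep n β).unop (by
    rintro g h (h1 | h1)
    · exact Or.inl ((artinRep n β).unop.toMonoidHom.map_isConj h1)
    · exact Or.inr (by
        have := (artinRep n β).unop.toMonoidHom.map_isConj h1
        simpa using this))

/-- A standard circle, that is, a circle meeting the axis of the punctures exactly twice, given by
the first and the last puncture inside it. It is essential and not peripheral: it encloses at least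
two punctures, but not all of them. -/
structure StandardCircle (n : ℕ) where
  first : Fin n
  last : Fin n
  first_lt_last : first < last
  not_peripheral : ¬ (first.1 = 0 ∧ last.1 + 1 = n)

/-- The punctures enclosed by a standard circle. -/
def StandardCircle.inside (C : StandardCircle n) : Set (Fin n) := Set.Icc C.first C.last

/-- The curve given by a standard circle: the class of `xᵢ xᵢ₊₁ ⋯ xⱼ`. -/
def StandardCircle.curve (C : StandardCircle n) : LoopClass n :=
  Quotient.mk (loopSetoid n)
    ((((List.finRange n).filter fun k => decide (C.first ≤ k ∧ k ≤ C.last)).map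
      FreeGroup.of).prod)

/-- Two standard circles can be made disjoint: they are nested or lie outside each other. -/
def StandardCircle.AreDisjoint (C C' : StandardCircle n) : Prop :=
  C.inside ⊆ C'.inside ∨ C'.inside ⊆ C.inside ∨ Disjoint C.inside C'.inside

/-- A standard reduction system for `β`: a non-empty family of pairwise disjoint standard circles
which is preserved by `β` up to isotopy. -/
structure IsStandardReductionSystem (β : Braid n) (𝒞 : Set (StandardCircle n)) : Prop where
  nonempty : 𝒞.Nonempty
  disjoint : 𝒞.Pairwise StandardCircle.AreDisjoint
  preserved : (fun C => actOnLoop β C.curve) '' 𝒞 = StandardCircle.curve '' 𝒞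

end Braid

/-! ### The braids of binary matrices

For a binary row `a = (a₀, …, a_{p-1})`, the braid `α(a)` has `2p + 2` strands. Between the first
and the last position lie `p` pairs of positions, `(2j+1, 2j+2)` being the `j`-th pair. -/

namespace BinaryBraid

open Braid

variable {p : ℕ}

/-- The right position `2j+2` of the first pair `j ≥ m` with `a j = 0`, and the last position if
there is no such pair. -/
def nextZero (a : Fin p → Fin 2) (m : ℕ) : Fin (2 * p + 2) :=
  (insert (Fin.last (2 * p + 1))
    ((Finset.univ.filter fun j : Fin p => m ≤ j.1 ∧ a j = 0).image
      fun j => (⟨2 * j.1 + 2, by omega⟩ : Fin (2 * p + 2)))).min' (Finset.insert_nonempty _ _)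

/-- The left position `2j+1` of the last pair `j < m` with `a j = 1`, and the first position if
there is no such pair. -/
def prevOne (a : Fin p → Fin 2) (m : ℕ) : Fin (2 * p + 2) :=
  (insert (0 : Fin (2 * p + 2))
    ((Finset.univ.filter fun j : Fin p => j.1 < m ∧ a j = 1).image
      fun j => (⟨2 * j.1 + 1, by omega⟩ : Fin (2 * p + 2)))).max' (Finset.insert_nonempty _ _)

/-- The position at which the strand of `α(a)` starting at position `i` ends. In the `j`-th pair,
if `a j = 0` then the right strand moves one step to the left and the left strand goes to the
right up to the next pair marked `0`; if `a j = 1` then the left strand moves one step to the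
right and the right strand goes to the left up to the previous pair marked `1`. The first strand
goes to the first pair marked `0`, and the last strand to the last pair marked `1`. -/
def strandEnd (a : Fin p → Fin 2) (i : Fin (2 * p + 2)) : Fin (2 * p + 2) :=
  if h0 : i.1 = 0 then nextZero a 0
  else if hl : i.1 = 2 * p + 1 then prevOne a p
  else
    let j : Fin p := ⟨(i.1 - 1) / 2, by omega⟩
    if i.1 % 2 = 1 then
      if a j = 0 then nextZero a (j.1 + 1) else ⟨i.1 + 1, by omega⟩
    else
      if a j = 0 then ⟨i.1 - 1, by omega⟩ else prevOne a j.1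

lemma nextZero_mem (a : Fin p → Fin 2) (m : ℕ) : (nextZero a m).1 = 2 * p + 1 ∨
    ∃ j : Fin p, m ≤ j.1 ∧ a j = 0 ∧ (nextZero a m).1 = 2 * j.1 + 2 := by
  have h := Finset.min'_mem _ (Finset.insert_nonempty (Fin.last (2 * p + 1))
    ((Finset.univ.filter fun j : Fin p => m ≤ j.1 ∧ a j = 0).image
      fun j => (⟨2 * j.1 + 2, by omega⟩ : Fin (2 * p + 2))))
  rw [Finset.mem_insert, Finset.mem_image] at h
  rcases h with h | ⟨j, hj, h⟩
  · exact Or.inl (congrArg Fin.val h)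
  · rw [Finset.mem_filter] at hj
    exact Or.inr ⟨j, hj.2.1, hj.2.2, (congrArg Fin.val h).symm⟩

lemma nextZero_le (a : Fin p → Fin 2) (m : ℕ) (j : Fin p) (hm : m ≤ j.1) (hj : a j = 0) :
    (nextZero a m).1 ≤ 2 * j.1 + 2 := by
  have h : nextZero a m ≤ (⟨2 * j.1 + 2, by omega⟩ : Fin (2 * p + 2)) :=
    Finset.min'_le _ _ (Finset.mem_insert_of_mem (Finset.mem_image.2
      ⟨j, Finset.mem_filter.2 ⟨Finset.mem_univ _, hm, hj⟩, rfl⟩))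
  exact h

lemma prevOne_mem (a : Fin p → Fin 2) (m : ℕ) : (prevOne a m).1 = 0 ∨
    ∃ j : Fin p, j.1 < m ∧ a j = 1 ∧ (prevOne a m).1 = 2 * j.1 + 1 := by
  have h := Finset.max'_mem _ (Finset.insert_nonempty (0 : Fin (2 * p + 2))
    ((Finset.univ.filter fun j : Fin p => j.1 < m ∧ a j = 1).image
      fun j => (⟨2 * j.1 + 1, by omega⟩ : Fin (2 * p + 2))))
  rw [Finset.mem_insert, Finset.mem_image] at h
  rcases h with h | ⟨j, hj, h⟩
  · exact Or.inl (congrArg Fin.val h)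
  · rw [Finset.mem_filter] at hj
    exact Or.inr ⟨j, hj.2.1, hj.2.2, (congrArg Fin.val h).symm⟩

lemma le_prevOne (a : Fin p → Fin 2) (m : ℕ) (j : Fin p) (hm : j.1 < m) (hj : a j = 1) :
    2 * j.1 + 1 ≤ (prevOne a m).1 := by
  have h : (⟨2 * j.1 + 1, by omega⟩ : Fin (2 * p + 2)) ≤ prevOne a m :=
    Finset.le_max' _ (⟨2 * j.1 + 1, by omega⟩ : Fin (2 * p + 2)) (Finset.mem_insert_of_mem (Finset.mem_image.2
      ⟨j, Finset.mem_filter.2 ⟨Finset.mem_univ _, hm, hj⟩, rfl⟩))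
  exact h

lemma strandEnd_cases (a : Fin p → Fin 2) (i : Fin (2 * p + 2)) :
    (i.1 = 0 ∧ strandEnd a i = nextZero a 0) ∨
    (i.1 = 2 * p + 1 ∧ strandEnd a i = prevOne a p) ∨
    (∃ j : Fin p, i.1 = 2 * j.1 + 1 ∧ a j = 0 ∧ strandEnd a i = nextZero a (j.1 + 1)) ∨
    (∃ j : Fin p, i.1 = 2 * j.1 + 1 ∧ a j = 1 ∧ (strandEnd a i).1 = 2 * j.1 + 2) ∨
    (∃ j : Fin p, i.1 = 2 * j.1 + 2 ∧ a j = 0 ∧ (strandEnd a i).1 = 2 * j.1 + 1) ∨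
    (∃ j : Fin p, i.1 = 2 * j.1 + 2 ∧ a j = 1 ∧ strandEnd a i = prevOne a j.1) := by
  by_cases h0 : i.1 = 0
  · exact Or.inl ⟨h0, by simp [strandEnd, h0]⟩
  by_cases hl : i.1 = 2 * p + 1
  · exact Or.inr (Or.inl ⟨hl, by simp [strandEnd, hl]⟩)
  have hlt := i.2
  obtain ⟨j, hj⟩ : ∃ j : Fin p, j.1 = (i.1 - 1) / 2 := ⟨⟨(i.1 - 1) / 2, by omega⟩, rfl⟩
  have hj' : (⟨(i.1 - 1) / 2, by omega⟩ : Fin p) = j := Fin.ext hj.symm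
  have ha : a j = 0 ∨ a j = 1 := by omega
  by_cases hi : i.1 % 2 = 1
  · have e : i.1 = 2 * j.1 + 1 := by omega
    rcases ha with ha | ha
    · exact Or.inr (Or.inr (Or.inl ⟨j, e, ha, by simp [strandEnd, h0, hl, hi, ha, ← hj]⟩))
    · exact Or.inr (Or.inr (Or.inr (Or.inl
        ⟨j, e, ha, by simp [strandEnd, h0, hl, hi, hj', ha]; omega⟩)))
  · have e : i.1 = 2 * j.1 + 2 := by omega
    rcases ha with ha | ha
    · exact Or.inr (Or.inr (Or.inr (Or.inr (Or.inl
        ⟨j, e, ha, by simp [strandEnd, h0, hl, hi, hj', ha]; omega⟩))))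
    · exact Or.inr (Or.inr (Or.inr (Or.inr (Or.inr
        ⟨j, e, ha, by simp [strandEnd, h0, hl, hi, ha, ← hj]⟩))))

lemma nextZero_gt (a : Fin p → Fin 2) (j : Fin p) : 2 * j.1 + 2 < (nextZero a (j.1 + 1)).1 := by
  rcases nextZero_mem a (j.1 + 1) with h | ⟨j', h, -, h'⟩ <;> omega

lemma prevOne_lt (a : Fin p → Fin 2) (j : Fin p) : (prevOne a j.1).1 < 2 * j.1 + 1 := by
  rcases prevOne_mem a j.1 with h | ⟨j', h, -, h'⟩ <;> omega

lemma nextZero_ne (a : Fin p → Fin 2) (j : Fin p) (m : ℕ) (hm : m ≤ j.1) (hj : a j = 0) :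
    (nextZero a m).1 ≠ (nextZero a (j.1 + 1)).1 := by
  have h1 := nextZero_le a m j hm hj
  have h2 := nextZero_gt a j
  omega

lemma prevOne_ne (a : Fin p → Fin 2) (j : Fin p) (m : ℕ) (hm : j.1 < m) (hj : a j = 1) :
    (prevOne a m).1 ≠ (prevOne a j.1).1 := by
  have h1 := le_prevOne a m j hm hj
  have h2 := prevOne_lt a j
  omega

lemma nextZero_ne_prevOne (a : Fin p → Fin 2) (m m' : ℕ) :
    (nextZero a m).1 ≠ (prevOne a m').1 := by
  rcases nextZero_mem a m with h | ⟨j, -, -, h⟩ <;>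
  rcases prevOne_mem a m' with h' | ⟨j', -, -, h'⟩ <;> omega

lemma nextZero_ne_left (a : Fin p → Fin 2) (m : ℕ) (j : Fin p) :
    (nextZero a m).1 ≠ 2 * j.1 + 1 := by
  rcases nextZero_mem a m with h | ⟨j', -, -, h⟩ <;> omega

lemma nextZero_ne_right (a : Fin p → Fin 2) (m : ℕ) (j : Fin p) (hj : a j = 1) :
    (nextZero a m).1 ≠ 2 * j.1 + 2 := by
  intro hh
  rcases nextZero_mem a m with h | ⟨j', -, h0, h⟩
  · omega
  · have : j' = j := Fin.ext (by omega)
    subst this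
    omega

lemma prevOne_ne_right (a : Fin p → Fin 2) (m : ℕ) (j : Fin p) :
    (prevOne a m).1 ≠ 2 * j.1 + 2 := by
  rcases prevOne_mem a m with h | ⟨j', -, -, h⟩ <;> omega

lemma prevOne_ne_left (a : Fin p → Fin 2) (m : ℕ) (j : Fin p) (hj : a j = 0) :
    (prevOne a m).1 ≠ 2 * j.1 + 1 := by
  intro hh
  rcases prevOne_mem a m with h | ⟨j', -, h0, h⟩
  · omega
  · have : j' = j := Fin.ext (by omega)
    subst this
    omega

lemma strandEnd_ne_of_lt (a : Fin p → Fin 2) {i i' : Fin (2 * p + 2)} (hlt : i < i') :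
    (strandEnd a i).1 ≠ (strandEnd a i').1 := by
  have hlt' : i.1 < i'.1 := hlt
  have hi' := i'.2
  have c := strandEnd_cases a i
  have c' := strandEnd_cases a i'
  have z1 := nextZero_ne a
  have z2 := nextZero_ne_left a
  have z3 := nextZero_ne_right a
  have o1 := prevOne_ne a
  have o2 := prevOne_ne_left a
  have o3 := prevOne_ne_right a
  have zo := nextZero_ne_prevOne a
  simp only [Fin.ext_iff (b := nextZero a _), Fin.ext_iff (b := prevOne a _)] at c c'
  obtain ⟨Z, hZ⟩ : ∃ Z : ℕ → ℕ, ∀ m, (nextZero a m).1 = Z m := ⟨_, fun _ => rfl⟩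
  obtain ⟨O, hO⟩ : ∃ O : ℕ → ℕ, ∀ m, (prevOne a m).1 = O m := ⟨_, fun _ => rfl⟩
  simp only [hZ, hO] at c c' z1 z2 z3 o1 o2 o3 zo
  rcases c with ⟨h, e⟩ | ⟨h, e⟩ | ⟨j, h, hj, e⟩ | ⟨j, h, hj, e⟩ | ⟨j, h, hj, e⟩ | ⟨j, h, hj, e⟩ <;>
  rcases c' with ⟨h', e'⟩ | ⟨h', e'⟩ | ⟨j', h', hj', e'⟩ | ⟨j', h', hj', e'⟩ | ⟨j', h', hj', e'⟩ |
    ⟨j', h', hj', e'⟩ <;>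
  rw [e, e'] <;>
  first
  | omega
  | exact zo _ _
  | exact (zo _ _).symm
  | exact z2 _ _
  | exact (z2 _ _).symm
  | exact o3 _ _
  | exact (o3 _ _).symm
  | exact z3 _ _ ‹_›
  | exact (z3 _ _ ‹_›).symm
  | exact o2 _ _ ‹_›
  | exact (o2 _ _ ‹_›).symm
  | exact z1 _ _ (by omega) ‹_›
  | exact (o1 _ _ (by omega) ‹_›).symm

lemma strandEnd_injective (a : Fin p → Fin 2) : Function.Injective (strandEnd a) := by
  intro i i' h
  rcases lt_trichotomy i i' with hlt | heq | hlt
  · exact absurd (congrArg Fin.val h) (strandEnd_ne_of_lt a hlt)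
  · exact heq
  · exact absurd (congrArg Fin.val h).symm (strandEnd_ne_of_lt a hlt)

/-- The permutation induced by `α(a)`: the strand `i` ends at the position `rowPerm a i`. -/
def rowPerm (a : Fin p → Fin 2) : Equiv.Perm (Fin (2 * p + 2)) :=
  Equiv.ofBijective (strandEnd a) (Finite.injective_iff_bijective.1 (strandEnd_injective a))

/-- The permutation obtained by adding a new point at the position `q` which is kept fixed. -/
def insertFixed {n : ℕ} (q : Fin (n + 1)) (f : Equiv.Perm (Fin n)) : Equiv.Perm (Fin (n + 1)) :=
  ((finSuccEquiv' q).trans f.optionCongr).trans (finSuccEquiv' q).symm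

/-- `α(a)`, the permutation braid on `2p + 2` strands given by a binary row. -/
def rowBraid (a : Fin p → Fin 2) : Braid (2 * p + 2) := permBraid (rowPerm a)

/-- `α(a, b)`, obtained from `α(a)` by adding a straight vertical strand, immediately to the left
of the `b`-th pair (for `b < p`) or immediately to the left of the last strand (for `b = p`).
The new strand is at the position `2b + 1`, and all strands of the result are still straight. -/
def rowBraidOdd (a : Fin p → Fin 2) (b : Fin (p + 1)) : Braid (2 * p + 3) :=
  permBraid (insertFixed (⟨2 * b.1 + 1, by omega⟩ : Fin (2 * p + 2 + 1)) (rowPerm a))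

/-- Binary `k × p` matrices with first column `0` and last column `1`. -/
def AdmissibleMatrix (k p : ℕ) : Type :=
  {A : Matrix (Fin k) (Fin p) (Fin 2) //
    ∀ (i : Fin k) (j : Fin p), (j.1 = 0 → A i j = 0) ∧ (j.1 + 1 = p → A i j = 1)}

/-- `α(A) = α(A₁) ⋯ α(A_k)`, on `2p + 2` strands. -/
def alphaEven {k : ℕ} (A : AdmissibleMatrix k p) : Braid (2 * p + 2) :=
  (List.ofFn fun i => rowBraid (A.1 i)).prod

/-- `α(A, b) = α(A₁, b) ⋯ α(A_k, b)`, on `2p + 3` strands: the braid `α(A)` with a vertical strand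
added. -/
def alphaOdd {k : ℕ} (A : AdmissibleMatrix k p × Fin (p + 1)) : Braid (2 * p + 3) :=
  (List.ofFn fun i => rowBraidOdd (A.1.1 i) A.2).prod

end BinaryBraid

end

/-!
A left weighted product of permutation braids determines its factors. The dual Lawrence–Krammer
representation at `q = 1 / 2` is given by matrices which at `t = 0` are singular with nonnegative
entries, the basis being indexed by pairs `i < j`. In this limit a left weighted product kills the
basis vector of `i < j` if and only if its first factor makes the strands `i` and `j` cross. So the
product determines the permutation of its first factor.

A standard circle is the word `x y⁻¹` in the two gaps `x`, `y` of the axis that it crosses. Local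
minima of the winding number along words are preserved by a left weighted product, and are created
by its first factor at the powers of `x y⁻¹` if a strand from outside the circle ends between two
strands from inside. Every row does this to every standard circle, so that the powers of the image
have an unbounded number of local minima. For the powers of a conjugate of `x y⁻¹` it is bounded.
-/

/-! ### Words of permutation braids -/

namespace Braid

variable {n : ℕ}

lemma ofWord_append (u v : List (Fin (n - 1))) : ofWord (u ++ v) = ofWord u * ofWord v := by
  simp [ofWord]

lemma ofWord_singleton (s : Fin (n - 1)) : ofWord [s] = σ s := by
  simp [ofWord]

lemma ofWord_cons (s : Fin (n - 1)) (w : List (Fin (n - 1))) :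
    ofWord (s :: w) = σ s * ofWord w := by
  simp [ofWord]

lemma σ_comm {i j : Fin (n - 1)} (h : i.1 + 1 < j.1) : σ i * σ j = σ j * σ i :=
  mul_inv_eq_one.1 <| PresentedGroup.mk_eq_one_iff.2 <|
    Subgroup.subset_normalClosure ⟨i, j, Or.inl ⟨h, rfl⟩⟩

lemma σ_braid {i j : Fin (n - 1)} (h : i.1 + 1 = j.1) :
    σ i * σ j * σ i = σ j * σ i * σ j :=
  mul_inv_eq_one.1 <| PresentedGroup.mk_eq_one_iff.2 <|
    Subgroup.subset_normalClosure ⟨i, j, Or.inr ⟨h, rfl⟩⟩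

/-- The Artin generator of index `k`, continued by `1` to all natural numbers so that indices can
be computed with. -/
def gen (n k : ℕ) : Braid n := if h : k < n - 1 then σ ⟨k, h⟩ else 1

lemma gen_val (s : Fin (n - 1)) : gen n s.1 = σ s := by simp [gen]

lemma gen_comm {i j : ℕ} (h : i + 1 < j) : gen n i * gen n j = gen n j * gen n i := by
  unfold gen
  split_ifs
  · exact σ_comm h
  all_goals simp

lemma gen_braid {i : ℕ} (h : i + 1 < n - 1) :
    gen n i * gen n (i + 1) * gen n i = gen n (i + 1) * gen n i * gen n (i + 1) := by
  rw [gen, gen, dif_pos h, dif_pos (by omega)]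
  exact σ_braid rfl

/-- The braid `σ (hi-1) ⋯ σ lo`, in which one strand moves from `hi` to `lo`: a factor of
`permBraid`. -/
def strandMove (n lo hi : ℕ) : Braid n :=
  ofWord ((List.finRange (n - 1)).reverse.filter fun s => decide (lo ≤ s.1 ∧ s.1 < hi))

lemma strandMove_self (k : ℕ) : strandMove n k k = 1 := by
  have : ((List.finRange (n - 1)).reverse.filter fun s => decide (k ≤ s.1 ∧ s.1 < k)) = [] := by
    simp only [List.filter_eq_nil_iff, decide_eq_true_eq]
    omega
  rw [strandMove, this]
  rfl

lemma strandMove_eq_mul {lo hi : ℕ} (h : lo < hi) (hn : hi ≤ n - 1) :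
    strandMove n lo hi = strandMove n (lo + 1) hi * gen n lo := by
  have key : ((List.finRange (n - 1)).filter fun s => decide (lo ≤ s.1 ∧ s.1 < hi)) =
      ⟨lo, by omega⟩ ::
        ((List.finRange (n - 1)).filter fun s => decide (lo + 1 ≤ s.1 ∧ s.1 < hi)) := by
    refine List.Pairwise.eq_of_mem_iff (r := (· < ·)) ((List.pairwise_lt_finRange _).filter _)
      (List.Pairwise.cons ?_ ((List.pairwise_lt_finRange _).filter _)) ?_
    · simp only [List.mem_filter, decide_eq_true_eq, Fin.lt_def]
      omega
    · simp only [List.mem_filter, List.mem_finRange, true_and, decide_eq_true_eq,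
        List.mem_cons, Fin.ext_iff]
      omega
  rw [strandMove, strandMove, List.filter_reverse, key, List.reverse_cons, ofWord_append,
    ofWord_singleton, ← List.filter_reverse, ← gen_val]

lemma strandMove_mul_gen_of_lt {lo hi k : ℕ} (h : k + 1 < lo) (hlh : lo ≤ hi) (hn : hi ≤ n - 1) :
    strandMove n lo hi * gen n k = gen n k * strandMove n lo hi := by
  induction hlh using Nat.decreasingInduction with
  | self => simp [strandMove_self]
  | of_succ lo hlt ih =>
    rw [strandMove_eq_mul hlt hn, mul_assoc, ← gen_comm h, ← mul_assoc, ih (by omega), mul_assoc]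

lemma strandMove_mul_gen_of_ge {lo hi k : ℕ} (h : lo ≤ k) (hlh : k + 1 < hi) (hn : hi ≤ n - 1) :
    strandMove n lo hi * gen n (k + 1) = gen n k * strandMove n lo hi := by
  induction h using Nat.decreasingInduction with
  | self =>
    rw [strandMove_eq_mul (show k < hi by omega) hn, strandMove_eq_mul hlh hn, mul_assoc,
      mul_assoc, ← mul_assoc (gen n (k + 1)) (gen n k), ← gen_braid (by omega), ← mul_assoc,
      ← mul_assoc, strandMove_mul_gen_of_lt (by omega) (by omega) hn]
    simp only [mul_assoc]
  | of_succ lo hlt ih =>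
    rw [strandMove_eq_mul (show lo < hi by omega) hn, mul_assoc, gen_comm (by omega), ← mul_assoc,
      ih, mul_assoc]

/-- The part of `permBraid f` that puts the first `J` strands in place. -/
def permBraidUpTo (f : Equiv.Perm (Fin n)) (J : ℕ) : Braid n :=
  (((List.finRange n).take J).map fun j => strandMove n (j.1 - crossedFromLeft f j) j.1).prod

lemma permBraidUpTo_succ (f : Equiv.Perm (Fin n)) (j : Fin n) :
    permBraidUpTo f (j.1 + 1) =
      permBraidUpTo f j.1 * strandMove n (j.1 - crossedFromLeft f j) j.1 := by
  simp [permBraidUpTo, List.take_add_one]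

lemma permBraid_eq_permBraidUpTo (f : Equiv.Perm (Fin n)) : permBraid f = permBraidUpTo f n := by
  rw [permBraidUpTo, List.take_of_length_le (by simp), permBraid, permWord]
  generalize List.finRange n = L
  induction L with
  | nil => rfl
  | cons j L ih => rw [List.flatMap_cons, ofWord_append, ih]; simp [strandMove]

/-- The rank matrix of a permutation: the number of strands among the first `J` that end on the
left of the position `k`. -/
def rankMatrix (f : Equiv.Perm (Fin n)) (J k : ℕ) : ℕ :=
  (Finset.univ.filter fun i : Fin n => i.1 < J ∧ (f i).1 < k).card

lemma rankMatrix_symm (f : Equiv.Perm (Fin n)) (J k : ℕ) :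
    rankMatrix f.symm k J = rankMatrix f J k :=
  Finset.card_equiv f.symm (by simp [and_comm])

lemma rankMatrix_succ_left (f : Equiv.Perm (Fin n)) (j : Fin n) (k : ℕ) :
    rankMatrix f (j.1 + 1) k = rankMatrix f j.1 k + if (f j).1 < k then 1 else 0 := by
  have h (i : Fin n) : (if i.1 < j.1 + 1 ∧ (f i).1 < k then 1 else 0) =
      (if i.1 < j.1 ∧ (f i).1 < k then 1 else 0) +
        if i = j then (if (f j).1 < k then 1 else 0) else 0 := by
    grind
  simp only [rankMatrix, Finset.card_filter, h, Finset.sum_add_distrib, Finset.sum_ite_eq',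
    Finset.mem_univ, if_true]

lemma rankMatrix_succ_right (f : Equiv.Perm (Fin n)) (J : ℕ) (k : Fin n) :
    rankMatrix f J (k.1 + 1) = rankMatrix f J k.1 + if (f.symm k).1 < J then 1 else 0 := by
  rw [← rankMatrix_symm f, ← rankMatrix_symm f J, rankMatrix_succ_left]

lemma rankMatrix_mono_right (f : Equiv.Perm (Fin n)) (J : ℕ) : Monotone (rankMatrix f J) :=
  fun _ _ h => Finset.card_le_card <| Finset.monotone_filter_right _
    fun _ _ hi => ⟨hi.1, hi.2.trans_le h⟩

lemma rankMatrix_top_left (f : Equiv.Perm (Fin n)) {k : ℕ} (hk : k ≤ n) :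
    rankMatrix f n k = k := by
  induction k with
  | zero => simp [rankMatrix]
  | succ k ih =>
    rw [rankMatrix_succ_right f n ⟨k, hk⟩, ih (by omega), if_pos (Fin.is_lt _)]

lemma rankMatrix_top_right (f : Equiv.Perm (Fin n)) {J : ℕ} (hJ : J ≤ n) :
    rankMatrix f J n = J := by
  rw [← rankMatrix_symm, rankMatrix_top_left _ hJ]

lemma crossedFromLeft_add_rankMatrix (f : Equiv.Perm (Fin n)) (j : Fin n) :
    crossedFromLeft f j + rankMatrix f j.1 (f j).1 = j.1 := by
  have h (i : Fin n) : ((if i < j ∧ f j < f i then 1 else 0) +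
      if i.1 < j.1 ∧ (f i).1 < (f j).1 then 1 else 0) = if i < j then 1 else 0 := by
    have : f i = f j → i = j := fun e => f.injective e
    grind
  rw [crossedFromLeft, rankMatrix, Finset.card_filter, Finset.card_filter,
    ← Finset.sum_add_distrib, Finset.sum_congr rfl fun i _ => h i, ← Finset.card_filter,
    Finset.filter_gt_eq_Iio, Fin.card_Iio]

/-- The permutation in which the strands ending at the positions `s` and `s + 1` are exchanged. -/
def swapEnds (s : Fin (n - 1)) (f : Equiv.Perm (Fin n)) : Equiv.Perm (Fin n) :=
  Equiv.swap (leftPos s) (rightPos s) * f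

lemma swapEnds_apply (s : Fin (n - 1)) (f : Equiv.Perm (Fin n)) (i : Fin n) :
    swapEnds s f i = Equiv.swap (leftPos s) (rightPos s) (f i) := rfl

lemma swapEnds_swapEnds (s : Fin (n - 1)) (f : Equiv.Perm (Fin n)) :
    swapEnds s (swapEnds s f) = f := by
  simp [swapEnds, ← mul_assoc]

lemma swapEnds_symm_left (s : Fin (n - 1)) (f : Equiv.Perm (Fin n)) :
    (swapEnds s f).symm (leftPos s) = f.symm (rightPos s) := by
  simp [Equiv.symm_apply_eq, swapEnds_apply]

lemma swapEnds_symm_right (s : Fin (n - 1)) (f : Equiv.Perm (Fin n)) :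
    (swapEnds s f).symm (rightPos s) = f.symm (leftPos s) := by
  simp [Equiv.symm_apply_eq, swapEnds_apply]

lemma swap_val (s : Fin (n - 1)) (a : Fin n) :
    (Equiv.swap (leftPos s) (rightPos s) a).1 =
      if a.1 = s.1 then s.1 + 1 else if a.1 = s.1 + 1 then s.1 else a.1 := by
  rw [Equiv.swap_apply_def]
  simp only [leftPos, rightPos, Fin.ext_iff]
  split_ifs <;> rfl

lemma crossedFromLeft_swapEnds (s : Fin (n - 1)) (f : Equiv.Perm (Fin n))
    (h : f.symm (leftPos s) < f.symm (rightPos s)) (j : Fin n) :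
    crossedFromLeft (swapEnds s f) j =
      crossedFromLeft f j + if j = f.symm (rightPos s) then 1 else 0 := by
  have hterm (i : Fin n) : (if i < j ∧ swapEnds s f j < swapEnds s f i then 1 else 0) =
      (if i < j ∧ f j < f i then 1 else 0) + if i = f.symm (leftPos s) then
        (if j = f.symm (rightPos s) then 1 else 0) else 0 := by
    simp only [Fin.lt_def, swapEnds_apply, swap_val, Equiv.eq_symm_apply]
    have hij : f i = f j → i = j := fun e => f.injective e
    have hji : f i = rightPos s → f j = leftPos s → j < i := fun hi hj => by
      rwa [← Equiv.eq_symm_apply .. |>.2 hi, ← Equiv.eq_symm_apply .. |>.2 hj] at h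
    have hlt : f i = leftPos s → f j = rightPos s → i < j := fun hi hj => by
      rwa [← Equiv.eq_symm_apply .. |>.2 hi, ← Equiv.eq_symm_apply .. |>.2 hj] at h
    simp only [Fin.ext_iff, leftPos, rightPos] at hij hji hlt ⊢
    grind
  simp only [crossedFromLeft, Finset.card_filter, hterm, Finset.sum_add_distrib,
    Finset.sum_ite_eq', Finset.mem_univ, if_true]

section SwapEnds

variable (s : Fin (n - 1)) (f : Equiv.Perm (Fin n))

lemma permBraidUpTo_swapEnds_of_le (h : f.symm (leftPos s) < f.symm (rightPos s)) {J : ℕ}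
    (hJ : J ≤ (f.symm (rightPos s)).1) :
    permBraidUpTo (swapEnds s f) J = permBraidUpTo f J := by
  induction J with
  | zero => rfl
  | succ J ih =>
    have hJn : J < n := by omega
    rw [permBraidUpTo_succ f ⟨J, hJn⟩, permBraidUpTo_succ (swapEnds s f) ⟨J, hJn⟩, ih (by omega),
      crossedFromLeft_swapEnds s f h, if_neg (by simp only [Fin.ext_iff]; omega), add_zero]

lemma permBraidUpTo_swapEnds_succ (h : f.symm (leftPos s) < f.symm (rightPos s)) :
    permBraidUpTo (swapEnds s f) ((f.symm (rightPos s)).1 + 1) =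
      permBraidUpTo f ((f.symm (rightPos s)).1 + 1) *
        gen n (rankMatrix f ((f.symm (rightPos s)).1 + 1) s.1) := by
  set r := f.symm (rightPos s) with hr
  have hfr : f r = rightPos s := by simp [hr]
  have rank_left : rankMatrix f r.1 (s.1 + 1) = rankMatrix f r.1 s.1 + 1 :=
    (rankMatrix_succ_right f r.1 (leftPos s)).trans (by rw [if_pos (Fin.lt_def.1 h)]; rfl)
  have hcross := crossedFromLeft_add_rankMatrix f r
  have hrank := rankMatrix_succ_left f r s.1
  simp only [hfr, rightPos, rank_left, Nat.not_succ_lt_self, if_false, add_zero] at hcross hrank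
  rw [permBraidUpTo_succ, permBraidUpTo_succ, permBraidUpTo_swapEnds_of_le s f h le_rfl,
    crossedFromLeft_swapEnds s f h, if_pos rfl, hrank, mul_assoc,
    strandMove_eq_mul (by omega) (by omega)]
  grind

lemma permBraidUpTo_swapEnds_of_lt (h : f.symm (leftPos s) < f.symm (rightPos s)) {J : ℕ}
    (hr : (f.symm (rightPos s)).1 < J) (hJ : J ≤ n) :
    permBraidUpTo (swapEnds s f) J = permBraidUpTo f J * gen n (rankMatrix f J s.1) := by
  set l := f.symm (leftPos s) with hl
  set r := f.symm (rightPos s) with hr'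
  have hfl : f l = leftPos s := by simp [hl]
  have hfr : f r = rightPos s := by simp [hr']
  have rank_left (J : ℕ) :
      rankMatrix f J (s.1 + 1) = rankMatrix f J s.1 + if l.1 < J then 1 else 0 :=
    rankMatrix_succ_right f J (leftPos s)
  have rank_right (J : ℕ) :
      rankMatrix f J (s.1 + 1 + 1) = rankMatrix f J (s.1 + 1) + if r.1 < J then 1 else 0 :=
    rankMatrix_succ_right f J (rightPos s)
  induction J, hr using Nat.le_induction with
  | base => exact permBraidUpTo_swapEnds_succ s f h
  | succ J hJr ih =>
    obtain ⟨j, rfl⟩ : ∃ j : Fin n, j.1 = J := ⟨⟨J, hJ⟩, rfl⟩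
    have hjl : f j ≠ leftPos s := fun e => by
      have := f.injective (e.trans hfl.symm)
      omega
    have hjr : f j ≠ rightPos s := fun e => by
      have := f.injective (e.trans hfr.symm)
      omega
    have hcross := crossedFromLeft_add_rankMatrix f j
    have htop := rankMatrix_top_right f j.2.le
    have hmono := rankMatrix_mono_right f j.1
    specialize rank_left j.1
    specialize rank_right j.1
    rw [if_pos (by omega)] at rank_left rank_right
    rw [permBraidUpTo_succ, permBraidUpTo_succ, ih (by omega), crossedFromLeft_swapEnds s f h,
      if_neg (by omega), add_zero, mul_assoc, mul_assoc, rankMatrix_succ_left]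
    simp only [ne_eq, Fin.ext_iff, leftPos, rightPos] at hjl hjr
    congr 1
    split_ifs with hlt
    · have := hmono hlt.le
      have := hmono (show s.1 + 1 + 1 ≤ n by omega)
      exact (strandMove_mul_gen_of_ge (by omega) (by omega) (by omega)).symm
    · have := hmono (show s.1 + 1 + 1 ≤ (f j).1 by omega)
      exact (strandMove_mul_gen_of_lt (by omega) (by omega) (by omega)).symm

lemma permBraid_swapEnds (h : f.symm (leftPos s) < f.symm (rightPos s)) :
    permBraid (swapEnds s f) = permBraid f * σ s := by
  rw [permBraid_eq_permBraidUpTo, permBraid_eq_permBraidUpTo,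
    permBraidUpTo_swapEnds_of_lt s f h (Fin.is_lt _) le_rfl, rankMatrix_top_left f (by omega),
    gen_val]

end SwapEnds

/-- `IsReducedWord w f`: the word `w` is a reduced word of the permutation `f`, that is, each of
its letters makes two strands cross that have not crossed before. -/
inductive IsReducedWord : List (Fin (n - 1)) → Equiv.Perm (Fin n) → Prop
  | nil : IsReducedWord [] 1
  | snoc {w f} (s : Fin (n - 1)) : IsReducedWord w f → f.symm (leftPos s) < f.symm (rightPos s) →
      IsReducedWord (w ++ [s]) (swapEnds s f)

lemma crossedFromLeft_one (j : Fin n) : crossedFromLeft 1 j = 0 := by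
  rw [crossedFromLeft, Finset.card_eq_zero, Finset.filter_eq_empty_iff]
  exact fun i _ h => h.1.asymm h.2

lemma permBraid_one : permBraid (1 : Equiv.Perm (Fin n)) = 1 := by
  simp [permBraid_eq_permBraidUpTo, permBraidUpTo, crossedFromLeft_one, strandMove_self]

lemma eq_one_of_no_descent (f : Equiv.Perm (Fin n))
    (h : ∀ s : Fin (n - 1), f (leftPos s) < f (rightPos s)) : f = 1 := by
  obtain _ | n := n
  · exact Subsingleton.elim _ _
  · have hf : StrictMono f := Fin.strictMono_iff_lt_succ.2 h
    exact DFunLike.coe_injective hf.eq_id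

lemma exists_isReducedWord (f : Equiv.Perm (Fin n)) :
    ∃ w, IsReducedWord w f ∧ ofWord w = permBraid f := by
  induction hN : ∑ j, crossedFromLeft f j using Nat.strong_induction_on generalizing f with
  | _ N ih =>
  by_cases hd : ∀ s : Fin (n - 1), f.symm (leftPos s) < f.symm (rightPos s)
  · obtain rfl : f = 1 := inv_eq_one.1 (eq_one_of_no_descent f.symm hd)
    exact ⟨[], IsReducedWord.nil, permBraid_one.symm⟩
  · push Not at hd
    obtain ⟨s, hs⟩ := hd
    obtain ⟨g, rfl⟩ : ∃ g, f = swapEnds s g := ⟨_, (swapEnds_swapEnds s f).symm⟩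
    rw [swapEnds_symm_left, swapEnds_symm_right] at hs
    replace hs := hs.lt_of_ne fun e => leftPos_ne_rightPos s (g.symm.injective e)
    have hcross : ∑ j, crossedFromLeft g j < N := by
      simp [← hN, crossedFromLeft_swapEnds s g hs, Finset.sum_add_distrib]
    obtain ⟨w, hw, hwg⟩ := ih _ hcross g rfl
    exact ⟨w ++ [s], hw.snoc s hs, by
      rw [ofWord_append, hwg, ofWord_singleton, permBraid_swapEnds s g hs]⟩

/-- The position at which the strand of a braid word starting at the position `i` ends. -/
def wordEnd (w : List (Fin (n - 1))) (i : Fin n) : Fin n :=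
  w.foldl (fun a s => Equiv.swap (leftPos s) (rightPos s) a) i

lemma IsReducedWord.wordEnd_eq {w : List (Fin (n - 1))} {f : Equiv.Perm (Fin n)}
    (h : IsReducedWord w f) (i : Fin n) : wordEnd w i = f i := by
  induction h with
  | nil => rfl
  | snoc _ _ _ ih => simp [wordEnd, swapEnds, ← ih]

lemma crossings_append (u v : List (Fin (n - 1))) (i j : Fin n) :
    crossings (u ++ v) i j = crossings u i j + crossings v (wordEnd u i) (wordEnd u j) := by
  induction u generalizing i j with
  | nil => simp [crossings, wordEnd]
  | cons t u ih => rw [List.cons_append, crossings, ih, crossings, ← add_assoc]; rfl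

lemma crossings_comm (w : List (Fin (n - 1))) (i j : Fin n) :
    crossings w i j = crossings w j i := by
  induction w generalizing i j with
  | nil => rfl
  | cons s w ih =>
    rw [crossings, crossings, ih]
    congr 2
    grind

lemma IsReducedWord.crossings_le_one {w : List (Fin (n - 1))} {f : Equiv.Perm (Fin n)}
    (h : IsReducedWord w f) {i j : Fin n} (hij : i ≠ j) : crossings w i j ≤ 1 := by
  wlog hlt : i < j generalizing i j
  · exact crossings_comm w i j ▸ this hij.symm (lt_of_le_of_ne (not_lt.1 hlt) hij.symm)
  suffices crossings w i j = if f j < f i then 1 else 0 by rw [this]; split_ifs <;> simp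
  induction h with
  | nil => simp [crossings, hlt.not_gt]
  | @snoc w f s h hs ih =>
    have huncrossed : ¬ (f i = rightPos s ∧ f j = leftPos s) := fun e => by
      simp only [← e.1, ← e.2, Equiv.symm_apply_apply] at hs
      exact hs.not_gt hlt
    rw [crossings_append, h.wordEnd_eq, h.wordEnd_eq, ih]
    simp only [crossings, swapEnds_apply, Fin.lt_def, swap_val, add_zero]
    simp only [Fin.ext_iff, leftPos, rightPos] at huncrossed ⊢
    split_ifs <;> omega

lemma isPermutationBraid_permBraid (f : Equiv.Perm (Fin n)) : IsPermutationBraid (permBraid f) :=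
  let ⟨w, hw, hwf⟩ := exists_isReducedWord f
  ⟨w, hwf, fun _ _ hij => hw.crossings_le_one hij⟩

lemma mem_finishingSet_permBraid {f : Equiv.Perm (Fin n)} {s : Fin (n - 1)}
    (h : f.symm (rightPos s) < f.symm (leftPos s)) : s ∈ finishingSet (permBraid f) := by
  refine ⟨permBraid (swapEnds s f), isPermutationBraid_permBraid _, ?_⟩
  rw [← permBraid_swapEnds s (swapEnds s f) (by rwa [swapEnds_symm_left, swapEnds_symm_right]),
    swapEnds_swapEnds]

end Braid

/-! ### The Lawrence–Krammer representation -/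

namespace Braid

variable {n : ℕ}

/-- The action of the `s`-th Artin generator in the dual Lawrence–Krammer representation. A braid
acts from the right on functions of pairs `i < j` of punctures; the values of `φ` at other pairs
are kept and play no role. The parameter `q` of the representation is specialised to `1 / 2`, the
parameter `t` is kept, and the standard basis is rescaled so that the coefficients do not depend on
the pair. -/
noncomputable def lkAct (t : ℝ) (s : ℕ) (φ : ℕ → ℕ → ℝ) (i j : ℕ) : ℝ :=
  if j ≤ i then φ i j
  else if i = s then
    if j = s + 1 then t / 4 * φ s (s + 1) else φ (s + 1) j - t / 4 * φ s (s + 1)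
  else if i = s + 1 then (φ s j + φ (s + 1) j) / 2
  else if j = s then (φ i s + φ i (s + 1)) / 2
  else if j = s + 1 then φ i s - t / 4 * φ s (s + 1)
  else if i < s ∧ s + 1 < j then φ i j + t / 4 * φ s (s + 1)
  else φ i j

/-- The inverse of `lkAct`, for `t ≠ 0`. -/
noncomputable def lkInv (t : ℝ) (s : ℕ) (φ : ℕ → ℕ → ℝ) (i j : ℕ) : ℝ :=
  if j ≤ i then φ i j
  else if i = s then
    if j = s + 1 then 4 / t * φ s (s + 1) else 2 * φ (s + 1) j - φ s j - φ s (s + 1)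
  else if i = s + 1 then φ s j + φ s (s + 1)
  else if j = s then φ i (s + 1) + φ s (s + 1)
  else if j = s + 1 then 2 * φ i s - φ i (s + 1) - φ s (s + 1)
  else if i < s ∧ s + 1 < j then φ i j - φ s (s + 1)
  else φ i j

section Values

variable (t : ℝ) {s i j : ℕ} (φ : ℕ → ℕ → ℝ)

lemma lkAct_of_le (h : j ≤ i) : lkAct t s φ i j = φ i j := if_pos h

lemma lkAct_self (hi : i = s) (hj : j = s + 1) : lkAct t s φ i j = t / 4 * φ s (s + 1) := by
  grind [lkAct]

lemma lkAct_left (hi : i = s) (hj : s + 1 < j) :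
    lkAct t s φ i j = φ (s + 1) j - t / 4 * φ s (s + 1) := by
  grind [lkAct]

lemma lkAct_left_succ (hi : i = s + 1) (hj : s + 1 < j) :
    lkAct t s φ i j = (φ s j + φ (s + 1) j) / 2 := by
  grind [lkAct]

lemma lkAct_right (hi : i < s) (hj : j = s) :
    lkAct t s φ i j = (φ i s + φ i (s + 1)) / 2 := by
  grind [lkAct]

lemma lkAct_right_succ (hi : i < s) (hj : j = s + 1) :
    lkAct t s φ i j = φ i s - t / 4 * φ s (s + 1) := by
  grind [lkAct]

lemma lkAct_around (hi : i < s) (hj : s + 1 < j) :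
    lkAct t s φ i j = φ i j + t / 4 * φ s (s + 1) := by
  grind [lkAct]

lemma lkAct_lt (hj : j < s) : lkAct t s φ i j = φ i j := by
  grind [lkAct]

lemma lkAct_gt (hi : s + 1 < i) : lkAct t s φ i j = φ i j := by
  grind [lkAct]

end Values

lemma lkInv_lkAct {t : ℝ} (ht : t ≠ 0) (s : ℕ) (φ : ℕ → ℕ → ℝ) :
    lkInv t s (lkAct t s φ) = φ := by
  funext i j
  grind [lkInv, lkAct]

lemma lkAct_lkInv {t : ℝ} (ht : t ≠ 0) (s : ℕ) (φ : ℕ → ℕ → ℝ) :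
    lkAct t s (lkInv t s φ) = φ := by
  funext i j
  grind [lkInv, lkAct]

lemma lkAct_comm (t : ℝ) {r s : ℕ} (h : r + 1 < s) (φ : ℕ → ℕ → ℝ) :
    lkAct t s (lkAct t r φ) = lkAct t r (lkAct t s φ) := by
  funext i j
  rcases le_or_gt j i with hij | hij
  · simp (disch := omega) only [lkAct_of_le]
  have hi : i < r ∨ i = r ∨ i = r + 1 ∨ r + 1 < i ∧ i < s ∨ i = s ∨ i = s + 1 ∨ s + 1 < i := by
    omega
  have hj : j < r ∨ j = r ∨ j = r + 1 ∨ r + 1 < j ∧ j < s ∨ j = s ∨ j = s + 1 ∨ s + 1 < j := by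
    omega
  rcases hi with hi | hi | hi | hi | hi | hi | hi <;>
    rcases hj with hj | hj | hj | hj | hj | hj | hj <;>
  first
  | omega
  | (simp (disch := omega) only [lkAct_lt, lkAct_gt, lkAct_self, lkAct_left, lkAct_left_succ,
      lkAct_right, lkAct_right_succ, lkAct_around]; done)
  | (simp (disch := omega) only [lkAct_lt, lkAct_gt, lkAct_left, lkAct_left_succ,
      lkAct_right, lkAct_right_succ, lkAct_around, hi, hj]; ring)

lemma lkAct_braid (t : ℝ) (s : ℕ) (φ : ℕ → ℕ → ℝ) :
    lkAct t s (lkAct t (s + 1) (lkAct t s φ)) =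
      lkAct t (s + 1) (lkAct t s (lkAct t (s + 1) φ)) := by
  funext i j
  rcases le_or_gt j i with hij | hij
  · simp (disch := omega) only [lkAct_of_le]
  have hi : i < s ∨ i = s ∨ i = s + 1 ∨ i = s + 2 ∨ s + 2 < i := by omega
  have hj : j < s ∨ j = s ∨ j = s + 1 ∨ j = s + 2 ∨ s + 2 < j := by omega
  rcases hi with hi | hi | hi | hi | hi <;> rcases hj with hj | hj | hj | hj | hj <;>
  first
  | omega
  | (simp (disch := omega) only [lkAct_lt, lkAct_gt, lkAct_self, lkAct_left, lkAct_left_succ,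
      lkAct_right, lkAct_right_succ, lkAct_around]; done)
  | (simp (disch := omega) only [lkAct_lt, lkAct_gt, lkAct_self, lkAct_left, lkAct_left_succ,
      lkAct_right, lkAct_right_succ, lkAct_around, hi, hj]; ring)

/-- The operator `lkAct` as a permutation of the functions of pairs, for `t ≠ 0`. -/
noncomputable def lkPerm {t : ℝ} (ht : t ≠ 0) (s : ℕ) : Equiv.Perm (ℕ → ℕ → ℝ) where
  toFun := lkAct t s
  invFun := lkInv t s
  left_inv := lkInv_lkAct ht s
  right_inv := lkAct_lkInv ht s

/-- The dual Lawrence–Krammer representation of the braid group at `q = 1 / 2`, for `t ≠ 0`. It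
acts on functions of all pairs of natural numbers, of which only the pairs `i < j < n` matter. -/
noncomputable def lkRep (n : ℕ) {t : ℝ} (ht : t ≠ 0) :
    Braid n →* (Equiv.Perm (ℕ → ℕ → ℝ))ᵐᵒᵖ :=
  PresentedGroup.toGroup (f := fun s : Fin (n - 1) => MulOpposite.op (lkPerm ht s.1)) (by
    rintro r ⟨i, j, ⟨h, rfl⟩ | ⟨h, rfl⟩⟩
    · rw [map_mul, map_inv, mul_inv_eq_one]
      simp only [map_mul, FreeGroup.lift_apply_of, ← MulOpposite.op_mul]
      congr 1
      ext1 φ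
      exact lkAct_comm t h φ
    · rw [map_mul, map_inv, mul_inv_eq_one]
      simp only [map_mul, FreeGroup.lift_apply_of, ← MulOpposite.op_mul, ← h]
      congr 1
      ext1 φ
      exact lkAct_braid t i.1 φ)

/-- The action of a positive word in the dual Lawrence–Krammer representation. Unlike `lkRep` it
is also defined at `t = 0`. -/
noncomputable def lkWord (t : ℝ) (w : List (Fin (n - 1))) (φ : ℕ → ℕ → ℝ) : ℕ → ℕ → ℝ :=
  w.foldl (fun ψ s => lkAct t s.1 ψ) φ

lemma lkWord_append (t : ℝ) (u v : List (Fin (n - 1))) (φ : ℕ → ℕ → ℝ) :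
    lkWord t (u ++ v) φ = lkWord t v (lkWord t u φ) := List.foldl_append

lemma lkRep_ofWord {t : ℝ} (ht : t ≠ 0) (w : List (Fin (n - 1))) (φ : ℕ → ℕ → ℝ) :
    (lkRep n ht (ofWord w)).unop φ = lkWord t w φ := by
  induction w generalizing φ with
  | nil => simp [ofWord, lkWord]
  | cons s w ih =>
    have hσ : (lkRep n ht (σ s)).unop φ = lkAct t s.1 φ := by
      rw [lkRep, σ, PresentedGroup.toGroup.of]
      rfl
    rw [ofWord_cons, map_mul, MulOpposite.unop_mul, Equiv.Perm.mul_apply, ih, hσ]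
    rfl

lemma continuous_lkWord (w : List (Fin (n - 1))) {Φ : ℝ → ℕ → ℕ → ℝ}
    (hΦ : ∀ i j, Continuous fun t => Φ t i j) (i j : ℕ) :
    Continuous fun t => lkWord t w (Φ t) i j := by
  induction w generalizing Φ i j with
  | nil => exact hΦ i j
  | cons s _ ih =>
    refine ih (Φ := fun t => lkAct t s.1 (Φ t)) (fun i j => ?_) i j
    unfold lkAct
    split_ifs <;> fun_prop

lemma lkWord_congr (t : ℝ) {u v : List (Fin (n - 1))} (h : ofWord u = ofWord v)
    (φ : ℕ → ℕ → ℝ) : lkWord t u φ = lkWord t v φ := by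
  funext i j
  have heq : Set.EqOn (fun t => lkWord t u φ i j) (fun t => lkWord t v φ i j) {(0 : ℝ)}ᶜ :=
    fun t (ht : t ≠ 0) => by simp only [← lkRep_ofWord ht, h]
  exact congrFun (Continuous.ext_on (dense_compl_singleton 0)
    (continuous_lkWord u (Φ := fun _ => φ) (fun _ _ => continuous_const) i j)
    (continuous_lkWord v (Φ := fun _ => φ) (fun _ _ => continuous_const) i j) heq) t

end Braid

/-! ### Uniqueness of left weighted products -/

namespace Braid

variable {n : ℕ}

lemma leftPos_lt_rightPos (s : Fin (n - 1)) : leftPos s < rightPos s :=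
  Fin.lt_def.2 (Nat.lt_succ_self s.1)

lemma lkAct_zero_nonneg {φ : ℕ → ℕ → ℝ} (h : ∀ i j, 0 ≤ φ i j) (s i j : ℕ) :
    0 ≤ lkAct 0 s φ i j := by
  have h₁ := h i j
  have h₂ := h (s + 1) j
  have h₃ := h s j
  have h₄ := h i s
  have h₅ := h i (s + 1)
  unfold lkAct
  split_ifs <;> linarith

lemma lkWord_zero_nonneg (w : List (Fin (n - 1))) {φ : ℕ → ℕ → ℝ} (h : ∀ i j, 0 ≤ φ i j)
    (i j : ℕ) : 0 ≤ lkWord 0 w φ i j := by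
  induction w generalizing φ with
  | nil => exact h i j
  | cons s _ ih => exact ih (lkAct_zero_nonneg h s.1)

/-- The first puncture `a` of a pair receives a contribution from the first puncture `a'` of a pair
under the action of the `s`-th Artin generator at `t = 0`. -/
def StepLeft (s : Fin (n - 1)) (a' a : Fin n) : Prop :=
  (a = leftPos s → a' = rightPos s) ∧ (a = rightPos s → a' = leftPos s ∨ a' = rightPos s) ∧
    (a ≠ leftPos s → a ≠ rightPos s → a' = a)

/-- The second puncture `b` of a pair receives a contribution from the second puncture `b'` of a
pair under the action of the `s`-th Artin generator at `t = 0`. -/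
def StepRight (s : Fin (n - 1)) (b' b : Fin n) : Prop :=
  (b = rightPos s → b' = leftPos s) ∧ (b = leftPos s → b' = leftPos s ∨ b' = rightPos s) ∧
    (b ≠ leftPos s → b ≠ rightPos s → b' = b)

section Step

variable {s : Fin (n - 1)} {a a' : Fin n}

lemma stepLeft_leftPos_iff : StepLeft s a' (leftPos s) ↔ a' = rightPos s := by
  simp [StepLeft, leftPos_ne_rightPos]

lemma stepLeft_rightPos_iff :
    StepLeft s a' (rightPos s) ↔ a' = leftPos s ∨ a' = rightPos s := by
  simp [StepLeft, (leftPos_ne_rightPos s).symm]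

lemma stepLeft_iff_eq (hl : a ≠ leftPos s) (hr : a ≠ rightPos s) :
    StepLeft s a' a ↔ a' = a := by
  simp [StepLeft, hl, hr]

lemma stepRight_leftPos_iff :
    StepRight s a' (leftPos s) ↔ a' = leftPos s ∨ a' = rightPos s := by
  simp [StepRight, leftPos_ne_rightPos]

lemma stepRight_rightPos_iff : StepRight s a' (rightPos s) ↔ a' = leftPos s := by
  simp [StepRight, (leftPos_ne_rightPos s).symm]

lemma stepRight_iff_eq (hl : a ≠ leftPos s) (hr : a ≠ rightPos s) :
    StepRight s a' a ↔ a' = a := by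
  simp [StepRight, hl, hr]

end Step

lemma lkAct_zero_pos_iff {φ : ℕ → ℕ → ℝ} (hφ : ∀ i j, 0 ≤ φ i j) (s : Fin (n - 1)) {a b : Fin n}
    (hab : a < b) : 0 < lkAct 0 s.1 φ a.1 b.1 ↔
      ∃ a' b' : Fin n, a' < b' ∧ StepLeft s a' a ∧ StepRight s b' b ∧ 0 < φ a'.1 b'.1 := by
  have hadd (x y z w : ℕ) : 0 < (φ x y + φ z w) / 2 ↔ 0 < φ x y ∨ 0 < φ z w := by
    have := hφ x y
    have := hφ z w
    grind
  rcases eq_or_ne a (leftPos s) with rfl | hal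
  · rcases eq_or_ne b (rightPos s) with rfl | hbr
    · have hzero : lkAct 0 s.1 φ (leftPos s).1 (rightPos s).1 = 0 := by
        grind [lkAct, leftPos, rightPos]
      simp [stepLeft_leftPos_iff, stepRight_rightPos_iff, hzero, hab.not_gt]
    · have hlt : rightPos s < b := by grind [rightPos, leftPos]
      have hval : lkAct 0 s.1 φ (leftPos s).1 b.1 = φ (rightPos s).1 b.1 := by
        grind [lkAct, leftPos, rightPos]
      simp [stepLeft_leftPos_iff, stepRight_iff_eq hab.ne' hbr, hlt, hval]
  rcases eq_or_ne a (rightPos s) with rfl | har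
  · have hlt := (leftPos_lt_rightPos s).trans hab
    have hval : lkAct 0 s.1 φ (rightPos s).1 b.1 =
        (φ (leftPos s).1 b.1 + φ (rightPos s).1 b.1) / 2 := by
      grind [lkAct, leftPos, rightPos]
    simp [stepLeft_rightPos_iff, stepRight_iff_eq hlt.ne' hab.ne', hab, hlt, or_and_right,
      and_or_left, exists_or, hval, hadd]
  simp only [stepLeft_iff_eq hal har]
  rcases eq_or_ne b (leftPos s) with rfl | hbl
  · have hlt := hab.trans (leftPos_lt_rightPos s)
    have hval : lkAct 0 s.1 φ a.1 (leftPos s).1 =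
        (φ a.1 (leftPos s).1 + φ a.1 (rightPos s).1) / 2 := by
      grind [lkAct, leftPos, rightPos]
    simp [stepRight_leftPos_iff, hab, hlt, or_and_right, and_or_left, exists_or, hval, hadd]
  rcases eq_or_ne b (rightPos s) with rfl | hbr
  · have hlt : a < leftPos s := by grind [rightPos, leftPos]
    have hval : lkAct 0 s.1 φ a.1 (rightPos s).1 = φ a.1 (leftPos s).1 := by
      grind [lkAct, leftPos, rightPos]
    simp [stepRight_rightPos_iff, hlt, hval]
  · have hval : lkAct 0 s.1 φ a.1 b.1 = φ a.1 b.1 := by grind [lkAct, leftPos, rightPos]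
    simp [stepRight_iff_eq hbl hbr, hab, hval]

/-- The first puncture `i` of a pair contributes to the first puncture `a` of a pair under the
action of a reduced word of `f` at `t = 0`. -/
def SpreadsLeft (f : Equiv.Perm (Fin n)) (i a : Fin n) : Prop := f.symm a ≤ i ∧ f i ≤ a

/-- The second puncture `j` of a pair contributes to the second puncture `b` of a pair under the
action of a reduced word of `f` at `t = 0`. -/
def SpreadsRight (f : Equiv.Perm (Fin n)) (j b : Fin n) : Prop := j ≤ f.symm b ∧ b ≤ f j

lemma swapEnds_symm_of_ne {s : Fin (n - 1)} {f : Equiv.Perm (Fin n)} {a : Fin n}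
    (hl : a ≠ leftPos s) (hr : a ≠ rightPos s) : (swapEnds s f).symm a = f.symm a := by
  rw [Equiv.symm_apply_eq, swapEnds_apply, Equiv.apply_symm_apply,
    Equiv.swap_apply_of_ne_of_ne hl hr]

section SwapEnds

variable {s : Fin (n - 1)} {f : Equiv.Perm (Fin n)}

lemma spreadsLeft_swapEnds_iff (h : f.symm (leftPos s) < f.symm (rightPos s))
    {i a : Fin n} :
    SpreadsLeft (swapEnds s f) i a ↔ ∃ a', StepLeft s a' a ∧ SpreadsLeft f i a' := by
  have hl : f i = leftPos s → i = f.symm (leftPos s) := f.eq_symm_apply.2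
  have hr : f i = rightPos s → i = f.symm (rightPos s) := f.eq_symm_apply.2
  rcases eq_or_ne a (leftPos s) with rfl | hal
  · simp only [stepLeft_leftPos_iff, exists_eq_left, SpreadsLeft, swapEnds_symm_left,
      swapEnds_apply, Fin.le_def, swap_val]
    grind [leftPos, rightPos]
  rcases eq_or_ne a (rightPos s) with rfl | har
  · simp only [stepLeft_rightPos_iff, or_and_right, exists_or, exists_eq_left, SpreadsLeft,
      swapEnds_symm_right, swapEnds_apply, Fin.le_def, swap_val]
    grind [leftPos, rightPos]
  · simp only [stepLeft_iff_eq hal har, exists_eq_left, SpreadsLeft, swapEnds_symm_of_ne hal har,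
      swapEnds_apply, Fin.le_def, swap_val]
    grind [leftPos, rightPos]

lemma spreadsRight_swapEnds_iff (h : f.symm (leftPos s) < f.symm (rightPos s))
    {j b : Fin n} :
    SpreadsRight (swapEnds s f) j b ↔ ∃ b', StepRight s b' b ∧ SpreadsRight f j b' := by
  have hl : f j = leftPos s → j = f.symm (leftPos s) := f.eq_symm_apply.2
  have hr : f j = rightPos s → j = f.symm (rightPos s) := f.eq_symm_apply.2
  rcases eq_or_ne b (leftPos s) with rfl | hbl
  · simp only [stepRight_leftPos_iff, or_and_right, exists_or, exists_eq_left, SpreadsRight,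
      swapEnds_symm_left, swapEnds_apply, Fin.le_def, swap_val]
    grind [leftPos, rightPos]
  rcases eq_or_ne b (rightPos s) with rfl | hbr
  · simp only [stepRight_rightPos_iff, exists_eq_left, SpreadsRight, swapEnds_symm_right,
      swapEnds_apply, Fin.le_def, swap_val]
    grind [leftPos, rightPos]
  · simp only [stepRight_iff_eq hbl hbr, exists_eq_left, SpreadsRight,
      swapEnds_symm_of_ne hbl hbr, swapEnds_apply, Fin.le_def, swap_val]
    grind [leftPos, rightPos]

end SwapEnds

lemma IsReducedWord.lkWord_zero_pos_iff {w : List (Fin (n - 1))} {f : Equiv.Perm (Fin n)}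
    (hw : IsReducedWord w f) {φ : ℕ → ℕ → ℝ} (hφ : ∀ i j, 0 ≤ φ i j) {a b : Fin n} (hab : a < b) :
    0 < lkWord 0 w φ a.1 b.1 ↔
      ∃ i j : Fin n, i < j ∧ 0 < φ i.1 j.1 ∧ SpreadsLeft f i a ∧ SpreadsRight f j b := by
  induction hw generalizing a b with
  | nil =>
    refine ⟨fun h => ⟨a, b, hab, h, ⟨le_rfl, le_rfl⟩, le_rfl, le_rfl⟩, ?_⟩
    rintro ⟨i, j, -, h, hi, hj⟩
    obtain rfl : i = a := le_antisymm hi.2 hi.1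
    obtain rfl : j = b := le_antisymm hj.1 hj.2
    exact h
  | snoc s _ hs ih =>
    rw [lkWord_append]
    change 0 < lkAct 0 s.1 (lkWord 0 _ φ) a.1 b.1 ↔ _
    rw [lkAct_zero_pos_iff (lkWord_zero_nonneg _ hφ) s hab]
    simp only [spreadsLeft_swapEnds_iff hs, spreadsRight_swapEnds_iff hs]
    constructor
    · rintro ⟨a', b', hlt, ha, hb, h⟩
      obtain ⟨i, j, hij, h, hi, hj⟩ := (ih hlt).1 h
      exact ⟨i, j, hij, h, ⟨a', ha, hi⟩, b', hb, hj⟩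
    · rintro ⟨i, j, hij, h, ⟨a', ha, hi⟩, b', hb, hj⟩
      have hlt : a' < b' := by
        by_cases h : a = leftPos s ∧ b = rightPos s
        · obtain rfl := ha.1 h.1
          obtain rfl := hb.1 h.2
          exact absurd (hi.1.trans_lt (hij.trans_le hj.1)) hs.not_gt
        · grind [StepLeft, StepRight, leftPos, rightPos]
      exact ⟨a', b', hlt, ha, hb, (ih hlt).2 ⟨i, j, hij, h, hi, hj⟩⟩

lemma lkWord_zero_eq_zero (w : List (Fin (n - 1))) {φ : ℕ → ℕ → ℝ} (hφ : ∀ i j, 0 ≤ φ i j)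
    (h : ∀ i j : Fin n, i < j → φ i.1 j.1 = 0) {a b : Fin n} (hab : a < b) :
    lkWord 0 w φ a.1 b.1 = 0 := by
  induction w generalizing φ with
  | nil => exact h a b hab
  | cons s _ ih =>
    refine ih (lkAct_zero_nonneg hφ s.1) fun i j hij => ?_
    refine le_antisymm (not_lt.1 fun hpos => ?_) (lkAct_zero_nonneg hφ s.1 i.1 j.1)
    obtain ⟨i', j', hij', -, -, hpos⟩ := (lkAct_zero_pos_iff hφ s hij).1 hpos
    exact hpos.ne' (h i' j' hij')

lemma exists_spreads (f : Equiv.Perm (Fin n)) {i j : Fin n} (hf : f i < f j)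
    (hbetween : ∀ l, i < l → l < j → f l < f i ∨ f j < f l) :
    ∃ m : Fin (n - 1), SpreadsLeft f i (leftPos m) ∧ SpreadsRight f j (rightPos m) := by
  let p (v : ℕ) : Prop := (f j).1 ≤ v ∨ (f i).1 < v ∧ ∃ hv : v < n, i < f.symm ⟨v, hv⟩
  obtain ⟨m, hm, hm'⟩ := Nat.exists_not_and_succ_of_not_zero_of_exists (p := p) (by grind)
    ⟨_, Or.inl le_rfl⟩
  obtain ⟨x, hx⟩ := f.surjective ⟨m, by grind⟩
  obtain ⟨y, hy⟩ := f.surjective ⟨m + 1, by grind⟩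
  have hxi : x ≤ i ∧ (f i).1 ≤ m := by
    have : f i = f x → i = x := fun e => f.injective e
    grind
  have hyj : j ≤ y ∧ m + 1 ≤ (f j).1 := by
    have : f j = f y → j = y := fun e => f.injective e
    have := hbetween y
    grind
  refine ⟨⟨m, by omega⟩, ⟨?_, hxi.2⟩, ?_, hyj.2⟩
  · exact (f.symm_apply_eq.2 hx.symm).trans_le hxi.1
  · exact hyj.1.trans_eq (f.symm_apply_eq.2 hy.symm).symm

/-- The left weightedness of two permutation braids, in terms of their permutations. -/
def LeftWeighted (f g : Equiv.Perm (Fin n)) : Prop :=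
  ∀ s : Fin (n - 1), g (rightPos s) < g (leftPos s) → f.symm (rightPos s) < f.symm (leftPos s)

lemma LeftWeighted.lt_of_spreads {f g : Equiv.Perm (Fin n)} (h : LeftWeighted f g) {i j : Fin n}
    (hij : i < j) {m : Fin (n - 1)} (hi : SpreadsLeft f i (leftPos m))
    (hj : SpreadsRight f j (rightPos m)) : g (leftPos m) < g (rightPos m) := by
  refine lt_of_le_of_ne (not_lt.1 fun hlt => ?_) fun e =>
    leftPos_ne_rightPos m (g.injective e)
  exact (h m hlt).not_gt (hi.1.trans_lt (hij.trans_le hj.1))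

lemma exists_ofWord_eq_prod (F : List (Equiv.Perm (Fin n))) :
    ∃ w : List (Fin (n - 1)), ofWord w = (F.map permBraid).prod := by
  induction F with
  | nil => exact ⟨[], rfl⟩
  | cons f F ih =>
    obtain ⟨w, hw⟩ := ih
    exact ⟨permWord f ++ w, by rw [ofWord_append, hw, List.map_cons, List.prod_cons]; rfl⟩

lemma exists_lkWord_zero_pos {f : Equiv.Perm (Fin n)} {F : List (Equiv.Perm (Fin n))}
    (hF : (f :: F).IsChain LeftWeighted) {w : List (Fin (n - 1))}
    (hw : ofWord w = ((f :: F).map permBraid).prod) {φ : ℕ → ℕ → ℝ} (hφ : ∀ i j, 0 ≤ φ i j)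
    {i j : Fin n} (hij : i < j) (hpos : 0 < φ i.1 j.1) {m : Fin (n - 1)}
    (hi : SpreadsLeft f i (leftPos m)) (hj : SpreadsRight f j (rightPos m)) :
    ∃ a b : Fin n, a < b ∧ 0 < lkWord 0 w φ a.1 b.1 := by
  induction F generalizing f w φ i j m with
  | nil =>
    obtain ⟨u, hu, huf⟩ := exists_isReducedWord f
    refine ⟨leftPos m, rightPos m, leftPos_lt_rightPos m, ?_⟩
    rw [lkWord_congr 0 (v := u) (by simp [hw, huf]),
      hu.lkWord_zero_pos_iff hφ (leftPos_lt_rightPos m)]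
    exact ⟨i, j, hij, hpos, hi, hj⟩
  | cons g F ih =>
    obtain ⟨u, hu, huf⟩ := exists_isReducedWord f
    obtain ⟨v, hv⟩ := exists_ofWord_eq_prod (g :: F)
    have hlt := (List.isChain_cons_cons.1 hF).1.lt_of_spreads hij hi hj
    obtain ⟨m', hi', hj'⟩ := exists_spreads g hlt fun l hl hl' => by
      simp only [Fin.lt_def, leftPos, rightPos] at hl hl'
      omega
    rw [lkWord_congr 0 (v := u ++ v) (by rw [hw, ofWord_append, huf, hv]; rfl), lkWord_append]
    exact ih (List.isChain_cons_cons.1 hF).2 hv (lkWord_zero_nonneg u hφ) (leftPos_lt_rightPos m)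
      ((hu.lkWord_zero_pos_iff hφ (leftPos_lt_rightPos m)).2 ⟨i, j, hij, hpos, hi, hj⟩) hi' hj'

lemma inversion_of_prod_eq_mul {f f' : Equiv.Perm (Fin n)} {F : List (Equiv.Perm (Fin n))}
    (hF : (f :: F).IsChain LeftWeighted) {w : List (Fin (n - 1))}
    (h : ((f :: F).map permBraid).prod = permBraid f' * ofWord w) {i j : Fin n} (hij : i < j)
    (hinv : f' j < f' i) : f j < f i := by
  induction hd : j.1 - i.1 using Nat.strong_induction_on generalizing i j with
  | _ d ih =>
  by_contra hlt
  replace hlt : f i < f j := lt_of_le_of_ne (not_lt.1 hlt) fun e => hij.ne (f.injective e)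
  obtain ⟨m, hi, hj⟩ := exists_spreads f hlt fun l hil hlj => by
    rcases lt_or_ge (f' l) (f' i) with hl | hl
    · exact Or.inl (ih (l.1 - i.1) (by omega) hil hl rfl)
    · exact Or.inr (ih (j.1 - l.1) (by omega) hlj (hinv.trans_le hl) rfl)
  obtain ⟨u, hu, huf⟩ := exists_isReducedWord f'
  let φ (a b : ℕ) : ℝ := if a = i.1 ∧ b = j.1 then 1 else 0
  have hφ (a b : ℕ) : 0 ≤ φ a b := by positivity
  obtain ⟨a, b, hab, hpos⟩ := exists_lkWord_zero_pos hF (w := u ++ w) (φ := φ)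
    (by rw [ofWord_append, huf, h]) hφ hij (by simp [φ]) hi hj
  rw [lkWord_append] at hpos
  refine hpos.ne' (lkWord_zero_eq_zero w (lkWord_zero_nonneg u hφ) (fun x y hxy => ?_) hab)
  refine le_antisymm (not_lt.1 fun hpos => ?_) (lkWord_zero_nonneg u hφ x.1 y.1)
  obtain ⟨i', j', -, hφ', hi', hj'⟩ := (hu.lkWord_zero_pos_iff hφ hxy).1 hpos
  obtain ⟨rfl, rfl⟩ : i' = i ∧ j' = j := by
    simpa [φ, Fin.val_inj] using fun h => hφ'.ne' (if_neg h)
  exact (hi'.2.trans_lt (hxy.trans_le hj'.2)).not_gt hinv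

lemma perm_ext_of_inversions {f g : Equiv.Perm (Fin n)}
    (h : ∀ i j, i < j → (f j < f i ↔ g j < g i)) : f = g := by
  refine (mul_inv_eq_one.1 (eq_one_of_no_descent (g * f⁻¹) fun s => ?_)).symm
  obtain ⟨x, hx⟩ := f.surjective (leftPos s)
  obtain ⟨y, hy⟩ := f.surjective (rightPos s)
  have hlt := leftPos_lt_rightPos s
  rw [← hx, ← hy] at hlt ⊢
  simp only [Equiv.Perm.mul_apply, Equiv.Perm.inv_def, Equiv.symm_apply_apply]
  have hne : x ≠ y := fun e => hlt.ne (congrArg f e)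
  rcases hne.lt_or_gt with hxy | hxy
  · exact lt_of_le_of_ne (not_lt.1 ((not_congr (h x y hxy)).1 hlt.not_gt)) (g.injective.ne hne)
  · exact (h y x hxy).1 hlt

theorem leftWeighted_unique {F G : List (Equiv.Perm (Fin n))} (hF : F.IsChain LeftWeighted)
    (hG : G.IsChain LeftWeighted) (hlen : F.length = G.length)
    (h : (F.map permBraid).prod = (G.map permBraid).prod) : F = G := by
  induction F generalizing G with
  | nil => exact (List.length_eq_zero_iff.1 hlen.symm).symm
  | cons f F ih =>
    obtain _ | ⟨g, G⟩ := G
    · simp at hlen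
    obtain ⟨u, hu⟩ := exists_ofWord_eq_prod F
    obtain ⟨v, hv⟩ := exists_ofWord_eq_prod G
    obtain rfl : f = g := perm_ext_of_inversions fun i j hij =>
      ⟨inversion_of_prod_eq_mul hG (w := u) (by rw [← h, hu, List.map_cons, List.prod_cons]) hij,
        inversion_of_prod_eq_mul hF (w := v) (by rw [h, hv, List.map_cons, List.prod_cons]) hij⟩
    rw [List.map_cons, List.map_cons, List.prod_cons, List.prod_cons] at h
    rw [ih hF.tail hG.tail (by simpa using hlen) (mul_left_cancel h), List.tail_cons]

lemma permBraid_injective : Function.Injective (permBraid : Equiv.Perm (Fin n) → Braid n) :=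
  fun f g h => List.singleton_injective <|
    leftWeighted_unique (.singleton f) (.singleton g) rfl (by simpa using h)

lemma descent_of_mem_startingSet {f : Equiv.Perm (Fin n)} {s : Fin (n - 1)}
    (h : s ∈ startingSet (permBraid f)) : f (rightPos s) < f (leftPos s) := by
  obtain ⟨β, ⟨w, rfl, -⟩, h⟩ := h
  have hσ : permBraid (swapEnds s 1) = σ s := by
    rw [permBraid_swapEnds s 1 (leftPos_lt_rightPos s), permBraid_one, one_mul]
  refine inversion_of_prod_eq_mul (F := []) (f' := swapEnds s 1) (w := w) (.singleton f)
    (by simpa [hσ] using h) (leftPos_lt_rightPos s) ?_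
  simpa [swapEnds] using leftPos_lt_rightPos s

end Braid

/-! ### Words of gaps

A path in the punctured plane that crosses the axis of the punctures is recorded by the word of
its crossings: the letter `(y, true)` is a crossing of the `y`-th gap downwards, `(y, false)` is a
crossing upwards. The path that runs from the upper to the lower half plane and separates the
punctures into two classes, given by `c : ℤ → Bool` (`false` for those on its left), and which
crosses the axis monotonically from the left to the right, crosses the gap `y` between `y` and
`y + 1` if `c y ≠ c (y + 1)`. Rotating the plane by `π` exchanges the two directions. -/

namespace GapWord

/-- A crossing of a gap, downwards if the second component is `true`. -/
abbrev Letter := ℤ × Bool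

/-- Rotation of a letter by `π`. -/
def flip (a : Letter) : Letter := (-1 - a.1, !a.2)

/-- Rotation of a set of gaps by `π`. -/
def flipSet (A : Set ℤ) : Set ℤ := {y | -1 - y ∈ A}

/-- Rotation of a colouring by `π`. -/
def flipColor (c : ℤ → Bool) (k : ℤ) : Bool := !c (-k)

lemma flip_flip (a : Letter) : flip (flip a) = a := by
  ext <;> simp [flip]

lemma flipSet_flipSet (A : Set ℤ) : flipSet (flipSet A) = A := by
  simp [flipSet]

lemma flipColor_flipColor (c : ℤ → Bool) : flipColor (flipColor c) = c := by
  funext k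
  simp [flipColor]

lemma map_flip_map_flip (l : List Letter) : (l.map flip).map flip = l := by
  simp [Function.comp_def, flip_flip]

/-- At the middle letter, the winding number of the path has a local minimum. -/
def IsMin (z y w : Letter) : Prop :=
  (y.2 = true ∧ z.1 < y.1 ∧ y.1 < w.1) ∨ (y.2 = false ∧ y.1 < z.1 ∧ w.1 < y.1)

instance (z y w : Letter) : Decidable (IsMin z y w) := inferInstanceAs (Decidable (_ ∨ _))

section Triples

variable {α : Type*}

/-- The number of triples of consecutive letters satisfying `R`. -/
def countTriples (R : α → α → α → Prop) [∀ z y w, Decidable (R z y w)] : List α → ℕ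
  | z :: y :: w :: l => (if R z y w then 1 else 0) + countTriples R (y :: w :: l)
  | _ => 0

variable (R : α → α → α → Prop) [∀ z y w, Decidable (R z y w)]

lemma countTriples_le_cons (z : α) (l : List α) : countTriples R l ≤ countTriples R (z :: l) := by
  rcases l with _ | ⟨y, _ | ⟨w, l⟩⟩
  · exact le_rfl
  · exact le_rfl
  · exact Nat.le_add_left _ _

lemma countTriples_cons_le (z : α) (l : List α) :
    countTriples R (z :: l) ≤ countTriples R l + 1 := by
  rcases l with _ | ⟨y, _ | ⟨w, l⟩⟩
  · exact Nat.zero_le _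
  · exact Nat.zero_le _
  · rw [countTriples]
    split_ifs <;> omega

end Triples

/-- The number of local minima of the winding number. -/
abbrev numMin : List Letter → ℕ := countTriples IsMin

/-- All local minima of the winding number lie in `A`. -/
def MinIn (A : Set ℤ) : List Letter → Prop
  | z :: y :: w :: l => (IsMin z y w → y.1 ∈ A) ∧ MinIn A (y :: w :: l)
  | _ => True

/-- Consecutive letters have opposite directions and lie in different gaps. -/
def Alternating (l : List Letter) : Prop := l.IsChain fun a b => a.1 ≠ b.1 ∧ a.2 ≠ b.2

lemma isMin_flip (z y w : Letter) : IsMin (flip z) (flip y) (flip w) ↔ IsMin z y w := by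
  unfold IsMin flip
  rcases y with ⟨y, _ | _⟩ <;> simp

lemma numMin_map_flip : ∀ l : List Letter, numMin (l.map flip) = numMin l
  | z :: y :: w :: l => by
    have ih := numMin_map_flip (y :: w :: l)
    simp only [List.map_cons, numMin, countTriples, isMin_flip] at ih ⊢
    rw [ih]
  | [_, _] | [_] | [] => rfl

lemma minIn_map_flip (A : Set ℤ) : ∀ l : List Letter, MinIn A (l.map flip) ↔ MinIn (flipSet A) l
  | z :: y :: w :: l => by
    have ih := minIn_map_flip A (y :: w :: l)
    simp only [List.map_cons, MinIn, isMin_flip] at ih ⊢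
    exact and_congr Iff.rfl ih
  | [_, _] | [_] | [] => Iff.rfl

lemma alternating_map_flip (l : List Letter) : Alternating (l.map flip) ↔ Alternating l := by
  rw [Alternating, List.isChain_map]
  simp [Alternating, flip]

lemma MinIn.tail {A : Set ℤ} {z : Letter} : ∀ {l : List Letter}, MinIn A (z :: l) → MinIn A l
  | _ :: _ :: _, h => h.2
  | [_], _ | [], _ => trivial

/-- The words with all local minima in `A` and at least `k` of them. -/
structure Tight (A : Set ℤ) (k : ℕ) (l : List Letter) : Prop where
  alternating : Alternating l
  minIn : MinIn A l
  le_numMin : k ≤ numMin l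

lemma tight_map_flip (A : Set ℤ) (k : ℕ) (l : List Letter) :
    Tight A k (l.map flip) ↔ Tight (flipSet A) k l :=
  ⟨fun h => ⟨(alternating_map_flip l).1 h.alternating, (minIn_map_flip A l).1 h.minIn,
    h.le_numMin.trans_eq (numMin_map_flip l)⟩,
  fun h => ⟨(alternating_map_flip l).2 h.alternating, (minIn_map_flip A l).2 h.minIn,
    h.le_numMin.trans_eq (numMin_map_flip l).symm⟩⟩

lemma tight_singleton (A : Set ℤ) (z : Letter) : Tight A 0 [z] :=
  ⟨.singleton z, trivial, le_rfl⟩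

lemma Tight.cons {A : Set ℤ} {k : ℕ} {z y : Letter} {l : List Letter} (h : Tight A k (y :: l))
    (hzy : z.1 ≠ y.1 ∧ z.2 ≠ y.2) (hm : ∀ w ∈ l.head?, IsMin z y w → y.1 ∈ A) :
    Tight A k (z :: y :: l) := by
  refine ⟨.cons_cons hzy h.alternating, ?_, h.le_numMin.trans (countTriples_le_cons _ _ _)⟩
  rcases l with _ | ⟨w, l⟩
  · trivial
  · exact ⟨hm w rfl, h.minIn⟩

/-- Rotation by `π` of words up to free reduction. -/
def flipHom : FreeGroup ℤ →* FreeGroup ℤ := FreeGroup.lift fun y => (FreeGroup.of (-1 - y))⁻¹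

lemma mk_append (u v : List Letter) :
    FreeGroup.mk (u ++ v) = FreeGroup.mk u * FreeGroup.mk v := FreeGroup.mul_mk.symm

lemma mk_cons (a : Letter) (l : List Letter) :
    FreeGroup.mk (a :: l) = FreeGroup.mk [a] * FreeGroup.mk l := mk_append [a] l

lemma flipHom_mk (l : List Letter) : flipHom (FreeGroup.mk l) = FreeGroup.mk (l.map flip) := by
  induction l with
  | nil => exact map_one flipHom
  | cons a l ih =>
    rw [mk_cons, map_mul, ih, List.map_cons, mk_cons (flip a)]
    rcases a with ⟨y, _ | _⟩ <;>
      simp [flipHom, flip, FreeGroup.of, FreeGroup.inv_mk, FreeGroup.invRev]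

lemma flipHom_flipHom (x : FreeGroup ℤ) : flipHom (flipHom x) = x := by
  obtain ⟨l, rfl⟩ := Quot.exists_rep x
  change flipHom (flipHom (FreeGroup.mk l)) = FreeGroup.mk l
  rw [flipHom_mk, flipHom_mk, map_flip_map_flip]

/-- The crossings of `m` consecutive gaps, beginning with `y`. -/
def run (c : ℤ → Bool) (y : ℤ) : ℕ → List Letter
  | 0 => []
  | m + 1 => (if c y = c (y + 1) then [] else [(y, c (y + 1))]) ++ run c (y + 1) m

/-- The crossings of the gaps `y, …, e - 1`. -/
def runTo (c : ℤ → Bool) (y e : ℤ) : List Letter := run c y (e - y).toNat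

lemma runTo_self (c : ℤ → Bool) (y : ℤ) : runTo c y y = [] := by simp [runTo, run]

section RunTo

variable {c : ℤ → Bool} {y e : ℤ}

lemma runTo_sub_one (h : y ≤ e) :
    runTo c (y - 1) e = (if c (y - 1) = c y then [] else [(y - 1, c y)]) ++ runTo c y e := by
  have hlen : (e - (y - 1)).toNat = (e - y).toNat + 1 := by omega
  rw [runTo, hlen, run, sub_add_cancel, runTo]

lemma runTo_sub_one_of_eq (h : y ≤ e) (hc : c (y - 1) = c y) :
    runTo c (y - 1) e = runTo c y e := by
  rw [runTo_sub_one h, if_pos hc, List.nil_append]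

lemma runTo_sub_one_of_ne (h : y ≤ e) (hc : c (y - 1) ≠ c y) :
    runTo c (y - 1) e = (y - 1, c y) :: runTo c y e := by
  rw [runTo_sub_one h, if_neg hc, List.singleton_append]

lemma runTo_of_lt (h : y < e) :
    runTo c y e = (if c y = c (y + 1) then [] else [(y, c (y + 1))]) ++ runTo c (y + 1) e := by
  simpa only [add_sub_cancel_right] using runTo_sub_one (c := c) (Int.add_one_le_of_lt h)

lemma runTo_append {x : ℤ} (hy : y ≤ x) (hx : x ≤ e) :
    runTo c y e = runTo c y x ++ runTo c x e := by
  induction y, hy using Int.leInductionDown with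
  | base => rw [runTo_self, List.nil_append]
  | pred y hy ih => rw [runTo_sub_one (hy.trans hx), ih, runTo_sub_one hy, List.append_assoc]

lemma runTo_congr {d : ℤ → Bool} (hy : y ≤ e) (h : ∀ k, y ≤ k → k ≤ e → c k = d k) :
    runTo c y e = runTo d y e := by
  induction y, hy using Int.leInductionDown with
  | base => rw [runTo_self, runTo_self]
  | pred y hy ih =>
    rw [runTo_sub_one hy, runTo_sub_one hy, ih fun k hk => h k (by omega), h y (by omega) hy,
      h (y - 1) le_rfl (by omega)]

lemma mem_runTo {a : Letter} (hy : y ≤ e) (h : a ∈ runTo c y e) : c a.1 ≠ c (a.1 + 1) := by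
  induction y, hy using Int.leInductionDown with
  | base => simp [runTo_self] at h
  | pred y hy ih =>
    rw [runTo_sub_one hy, List.mem_append] at h
    rcases h with h | h
    · split_ifs at h with hc
      · simp at h
      · rwa [List.mem_singleton.1 h, sub_add_cancel]
    · exact ih h

lemma mem_Ico_of_mem_runTo {a : Letter} (hy : y ≤ e) (h : a ∈ runTo c y e) :
    a.1 ∈ Set.Ico y e := by
  induction y, hy using Int.leInductionDown with
  | base => simp [runTo_self] at h
  | pred y hy ih =>
    rw [runTo_sub_one hy, List.mem_append] at h
    rcases h with h | h
    · split_ifs at h with hc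
      · simp at h
      · rw [List.mem_singleton.1 h]
        exact ⟨le_rfl, by omega⟩
    · exact ⟨by linarith [(ih h).1], (ih h).2⟩

lemma map_flip_runTo_flipColor (h : y ≤ e) :
    (runTo (flipColor c) (-e) (-y)).map flip = FreeGroup.invRev (runTo c y e) := by
  induction y, h using Int.leInductionDown with
  | base => simp [runTo_self]
  | pred y hy ih =>
    have hlast : (runTo (flipColor c) (-y) (-(y - 1))).map flip =
        FreeGroup.invRev (if c (y - 1) = c y then [] else [(y - 1, c y)]) := by
      have hy' : -y = -(y - 1) - 1 := by ring
      rw [hy', runTo_sub_one le_rfl, runTo_self, ← hy']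
      cases hc : c y <;> cases hc' : c (y - 1) <;>
        simp [flipColor, flip, FreeGroup.invRev, hc, hc'] <;> ring
    rw [runTo_append (x := -y) (by omega) (by omega), List.map_append, ih, hlast,
      runTo_sub_one hy, FreeGroup.invRev_append]

lemma flipHom_mk_runTo_flipColor (h : y ≤ e) :
    flipHom (FreeGroup.mk (runTo (flipColor c) (-e) (-y))) = (FreeGroup.mk (runTo c y e))⁻¹ := by
  rw [flipHom_mk, map_flip_runTo_flipColor h, FreeGroup.inv_mk]

end RunTo

end GapWord

/-! ### Free reduction of products of monotone paths -/

namespace GapWord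

/-- The monotone path with colouring `c` passes the gap `y` from the left to the right class. -/
def Rise (c : ℤ → Bool) (y : ℤ) : Prop := c y = false ∧ c (y + 1) = true

lemma rise_of_ne {c : ℤ → Bool} {y : ℤ} (h : c y ≠ c (y + 1)) (ht : c (y + 1) = true) :
    Rise c y :=
  ⟨by simpa [ht] using h, ht⟩

/-- All sufficiently far points are coloured as the ends of the axis. -/
structure IsColoring (M : ℤ) (c : ℤ → Bool) : Prop where
  left : ∀ k ≤ -M, c k = false
  right : ∀ k, M ≤ k → c k = true

/-- The last point where the colourings of consecutive letters differ; each colouring is given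
from the point of view of its letter. -/
def Junction (c d : ℤ → Bool) (Q : ℤ) : Prop :=
  c Q ≠ flipColor d Q ∧ ∀ k, Q < k → c k = flipColor d k

section Junction

variable {M Q Q' : ℤ} {c d e : ℤ → Bool}

lemma Junction.lt (h : Junction c d Q) (hc : IsColoring M c) (hd : IsColoring M d) :
    -M < Q ∧ Q < M := by
  constructor <;> by_contra hQ <;> refine h.1 ?_
  · simp [flipColor, hc.left Q (by omega), hd.right (-Q) (by omega)]
  · simp [flipColor, hc.right Q (by omega), hd.left (-Q) (by omega)]

lemma Junction.unique (h : Junction c d Q) (h' : Junction c d Q') : Q = Q' := by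
  rcases lt_trichotomy Q Q' with hlt | heq | hlt
  · exact absurd (h.2 _ hlt) h'.1
  · exact heq
  · exact absurd (h'.2 _ hlt) h.1

lemma Junction.apply_eq (h : Junction c d Q) : c Q = d (-Q) := by
  simpa [flipColor, Bool.eq_not] using h.1

lemma Junction.apply_add_one (h : Junction c d Q) : c (Q + 1) = !d (-Q - 1) := by
  rw [h.2 (Q + 1) (lt_add_one Q), flipColor, neg_add']

lemma Junction.crossing_iff (h : Junction c d Q) :
    c (Q + 1 - 1) = c (Q + 1) ↔ d (-Q - 1) ≠ d (-Q) := by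
  rw [add_sub_cancel_right, h.apply_eq, h.apply_add_one]
  cases d (-Q) <;> cases d (-Q - 1) <;> simp

lemma Junction.flipHom_mk_runTo {y : ℤ} (h : Junction c d Q) (hQ : Q < y) (hy : y ≤ M) :
    flipHom (FreeGroup.mk (runTo d (-M) (-y))) = (FreeGroup.mk (runTo c y M))⁻¹ := by
  rw [← flipHom_mk_runTo_flipColor hy]
  congr 2
  refine runTo_congr (by omega) fun k _ hk => ?_
  rw [flipColor, h.2 (-k) (by omega), flipColor, neg_neg, Bool.not_not]

end Junction

/-- The word `O` continues, without cancellation, the crossings before the point `e` of the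
monotone path with colouring `c`. -/
structure Continues (A : Set ℤ) (c : ℤ → Bool) (e : ℤ) (k : ℕ) (O : List Letter) : Prop where
  tight : ∀ z : Letter, z.2 = c e → (c (e - 1) = c e → z.1 < e - 1) →
    (c (e - 1) ≠ c e → z.1 = e - 1) → Tight A k (z :: O)
  le_head : c (e - 1) = c e → ∀ h ∈ O.head?, e - 1 ≤ h.1

section Continues

variable {A : Set ℤ} {c : ℤ → Bool} {y e : ℤ} {k : ℕ} {O l : List Letter} {z : Letter}

lemma Tight.cons_crossing (h : Tight A k ((y - 1, c y) :: l)) (hA : ∀ x, Rise c x → x ∈ A)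
    (hc : c (y - 1) ≠ c y) (hz : z.2 = c (y - 1))
    (hlt : z.1 < y - 1 ∨ z.1 ≠ y - 1 ∧ ∀ w ∈ l.head?, y ≤ w.1) :
    Tight A k (z :: (y - 1, c y) :: l) := by
  refine h.cons ⟨by dsimp only; omega, hz ▸ hc⟩ fun w hw hmin => ?_
  rcases hmin with ⟨ht, -, -⟩ | ⟨-, hz', hw'⟩
  · exact hA _ (rise_of_ne (by rwa [sub_add_cancel]) (by rwa [sub_add_cancel]))
  · dsimp only at hz' hw'
    have := hlt.resolve_left (by omega)
    have := this.2 w hw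
    omega

lemma Continues.le_head_runTo (h : Continues A c e k O) (hy : y ≤ e - 1) :
    ∀ a ∈ (runTo c y e ++ O).head?, y ≤ a.1 := by
  induction y, hy using Int.leInductionDown with
  | base =>
    by_cases hc : c (e - 1) = c e
    · simpa [runTo_sub_one_of_eq le_rfl hc, runTo_self] using h.le_head hc
    · simp [runTo_sub_one_of_ne le_rfl hc]
  | pred y hy ih =>
    by_cases hc : c (y - 1) = c y
    · rw [runTo_sub_one_of_eq (by omega) hc]
      exact fun a ha => (sub_one_lt y).le.trans (ih a ha)
    · simp [runTo_sub_one_of_ne (show y ≤ e by omega) hc]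

lemma runTo_append_ne_nil (hO : c (e - 1) = c e → c e = true → O ≠ [])
    (hy : y ≤ e - 1) (ht : c y = true) : runTo c y e ++ O ≠ [] := by
  induction y, hy using Int.leInductionDown with
  | base =>
    by_cases hc : c (e - 1) = c e
    · simp [hO hc (hc ▸ ht)]
    · simp [runTo_sub_one_of_ne le_rfl hc]
  | pred y hy ih =>
    by_cases hc : c (y - 1) = c y
    · rw [runTo_sub_one_of_eq (by omega) hc]
      exact ih (hc ▸ ht)
    · simp [runTo_sub_one_of_ne (show y ≤ e by omega) hc]

lemma Continues.tight_runTo (h : Continues A c e k O) (hA : ∀ x, Rise c x → x ∈ A)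
    (hy : y ≤ e - 1) (hz : z.2 = c y) (hlt : z.1 < y) : Tight A k (z :: (runTo c y e ++ O)) := by
  induction y, hy using Int.leInductionDown generalizing z with
  | base =>
    by_cases hc : c (e - 1) = c e
    · rw [runTo_sub_one_of_eq le_rfl hc, runTo_self, List.nil_append]
      exact h.tight z (hz.trans hc) (fun _ => hlt) fun hne => absurd hc hne
    · rw [runTo_sub_one_of_ne le_rfl hc, runTo_self]
      exact (h.tight _ rfl (fun he => absurd he hc) fun _ => rfl).cons_crossing hA hc hz (.inl hlt)
  | pred y hy ih =>
    by_cases hc : c (y - 1) = c y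
    · rw [runTo_sub_one_of_eq (by omega) hc]
      exact ih (hz.trans hc) (by omega)
    · rw [runTo_sub_one_of_ne (by omega) hc]
      exact (ih rfl (sub_one_lt y)).cons_crossing hA hc hz (.inl hlt)

lemma Continues.tight_succ_runTo (h : Continues A c e k O) (hA : ∀ x, Rise c x → x ∈ A)
    (hO : c (e - 1) = c e → c e = true → O ≠ []) (hy : y ≤ e - 1) (hz : z.2 = c y) (hlt : z.1 < y)
    (hrise : ∃ x, y ≤ x ∧ x < e - 1 ∧ Rise c x) : Tight A (k + 1) (z :: (runTo c y e ++ O)) := by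
  refine ⟨(h.tight_runTo hA hy hz hlt).alternating, (h.tight_runTo hA hy hz hlt).minIn, ?_⟩
  induction y, hy using Int.leInductionDown generalizing z with
  | base =>
    obtain ⟨x, hx, hx', -⟩ := hrise
    omega
  | pred y hy ih =>
    obtain ⟨x, hx, hx', hr⟩ := hrise
    by_cases hc : c (y - 1) = c y
    · rw [runTo_sub_one_of_eq (by omega) hc]
      refine ih (hz.trans hc) (by omega) ⟨x, ?_, hx', hr⟩
      have : x ≠ y - 1 := by
        rintro rfl
        simp [Rise, hc] at hr
      omega
    rw [runTo_sub_one_of_ne (by omega) hc, List.cons_append]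
    rcases hx.eq_or_lt with rfl | hx
    · have ht : c y = true := by simpa using hr.2
      have htight := h.tight_runTo hA hy (z := (y - 1, c y)) rfl (sub_one_lt y)
      have hhead := h.le_head_runTo hy
      obtain ⟨w, l, hl⟩ := List.exists_cons_of_ne_nil (runTo_append_ne_nil hO hy ht)
      rw [hl] at htight hhead ⊢
      have hmin : IsMin z (y - 1, c y) w :=
        .inl ⟨ht, hlt, (sub_one_lt y).trans_le (hhead w rfl)⟩
      rw [numMin, countTriples, if_pos hmin, add_comm]
      exact Nat.add_le_add_left htight.le_numMin 1
    · exact (ih rfl (sub_one_lt y) ⟨x, by omega, hx', hr⟩).trans (countTriples_le_cons _ _ _)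

end Continues

/-- The path with colouring `c` gains at least `δ ≤ 1` local minima between `lo` and `Q`. -/
def Gains (c : ℤ → Bool) (lo Q : ℤ) (δ : ℕ) : Prop :=
  δ = 0 ∨ δ = 1 ∧ ∃ y, lo ≤ y ∧ y < Q ∧ Rise c y

/-- The result of free reduction, after the crossing of the gap `lo - 1`. -/
structure Reduced (A : Set ℤ) (lo : ℤ) (c : ℤ → Bool) (k : ℕ) (O : List Letter) : Prop where
  le_head : ∀ h ∈ O.head?, lo - 1 ≤ h.1
  head_eq : c (lo - 1) ≠ c lo → ∀ h ∈ O.head?, h.1 = lo - 1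
  ne_nil : c (lo - 1) ≠ c lo → O ≠ []
  tight : ∀ z : Letter, z.2 = c (lo - 1) → (c (lo - 1) = c lo → z.1 ≤ lo - 1) →
    (c (lo - 1) ≠ c lo → z.1 ≠ lo - 1) → Tight A k (z :: O)

section Reduced

variable {A : Set ℤ} {c d : ℤ → Bool} {e lo Q : ℤ} {k δ : ℕ} {O : List Letter}

lemma Continues.reduced (h : Continues A c e k O) (hA : ∀ x, Rise c x → x ∈ A)
    (hO : 0 < δ → c (e - 1) = c e → c e = true → O ≠ []) (hlo : lo ≤ e - 1)
    (hδ : Gains c lo (e - 1) δ) : Reduced A lo c (k + δ) (runTo c (lo - 1) e ++ O) := by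
  have htight (z : Letter) (hz : z.2 = c lo) (hlt : z.1 < lo) :
      Tight A (k + δ) (z :: (runTo c lo e ++ O)) := by
    rcases hδ with rfl | ⟨rfl, hr⟩
    · exact h.tight_runTo hA hlo hz hlt
    · exact h.tight_succ_runTo hA (hO Nat.one_pos) hlo hz hlt hr
  have hhead := h.le_head_runTo hlo
  by_cases hc : c (lo - 1) = c lo
  · rw [runTo_sub_one_of_eq (by omega) hc]
    exact ⟨fun a ha => (sub_one_lt lo).le.trans (hhead a ha), fun hne => absurd hc hne,
      fun hne => absurd hc hne,
      fun z hz hle _ => htight z (hz.trans hc) ((hle hc).trans_lt (sub_one_lt lo))⟩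
  · rw [runTo_sub_one_of_ne (by omega) hc, List.cons_append]
    refine ⟨by simp, by simp, by simp, fun z hz _ hne => ?_⟩
    exact (htight _ rfl (sub_one_lt lo)).cons_crossing hA hc hz (.inr ⟨hne hc, hhead⟩)

lemma Continues.nil : Continues A c e 0 [] := ⟨fun z _ _ _ => tight_singleton A z, by simp⟩

lemma Reduced.tight_map_flip (hr : Reduced (flipSet A) (-Q) d k O) (hJ : Junction c d Q)
    {z : Letter} (hz : z.2 = c (Q + 1)) (hlt : c (Q + 1 - 1) = c (Q + 1) → z.1 ≠ Q)
    (hle : c (Q + 1 - 1) ≠ c (Q + 1) → Q ≤ z.1) : Tight A k (z :: O.map flip) := by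
  rw [← flip_flip z, ← List.map_cons, GapWord.tight_map_flip]
  refine hr.tight (flip z) (by simp [flip, hz, hJ.apply_add_one]) (fun h => ?_) fun h => ?_
  · have := hle fun h' => hJ.crossing_iff.1 h' h
    dsimp only [flip]
    omega
  · have := hlt (hJ.crossing_iff.2 h)
    dsimp only [flip]
    omega

lemma Reduced.continues_map_flip (hr : Reduced (flipSet A) (-Q) d k O) (hJ : Junction c d Q) :
    Continues A c (Q + 1) k (O.map flip) := by
  constructor
  · intro z hz hlt heq
    rw [add_sub_cancel_right] at hlt heq
    exact hr.tight_map_flip hJ hz (fun h => (hlt (by simpa using h)).ne)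
      fun h => (heq (by simpa using h)).ge
  · intro hc a ha
    rw [List.head?_map, Option.mem_def, Option.map_eq_some_iff] at ha
    obtain ⟨b, hb, rfl⟩ := ha
    have := hr.head_eq (hJ.crossing_iff.1 hc) b hb
    dsimp only [flip]
    omega

end Reduced

/-- The contribution of the paths after the leading one. -/
def tailValue (M : ℤ) : List (ℤ → Bool) → FreeGroup ℤ
  | [] => 1
  | d :: l => flipHom (FreeGroup.mk (runTo d (-M) M) * tailValue M l)

/-- The colouring of a monotone path that rises at gaps in `A` only and crosses gaps in `G` only. -/
structure IsColoringIn (M : ℤ) (A G : Set ℤ) (c : ℤ → Bool) : Prop extends IsColoring M c where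
  rise_mem : ∀ y, Rise c y → y ∈ A
  crossing_mem : ∀ y, c y ≠ c (y + 1) → y ∈ G

/-- A product of monotone paths, beginning downwards and given by their colourings `c :: l`, has a
free reduction with at least `k` local minima. Every colouring is given from the point of view of
its letter, that is, the plane is rotated after each letter. The crossings of the leading path
before the gap `lo - 1` are those it shares with the path before it. -/
def Reduces (M : ℤ) (A G : Set ℤ) (lo : ℤ) (c : ℤ → Bool) (l : List (ℤ → Bool)) (k : ℕ) : Prop :=
  ∃ O, FreeGroup.mk (runTo c (lo - 1) M) * tailValue M l = FreeGroup.mk O ∧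
    Reduced A lo c k O ∧ ∀ a ∈ O, a.1 ∈ G

section Reduces

variable {M Q Q' lo : ℤ} {A G : Set ℤ} {c d e : ℤ → Bool} {l : List (ℤ → Bool)} {k δ : ℕ}

lemma mk_runTo_mul_tailValue_cons (hc : IsColoring M c) (hd : IsColoring M d)
    (hJ : Junction c d Q) (hlo : lo ≤ Q + 1) :
    FreeGroup.mk (runTo c (lo - 1) M) * tailValue M (d :: l) =
      FreeGroup.mk (runTo c (lo - 1) (Q + 1)) *
        flipHom (FreeGroup.mk (runTo d (-Q - 1) M) * tailValue M l) := by
  have hQ := hJ.lt hc hd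
  have hcancel := hJ.flipHom_mk_runTo (M := M) (lt_add_one Q) (by omega)
  rw [neg_add'] at hcancel
  rw [tailValue, runTo_append (x := Q + 1) (by omega) (by omega),
    runTo_append (c := d) (x := -Q - 1) (by omega) (by omega)]
  simp only [mk_append, map_mul, hcancel]
  group

/-- In this configuration, the middle path cancels completely. -/
lemma mk_runTo_mul_tailValue_cons_cons (hd : IsColoring M d) (he : IsColoring M e)
    (hJ : Junction c d Q) (hJ' : Junction d e Q') (hlo : lo ≤ Q) (hQ : Q + Q' < -1) :
    FreeGroup.mk (runTo c (lo - 1) M) * tailValue M (d :: e :: l) =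
      FreeGroup.mk (runTo c (lo - 1) (-Q' - 1)) *
        (FreeGroup.mk (runTo e (-Q' - 1) M) * tailValue M l) := by
  have hde := hJ'.lt hd he
  have hcancel := hJ.flipHom_mk_runTo (M := M) (y := -Q' - 1) (by omega) (by omega)
  have hcancel' := congrArg flipHom
    (hJ'.flipHom_mk_runTo (M := M) (y := -(-Q' - 1)) (by omega) (by omega))
  rw [flipHom_flipHom, neg_neg, map_inv] at hcancel'
  rw [tailValue, tailValue, map_mul, flipHom_flipHom,
    runTo_append (c := c) (x := -Q' - 1) (by omega) (by omega),
    runTo_append (c := d) (x := -(-Q' - 1)) (by omega) (by omega),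
    runTo_append (c := e) (y := -M) (x := -Q' - 1) (by omega) (by omega)]
  simp only [mk_append, map_mul, hcancel, hcancel']
  group

lemma Reduces.last (hc : IsColoringIn M A G c) (hlo : lo < M) : Reduces M A G lo c [] 0 := by
  refine ⟨runTo c (lo - 1) M ++ [], by rw [List.append_nil, tailValue, mul_one], ?_, ?_⟩
  · exact Continues.nil.reduced hc.rise_mem (fun h => absurd h (lt_irrefl 0)) (by omega) (.inl rfl)
  · rw [List.append_nil]
    exact fun a ha => hc.crossing_mem _ (mem_runTo (by omega) ha)

lemma mem_of_mem_map_flip {O : List Letter} (h : ∀ a ∈ O, a.1 ∈ flipSet G) :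
    ∀ a ∈ O.map flip, a.1 ∈ G :=
  List.forall_mem_map.2 h

lemma Gains.mono (h : Gains c lo Q δ) (hQ : Q ≤ Q') : Gains c lo Q' δ :=
  h.imp_right fun ⟨h, y, hy, hy', hr⟩ => ⟨h, y, hy, hy'.trans_le hQ, hr⟩

lemma Reduces.step (hc : IsColoringIn M A G c) (hd : IsColoring M d) (hJ : Junction c d Q)
    (hlo : lo ≤ Q) (hδ : Gains c lo Q δ) (h : Reduces M (flipSet A) (flipSet G) (-Q) d l k) :
    Reduces M A G lo c (d :: l) (k + δ) := by
  obtain ⟨O, hO, hr, hG⟩ := h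
  refine ⟨runTo c (lo - 1) (Q + 1) ++ O.map flip, ?_, ?_, fun a ha => ?_⟩
  · rw [mk_runTo_mul_tailValue_cons hc.toIsColoring hd hJ (by omega), hO, flipHom_mk, mk_append]
  · refine (hr.continues_map_flip hJ).reduced hc.rise_mem (fun _ h _ => ?_) (by omega)
      (hδ.mono (by omega))
    simpa using hr.ne_nil (hJ.crossing_iff.1 h)
  · rcases List.mem_append.1 ha with ha | ha
    · exact hc.crossing_mem _ (mem_runTo (by omega) ha)
    · exact mem_of_mem_map_flip hG a ha

/-- In this configuration, a single crossing of the leading path survives. -/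
lemma Reduces.single (hc : IsColoringIn M A G c) (hd : IsColoring M d) (hJ : Junction c d Q)
    (hrise : Rise c Q) (h : Reduces M (flipSet A) (flipSet G) (-Q) d l k) :
    Reduces M A G (Q + 1) c (d :: l) k := by
  obtain ⟨O, hO, hr, hG⟩ := h
  have hne : c (Q + 1 - 1) ≠ c (Q + 1) := by simp [hrise.1, hrise.2]
  have htight : Tight A k ((Q, true) :: O.map flip) :=
    hr.tight_map_flip hJ hrise.2.symm (fun h => absurd h hne) fun _ => le_rfl
  refine ⟨(Q, true) :: O.map flip, ?_, ⟨by simp, by simp, by simp, fun z hz _ hz' => ?_⟩, ?_⟩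
  · rw [mk_runTo_mul_tailValue_cons hc.toIsColoring hd hJ le_rfl, hO, flipHom_mk,
      runTo_sub_one_of_ne le_rfl hne, runTo_self, ← mk_append, hrise.2, add_sub_cancel_right,
      List.singleton_append]
  · rw [add_sub_cancel_right] at hz hz'
    exact htight.cons ⟨hz' (by simp [hrise.1, hrise.2]), by simp [hz, hrise.1]⟩
      fun _ _ _ => hc.rise_mem Q hrise
  · exact List.forall_mem_cons.2
      ⟨hc.crossing_mem Q (by simp [hrise.1, hrise.2]), mem_of_mem_map_flip hG⟩

lemma Reduces.skip (hc : IsColoringIn M A G c) (hd : IsColoring M d) (he : IsColoring M e)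
    (hJ : Junction c d Q) (hJ' : Junction d e Q') (hlo : lo ≤ Q) (hQ : Q + Q' < -1)
    (hQ' : e (-Q') = false) (hδ : Gains c lo Q δ) (h : Reduces M A G (-Q') e l k) :
    Reduces M A G lo c (d :: e :: l) (k + δ) := by
  obtain ⟨O, hO, hr, hG⟩ := h
  have hce : c (-Q' - 1) = e (-Q' - 1) := by
    rw [hJ.2 _ (by omega), flipColor, neg_sub', neg_neg, sub_neg_eq_add, hJ'.apply_add_one,
      Bool.not_not]
  have hcont : Continues A c (-Q' - 1) k O := by
    refine ⟨fun z hz hlt heq => ?_, fun _ a ha => (sub_one_lt _).le.trans (hr.le_head a ha)⟩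
    by_cases h : c (-Q' - 1 - 1) = c (-Q' - 1)
    · have := hlt h
      exact hr.tight z (hz.trans hce) (by omega) (by omega)
    · have := heq h
      exact hr.tight z (hz.trans hce) (by omega) (by omega)
  refine ⟨runTo c (lo - 1) (-Q' - 1) ++ O, ?_, ?_, fun a ha => ?_⟩
  · rw [mk_runTo_mul_tailValue_cons_cons hd he hJ hJ' hlo hQ, hO, mk_append]
  · refine hcont.reduced hc.rise_mem (fun _ _ ht => hr.ne_nil ?_) (by omega) (hδ.mono (by omega))
    rw [← hce, ht, hQ']
    exact Bool.false_ne_true.symm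
  · rcases List.mem_append.1 ha with ha | ha
    · exact hc.crossing_mem _ (mem_runTo (by omega) ha)
    · exact hG a ha

end Reduces

end GapWord

/-! ### The image of a gap under a permutation braid -/

namespace GapWord

open Braid

section Words

variable {n : ℕ} {A : Set ℤ} {x y z w : Letter} {W : List Letter}

/-- The words in the gaps between and beside `n` points on the axis which are freely reduced and
whose local minima of the winding number lie in `A`. -/
structure IsGapWord (n : ℕ) (A : Set ℤ) (W : List Letter) : Prop where
  alternating : Alternating W
  minIn : MinIn A W
  mem_Icc : ∀ a ∈ W, a.1 ∈ Set.Icc (0 : ℤ) n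

lemma IsGapWord.tail (h : IsGapWord n A (x :: W)) : IsGapWord n A W :=
  ⟨h.alternating.tail, h.minIn.tail, fun a ha => h.mem_Icc a (List.mem_cons_of_mem x ha)⟩

lemma IsGapWord.pair (h : IsGapWord n A (x :: y :: W)) : IsGapWord n A [x, y] :=
  ⟨.cons_cons h.alternating.rel (.singleton y), trivial,
    fun a ha => h.mem_Icc a (List.mem_append_left W ha)⟩

lemma IsGapWord.triple (h : IsGapWord n A (x :: y :: w :: W)) : IsGapWord n A [x, y, w] :=
  ⟨.cons_cons h.alternating.rel h.tail.pair.alternating, ⟨h.minIn.1, trivial⟩,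
    fun a ha => h.mem_Icc a (List.mem_append_left W ha)⟩

lemma IsGapWord.snd_eq (h : IsGapWord n A (x :: y :: W)) : y.2 = !x.2 :=
  Bool.eq_not_of_ne h.alternating.rel.2.symm

end Words

section Color

variable {n : ℕ} (g : Equiv.Perm (Fin n)) (t k : ℤ) (a : Letter) (b : Bool) (l : Fin n)

/-- The colouring, by positions in the end, of the strands of `g` into those that start on the left
and on the right of the gap `t`. The strand ending at the position `i` is at the point `i + 1`. -/
def baseColor : Bool :=
  if h : 0 < k ∧ k ≤ n then decide (t ≤ (g.symm ⟨(k - 1).toNat, by omega⟩).val)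
  else decide (0 < k)

/-- The colouring given by a letter, from the point of view of the letter. -/
def color : ℤ → Bool :=
  if a.2 then baseColor g a.1 else flipColor (baseColor g a.1)

/-- The end of a strand, from the point of view of a letter. -/
def strandPoint : ℤ :=
  if b then (g l).val + 1 else -((g l).val + 1)

lemma baseColor_apply_add_one : baseColor g t ((g l).val + 1) = decide (t ≤ l.val) := by
  have hg : (⟨((g l).val + 1 - 1 : ℤ).toNat, by omega⟩ : Fin n) = g l := Fin.ext (by simp)
  rw [baseColor, dif_pos (by omega), hg, Equiv.symm_apply_apply]

lemma baseColor_of_ne (h : ∀ l, k ≠ (g l).val + 1) : baseColor g t k = decide (0 < k) := by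
  rw [baseColor, dif_neg]
  rintro ⟨hpos, hle⟩
  refine h (g.symm ⟨(k - 1).toNat, by omega⟩) ?_
  rw [Equiv.apply_symm_apply]
  dsimp only
  omega

lemma flipColor_color : flipColor (color g a) = color g (a.1, !a.2) := by
  rcases a with ⟨t, _ | _⟩ <;> simp [color, flipColor_flipColor]

lemma strandPoint_not : strandPoint g (!b) l = -strandPoint g b l := by
  cases b <;> simp [strandPoint]

lemma color_strandPoint : color g (t, b) (strandPoint g b l) = (b == decide (t ≤ l.val)) := by
  cases b <;> simp [color, strandPoint, flipColor, baseColor_apply_add_one]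

lemma color_congr_of_ne (u : ℤ) (h : ∀ l, k ≠ strandPoint g b l) :
    color g (u, b) k = color g (t, b) k := by
  cases b
  · have h' : ∀ l, -k ≠ (g l).val + 1 := fun l hl => h l (by simp [strandPoint, ← hl])
    simp only [color, Bool.false_eq_true, if_false, flipColor, baseColor_of_ne g _ _ h']
  · have h' : ∀ l, k ≠ (g l).val + 1 := h
    simp only [color, if_true, baseColor_of_ne g _ _ h']

/-- A set of gaps, from the point of view of a letter. -/
def frameSet (b : Bool) (A : Set ℤ) : Set ℤ := if b then A else flipSet A

lemma flipSet_frameSet (A : Set ℤ) : flipSet (frameSet b A) = frameSet (!b) A := by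
  cases b <;> simp [frameSet, flipSet_flipSet]

/-- The gaps at which the strands ending at both sides do not cross. -/
def endAscents : Set ℤ :=
  {y | ∀ s : Fin (n - 1), y = s.val + 1 → g.symm (leftPos s) < g.symm (rightPos s)}

/-- The gaps at which the strands starting at both sides do not cross. -/
def startAscents : Set ℤ :=
  {y | ∀ s : Fin (n - 1), y = s.val + 1 → g (leftPos s) < g (rightPos s)}

lemma isColoringIn_baseColor :
    IsColoringIn (n + 1) (endAscents g) (Set.Icc 0 n) (baseColor g t) := by
  have hout {k : ℤ} (h : k ≤ 0 ∨ n < k) : baseColor g t k = decide (0 < k) := by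
    rw [baseColor, dif_neg (by omega)]
  refine ⟨⟨fun k hk => ?_, fun k hk => ?_⟩, ?_, fun y hy => ?_⟩
  · rw [hout (by omega), decide_eq_false (by omega)]
  · rw [hout (by omega), decide_eq_true (by omega)]
  · rintro _ ⟨hl, hr⟩ s rfl
    have hleft := baseColor_apply_add_one g t (g.symm (leftPos s))
    have hright := baseColor_apply_add_one g t (g.symm (rightPos s))
    rw [Equiv.apply_symm_apply] at hleft hright
    have hlt := of_decide_eq_false (hleft.symm.trans hl)
    have hle := of_decide_eq_true (hright.symm.trans hr)
    rw [Fin.lt_def]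
    omega
  · by_contra hmem
    rw [Set.mem_Icc] at hmem
    refine hy ?_
    rw [hout (by omega), hout (by omega), decide_eq_decide]
    omega

end Color

lemma rise_flipColor {c : ℤ → Bool} {y : ℤ} : Rise (flipColor c) y ↔ Rise c (-1 - y) := by
  have hl : -(y + 1) = -1 - y := by ring
  have hr : -1 - y + 1 = -y := by ring
  simp [Rise, flipColor, hl, hr, and_comm]

lemma IsColoringIn.flipColor {M : ℤ} {A G : Set ℤ} {c : ℤ → Bool} (h : IsColoringIn M A G c) :
    IsColoringIn M (flipSet A) (flipSet G) (flipColor c) := by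
  refine ⟨⟨fun k hk => ?_, fun k hk => ?_⟩, fun y hy => h.rise_mem _ (rise_flipColor.1 hy),
    fun y hy => h.crossing_mem _ fun heq => hy ?_⟩
  · simp [GapWord.flipColor, h.right (-k) (by omega)]
  · simp [GapWord.flipColor, h.left (-k) (by omega)]
  · have hl : -(y + 1) = -1 - y := by ring
    have hr : -1 - y + 1 = -y := by ring
    rw [hr] at heq
    rw [GapWord.flipColor, GapWord.flipColor, hl, heq]

section Junctions

variable {n : ℕ} {A : Set ℤ} (g : Equiv.Perm (Fin n)) {x y z w : Letter} {Q Q' : ℤ}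

lemma isColoringIn_color (a : Letter) : IsColoringIn (n + 1) (frameSet a.2 (endAscents g))
    (frameSet a.2 (Set.Icc 0 n)) (color g a) := by
  rcases a with ⟨t, _ | _⟩
  · exact (isColoringIn_baseColor g t).flipColor
  · exact isColoringIn_baseColor g t

/-- The strands that start between two gaps. -/
def strandsBetween (n : ℕ) (u t : ℤ) : Set (Fin n) :=
  {l | u ≤ l.val ∧ l.val < t ∨ t ≤ l.val ∧ l.val < u}

lemma junction_of_isGreatest (hxy : y.2 = !x.2)
    (h : IsGreatest (strandPoint g x.2 '' strandsBetween n x.1 y.1) Q) :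
    Junction (color g x) (color g y) Q := by
  obtain ⟨⟨l₀, hl₀, rfl⟩, hmax⟩ := h
  obtain ⟨u, b⟩ := x
  obtain ⟨t, b'⟩ := y
  obtain rfl : b' = !b := hxy
  rw [Junction, flipColor_color, Bool.not_not]
  refine ⟨?_, fun k hk => ?_⟩
  · rw [color_strandPoint, color_strandPoint]
    have hne : decide (u ≤ l₀.val) ≠ decide (t ≤ l₀.val) := by
      rcases hl₀ with h | h <;> rw [Ne, decide_eq_decide] <;> dsimp only at h <;> omega
    cases b <;> simpa using hne
  · by_cases hex : ∃ l, k = strandPoint g b l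
    · obtain ⟨l, rfl⟩ := hex
      have hl : l ∉ strandsBetween n u t := fun hl => hk.not_ge (hmax ⟨l, hl, rfl⟩)
      simp only [strandsBetween, Set.mem_ofPred_eq] at hl
      rw [color_strandPoint, color_strandPoint]
      congr 1
      rw [decide_eq_decide]
      omega
    · exact color_congr_of_ne g t k b u fun l hl => hex ⟨l, hl⟩

lemma exists_isGreatest_strandPoint (h : IsGapWord n A [x, y]) :
    ∃ Q, IsGreatest (strandPoint g x.2 '' strandsBetween n x.1 y.1) Q := by
  suffices hne : (strandsBetween n x.1 y.1).Nonempty by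
    obtain ⟨l₀, hl₀, hmax⟩ := Set.exists_max_image _ (strandPoint g x.2) (Set.toFinite _) hne
    exact ⟨_, ⟨l₀, hl₀, rfl⟩, Set.forall_mem_image.2 hmax⟩
  have hne := h.alternating.rel.1
  have hx := h.mem_Icc x (by simp)
  have hy := h.mem_Icc y (by simp)
  rw [Set.mem_Icc] at hx hy
  rcases lt_or_gt_of_ne hne with hlt | hlt
  · exact ⟨⟨x.1.toNat, by omega⟩, .inl ⟨by simp, by simp [hx.1, hlt]⟩⟩
  · exact ⟨⟨y.1.toNat, by omega⟩, .inr ⟨by simp, by simp [hy.1, hlt]⟩⟩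

lemma exists_junction (h : IsGapWord n A [x, y]) : ∃ Q, Junction (color g x) (color g y) Q :=
  (exists_isGreatest_strandPoint g h).imp fun _ => junction_of_isGreatest g h.snd_eq

variable {g}

lemma Junction.isGreatest (hJ : Junction (color g x) (color g y) Q) (h : IsGapWord n A [x, y]) :
    IsGreatest (strandPoint g x.2 '' strandsBetween n x.1 y.1) Q := by
  obtain ⟨Q', hQ'⟩ := exists_isGreatest_strandPoint g h
  exact hJ.unique (junction_of_isGreatest g h.snd_eq hQ') ▸ hQ'

lemma Junction.isLeast (hJ : Junction (color g x) (color g y) Q) (h : IsGapWord n A [x, y]) :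
    IsLeast (strandPoint g y.2 '' strandsBetween n x.1 y.1) (-Q) := by
  obtain ⟨⟨l₀, hl₀, rfl⟩, hmax⟩ := hJ.isGreatest h
  rw [h.snd_eq]
  refine ⟨⟨l₀, hl₀, strandPoint_not g x.2 l₀⟩, ?_⟩
  rintro _ ⟨l, hl, rfl⟩
  rw [strandPoint_not, neg_le_neg_iff]
  exact hmax ⟨l, hl, rfl⟩

lemma exists_rise {c : ℤ → Bool} {x y : ℤ} (hxy : x ≤ y) (hx : c x = false) (hy : c y = true) :
    ∃ k, x ≤ k ∧ k < y ∧ Rise c k := by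
  induction y, hxy using Int.leInduction with
  | base => simp [hx] at hy
  | succ y hxy ih =>
    by_cases h : c y = true
    · obtain ⟨k, hk, hk', hr⟩ := ih h
      exact ⟨k, hk, by omega, hr⟩
    · exact ⟨y, hxy, lt_add_one y, by simpa using h, hy⟩

/-- At the middle letter, the winding number of the path has a local maximum. -/
def IsMax (z y w : Letter) : Prop :=
  y.2 = true ∧ y.1 < z.1 ∧ w.1 < y.1 ∨ y.2 = false ∧ z.1 < y.1 ∧ y.1 < w.1

lemma exists_rise_of_isMin (h : IsGapWord n (startAscents g) [z, y, w]) (hmin : IsMin z y w)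
    (hJ : Junction (color g z) (color g y) Q) (hJ' : Junction (color g y) (color g w) Q') :
    ∃ r, -Q ≤ r ∧ r < Q' ∧ Rise (color g y) r := by
  have hleast := (hJ.isLeast h.pair).2
  have hgreatest := (hJ'.isGreatest h.tail).2
  have hz := h.mem_Icc z (by simp)
  have hw := h.mem_Icc w (by simp)
  rw [Set.mem_Icc] at hz hw
  have hy : 0 < y.1 ∧ y.1 < n := by
    rcases hmin with hmin | hmin <;> omega
  obtain ⟨s, hs⟩ : ∃ s : Fin (n - 1), y.1 = s.val + 1 :=
    ⟨⟨(y.1 - 1).toNat, by omega⟩, by simp; omega⟩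
  have hlt := Fin.lt_def.1 (h.minIn.1 hmin s hs)
  have hl : (leftPos s).val = s.val := rfl
  have hr : (rightPos s).val = s.val + 1 := by simp [rightPos]
  obtain ⟨t, b⟩ := y
  dsimp only at *
  obtain ⟨l, r, hl', hr', hle, hcl, hcr⟩ : ∃ l r, l ∈ strandsBetween n z.1 t ∧
      r ∈ strandsBetween n t w.1 ∧ strandPoint g b l ≤ strandPoint g b r ∧
      color g (t, b) (strandPoint g b l) = false ∧ color g (t, b) (strandPoint g b r) = true := by
    simp only [color_strandPoint]
    rcases hmin with ⟨rfl, hzy, hyw⟩ | ⟨rfl, hzy, hyw⟩ <;> dsimp only at hzy hyw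
    · refine ⟨leftPos s, rightPos s, .inl (by omega), .inl (by omega), ?_, ?_, ?_⟩ <;>
        simp [strandPoint] <;> omega
    · refine ⟨rightPos s, leftPos s, .inr (by omega), .inr (by omega), ?_, ?_, ?_⟩ <;>
        simp [strandPoint] <;> omega
  obtain ⟨k, hk, hk', hrise⟩ := exists_rise hle hcl hcr
  exact ⟨k, (hleast ⟨l, hl', rfl⟩).trans hk, hk'.trans_le (hgreatest ⟨r, hr', rfl⟩), hrise⟩

lemma neg_le_of_not_isMax (h : IsGapWord n (startAscents g) [z, y, w]) (hmax : ¬ IsMax z y w)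
    (hJ : Junction (color g z) (color g y) Q) (hJ' : Junction (color g y) (color g w) Q') :
    -Q ≤ Q' := by
  by_cases hmin : IsMin z y w
  · obtain ⟨r, hr, hr', -⟩ := exists_rise_of_isMin h hmin hJ hJ'
    omega
  have hz := h.mem_Icc z (by simp)
  have hy := h.mem_Icc y (by simp)
  have hw := h.mem_Icc w (by simp)
  rw [Set.mem_Icc] at hz hy hw
  obtain ⟨l, hl, hl'⟩ : ∃ l, l ∈ strandsBetween n z.1 y.1 ∧ l ∈ strandsBetween n y.1 w.1 := by
    have hzy := h.alternating.rel.1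
    have hyw := h.tail.alternating.rel.1
    have hside : y.1 < z.1 ∧ y.1 < w.1 ∨ z.1 < y.1 ∧ w.1 < y.1 := by
      unfold IsMin at hmin
      unfold IsMax at hmax
      cases hb : y.2 <;> simp [hb] at hmin hmax <;> omega
    rcases hside with hlt | hlt
    · exact ⟨⟨y.1.toNat, by omega⟩, .inr (by simp; omega), .inl (by simp; omega)⟩
    · exact ⟨⟨(y.1 - 1).toNat, by omega⟩, .inl (by simp; omega), .inr (by simp; omega)⟩
  exact ((hJ.isLeast h.pair).2 ⟨l, hl, rfl⟩).trans ((hJ'.isGreatest h.tail).2 ⟨l, hl', rfl⟩)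

lemma color_of_isMax (h : IsGapWord n A [z, y, w]) (hmax : IsMax z y w)
    (hJ : Junction (color g z) (color g y) Q) (hJ' : Junction (color g y) (color g w) Q') :
    color g y Q' = false ∧ color g y (-Q) = true ∧ color g w (-Q') = false := by
  obtain ⟨l, hl, hQ⟩ := (hJ.isLeast h.pair).1
  obtain ⟨r, hr, hQ'⟩ := (hJ'.isGreatest h.tail).1
  rw [← hJ'.apply_eq, ← hQ, ← hQ']
  obtain ⟨t, b⟩ := y
  dsimp only [strandsBetween, Set.mem_ofPred_eq] at *
  rw [color_strandPoint, color_strandPoint]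
  rcases hmax with ⟨rfl, hzy, hyw⟩ | ⟨rfl, hzy, hyw⟩ <;> simp <;> omega

end Junctions

end GapWord

/-! ### The image of a gap word under a permutation braid -/

namespace GapWord

section Reduction

variable {n : ℕ} {g : Equiv.Perm (Fin n)} {R : Letter → Letter → Letter → Prop}
  [∀ z y w, Decidable (R z y w)] {x y z w : Letter} {W : List Letter} {lo Q Q' : ℤ} {k δ : ℕ}

/-- A relation on triples of consecutive letters which implies that the path given by the middle
letter passes from the left to the right between its junctions with its neighbours. -/
def RiseRelation (g : Equiv.Perm (Fin n)) (R : Letter → Letter → Letter → Prop) : Prop :=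
  ∀ z y w, IsGapWord n (startAscents g) [z, y, w] → R z y w →
    ∀ Q Q', Junction (color g z) (color g y) Q → Junction (color g y) (color g w) Q' →
      ∃ r, -Q ≤ r ∧ r < Q' ∧ Rise (color g y) r

lemma riseRelation_isMin (g : Equiv.Perm (Fin n)) : RiseRelation g IsMin :=
  fun _ _ _ h hmin _ _ => exists_rise_of_isMin h hmin

/-- The path given by the letter `x` continues at least up to the gap `lo` before it meets the
first path of `W`, and gains `δ` local minima on the way. -/
def Enters (g : Equiv.Perm (Fin n)) (lo : ℤ) (δ : ℕ) (x : Letter) : List Letter → Prop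
  | [] => lo ≤ n ∧ δ = 0
  | y :: _ => ∀ Q, Junction (color g x) (color g y) Q → lo ≤ Q ∧ Gains (color g x) lo Q δ

/-- `GapWord.Reduces` for the images of the letters of the word `x :: W`. -/
def ReducesWord (g : Equiv.Perm (Fin n)) (lo : ℤ) (x : Letter) (W : List Letter) (k : ℕ) : Prop :=
  Reduces (n + 1) (frameSet x.2 (endAscents g)) (frameSet x.2 (Set.Icc 0 n)) lo (color g x)
    (W.map (color g)) k

lemma ReducesWord.flip (hxy : y.2 = !x.2) (h : ReducesWord g lo y W k) :
    Reduces (n + 1) (flipSet (frameSet x.2 (endAscents g))) (flipSet (frameSet x.2 (Set.Icc 0 n)))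
      lo (color g y) (W.map (color g)) k := by
  rwa [flipSet_frameSet, flipSet_frameSet, ← hxy]

lemma reducesWord_of_enters (hR : RiseRelation g R)
    (hword : IsGapWord n (startAscents g) (x :: y :: W)) (hQ : Junction (color g x) (color g y) Q)
    (hle : Enters g (-Q) 0 y W)
    (ih : ∀ δ, Enters g (-Q) δ y W → ReducesWord g (-Q) y W (countTriples R (y :: W) + δ)) :
    ReducesWord g (-Q) y W (countTriples R (x :: y :: W)) := by
  rcases W with _ | ⟨w, W⟩
  · exact ih 0 hle
  · rw [countTriples, add_comm]
    refine ih _ fun Q' hQ' => ⟨(hle Q' hQ').1, ?_⟩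
    split_ifs with hr
    · exact .inr ⟨rfl, hR x y w hword.triple hr Q Q' hQ hQ'⟩
    · exact .inl rfl

lemma ReducesWord.step_of_isMax (hword : IsGapWord n (startAscents g) (x :: y :: w :: W))
    (hQ : Junction (color g x) (color g y) Q) (hQ' : Junction (color g y) (color g w) Q')
    (hmax : IsMax x y w) (hlt : Q' < -Q) (hlo : lo ≤ Q) (hδ : Gains (color g x) lo Q δ)
    (h : ReducesWord g (-Q') w W k) : ReducesWord g lo x (y :: w :: W) (k + δ) := by
  have hcol := isColoringIn_color g
  obtain ⟨hy, hy', hw⟩ := color_of_isMax hword.triple hmax hQ hQ'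
  rcases (show Q + Q' ≤ -1 by omega).eq_or_lt with heq | hlt
  · have hneg : -Q = Q' + 1 := by omega
    rw [hneg] at hy'
    refine .step (hcol x) (hcol y).toIsColoring hQ hlo hδ (ReducesWord.flip hword.snd_eq ?_)
    rw [hneg]
    exact .single (hcol y) (hcol w).toIsColoring hQ' ⟨hy, hy'⟩ (h.flip hword.tail.snd_eq)
  · have hxw : w.2 = x.2 := by rw [hword.tail.snd_eq, hword.snd_eq, Bool.not_not]
    refine .skip (hcol x) (hcol y).toIsColoring (hcol w).toIsColoring hQ hQ' hlo hlt hw hδ ?_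
    rw [← hxw]
    exact h

lemma IsMax.not_isMax (h : IsMax x y w) (hyw : w.2 = !y.2) : ¬ IsMax y w z := by
  unfold IsMax at h ⊢
  cases hb : y.2 <;> simp [hb, hyw] at h ⊢ <;> omega

lemma enters_of_not_isMax (hword : IsGapWord n (startAscents g) (x :: y :: W))
    (hQ : Junction (color g x) (color g y) Q) (hmax : ∀ w ∈ W.head?, ¬ IsMax x y w) :
    Enters g (-Q) 0 y W := by
  rcases W with _ | ⟨w, W⟩
  · have := hQ.lt (isColoringIn_color g x).toIsColoring (isColoringIn_color g y).toIsColoring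
    exact ⟨by omega, rfl⟩
  · exact fun Q' hQ' => ⟨neg_le_of_not_isMax hword.triple (hmax w rfl) hQ hQ', .inl rfl⟩

theorem Enters.reducesWord (hR : RiseRelation g R) (hword : IsGapWord n (startAscents g) (x :: W))
    (h : Enters g lo δ x W) : ReducesWord g lo x W (countTriples R (x :: W) + δ) := by
  induction hm : W.length using Nat.strong_induction_on generalizing x W lo δ with
  | _ m ih =>
  subst hm
  have hcol := isColoringIn_color g
  rcases W with _ | ⟨y, W⟩
  · obtain ⟨hlo, rfl⟩ := h
    exact .last (hcol x) (by omega)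
  obtain ⟨Q, hQ⟩ := exists_junction g hword.pair
  obtain ⟨hlo, hδ⟩ := h Q hQ
  by_cases hle : Enters g (-Q) 0 y W
  · refine .step (hcol x) (hcol y).toIsColoring hQ hlo hδ (ReducesWord.flip hword.snd_eq ?_)
    exact reducesWord_of_enters hR hword hQ hle fun δ h => ih _ (by simp) hword.tail h rfl
  obtain ⟨w, hw, hmax⟩ : ∃ w ∈ W.head?, IsMax x y w := by
    by_contra! hmax
    exact hle (enters_of_not_isMax hword hQ hmax)
  rcases W with _ | ⟨w', W⟩
  · simp at hw
  obtain rfl : w' = w := by simpa using hw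
  obtain ⟨Q', hQ'⟩ := exists_junction g hword.tail.pair
  have hlt : Q' < -Q := by
    by_contra! hge
    exact hle fun Q'' hQ'' => ⟨hQ''.unique hQ' ▸ hge, .inl rfl⟩
  have hnR : ¬ R x y w' := by
    intro hr
    obtain ⟨r, hr, hr', -⟩ := hR x y w' hword.triple hr Q Q' hQ hQ'
    omega
  rw [countTriples, if_neg hnR, zero_add]
  refine .step_of_isMax hword hQ hQ' hmax hlt hlo hδ ?_
  exact reducesWord_of_enters hR hword.tail hQ'
    (enters_of_not_isMax hword.tail hQ' fun z _ => hmax.not_isMax hword.tail.snd_eq) fun δ h =>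
      ih _ (by simp) hword.tail.tail h rfl

end Reduction

section Image

variable {n : ℕ} (g : Equiv.Perm (Fin n))

/-- The action of the permutation braid of `g` on words in gaps. -/
def permHom : FreeGroup ℤ →* FreeGroup ℤ :=
  FreeGroup.lift fun t => FreeGroup.mk (runTo (baseColor g t) (-(n + 1)) (n + 1))

/-- The point of view of a letter. -/
def frameHom (b : Bool) : FreeGroup ℤ →* FreeGroup ℤ := if b then MonoidHom.id _ else flipHom

lemma flipHom_frameHom (b : Bool) (x : FreeGroup ℤ) : flipHom (frameHom b x) = frameHom (!b) x := by
  cases b <;> simp [frameHom, flipHom_flipHom]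

lemma mk_runTo_color (x : Letter) : FreeGroup.mk (runTo (color g x) (-(n + 1)) (n + 1)) =
    frameHom x.2 (permHom g (FreeGroup.mk [x])) := by
  have h (t : ℤ) : permHom g (FreeGroup.mk [(t, true)]) =
      FreeGroup.mk (runTo (baseColor g t) (-(n + 1)) (n + 1)) := by
    simp [permHom]
  obtain ⟨t, _ | _⟩ := x
  · have hinv : (FreeGroup.mk [(t, false)] : FreeGroup ℤ) = (FreeGroup.mk [(t, true)])⁻¹ := by
      simp [FreeGroup.inv_mk, FreeGroup.invRev]
    have hflip := flipHom_mk_runTo_flipColor (c := baseColor g t) (y := -((n : ℤ) + 1))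
      (e := n + 1) (by omega)
    rw [neg_neg] at hflip
    rw [hinv, map_inv, h, ← hflip]
    simp [frameHom, color, flipHom_flipHom]
  · simp [frameHom, color, h]

lemma mk_runTo_mul_tailValue {x : Letter} {W : List Letter} (hW : Alternating (x :: W)) :
    FreeGroup.mk (runTo (color g x) (-(n + 1)) (n + 1)) * tailValue (n + 1) (W.map (color g)) =
      frameHom x.2 (permHom g (FreeGroup.mk (x :: W))) := by
  induction W generalizing x with
  | nil => simp only [List.map_nil, tailValue, mul_one, mk_runTo_color]
  | cons y W ih =>
    have hxy : y.2 = !x.2 := Bool.eq_not_of_ne hW.rel.2.symm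
    rw [List.map_cons, tailValue, ih hW.tail, flipHom_frameHom, hxy, Bool.not_not, mk_runTo_color,
      mk_cons x (y :: W), map_mul, map_mul]

lemma Tight.tail {A : Set ℤ} {k : ℕ} {z : Letter} {l : List Letter} (h : Tight A k (z :: l)) :
    Tight A (k - 1) l :=
  ⟨h.alternating.tail, h.minIn.tail,
    Nat.sub_le_of_le_add (h.le_numMin.trans (countTriples_cons_le IsMin z l))⟩

variable {g}

theorem exists_image {R : Letter → Letter → Letter → Prop} [∀ z y w, Decidable (R z y w)]
    (hR : RiseRelation g R) {W : List Letter} (hW : IsGapWord n (startAscents g) W) :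
    ∃ O, permHom g (FreeGroup.mk W) = FreeGroup.mk O ∧ IsGapWord n (endAscents g) O ∧
      countTriples R W ≤ numMin O + 1 := by
  rcases W with _ | ⟨x, W⟩
  · exact ⟨[], map_one _, ⟨.nil, trivial, by simp⟩, by simp [countTriples]⟩
  have hcol := fun a => (isColoringIn_color g a).toIsColoring
  have henters : Enters g (-n) 0 x W := by
    rcases W with _ | ⟨y, W⟩
    · exact ⟨by omega, rfl⟩
    · intro Q hQ
      have := hQ.lt (hcol x) (hcol y)
      exact ⟨by omega, .inl rfl⟩
  obtain ⟨O, hO, hred, hG⟩ := henters.reducesWord hR hW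
  rw [← neg_add', mk_runTo_mul_tailValue g hW.alternating] at hO
  have htight := (hred.tight (-n - 2, false) ((hcol x).left _ (by omega)).symm
    (fun _ => by dsimp only; omega) (fun _ => by dsimp only; omega)).tail
  cases hx : x.2 <;> rw [hx] at hO hG htight
  · have htight' := (tight_map_flip (endAscents g) _ O).2 htight
    refine ⟨O.map flip, ?_, ⟨htight'.alternating, htight'.minIn, mem_of_mem_map_flip hG⟩,
      Nat.le_add_of_sub_le htight'.le_numMin⟩
    rw [← flipHom_mk, ← hO]
    simp [frameHom, flipHom_flipHom]
  · exact ⟨O, hO, ⟨htight.alternating, htight.minIn, hG⟩, Nat.le_add_of_sub_le htight.le_numMin⟩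

end Image

end GapWord

/-! ### Growth of the number of local minima -/

namespace GapWord

open Braid

section Products

variable {n : ℕ} {f g : Equiv.Perm (Fin n)} {F : List (Equiv.Perm (Fin n))} {A B : Set ℤ}

/-- The action of a product of permutation braids, the first one acting first. -/
def permHomProd : List (Equiv.Perm (Fin n)) → FreeGroup ℤ →* FreeGroup ℤ
  | [] => MonoidHom.id _
  | f :: F => (permHomProd F).comp (permHom f)

lemma MinIn.mono (hAB : A ⊆ B) : ∀ {l : List Letter}, MinIn A l → MinIn B l
  | _ :: _ :: _ :: _, h => ⟨fun hm => hAB (h.1 hm), h.2.mono hAB⟩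
  | [_, _], _ | [_], _ | [], _ => trivial

lemma endAscents_subset (h : LeftWeighted f g) : endAscents f ⊆ startAscents g := by
  intro y hy s hs
  by_contra hlt
  have hne : g (leftPos s) ≠ g (rightPos s) := g.injective.ne (leftPos_ne_rightPos s)
  exact (hy s hs).asymm (h s ((not_lt.1 hlt).lt_of_ne hne.symm))

lemma exists_image_prod {R : Letter → Letter → Letter → Prop} [∀ z y w, Decidable (R z y w)]
    (hR : RiseRelation f R) (hF : (f :: F).IsChain LeftWeighted) {W : List Letter}
    (hW : IsGapWord n (startAscents f) W) :
    ∃ O, permHomProd (f :: F) (FreeGroup.mk W) = FreeGroup.mk O ∧ Alternating O ∧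
      countTriples R W ≤ numMin O + (F.length + 1) := by
  induction F generalizing f R W with
  | nil =>
    obtain ⟨O, hO, hword, hcount⟩ := exists_image hR hW
    exact ⟨O, hO, hword.alternating, hcount⟩
  | cons f' F ih =>
    obtain ⟨O, hO, hword, hcount⟩ := exists_image hR hW
    obtain ⟨O', hO', halt, hcount'⟩ := ih (riseRelation_isMin f') hF.tail
      ⟨hword.alternating, hword.minIn.mono (endAscents_subset hF.rel), hword.mem_Icc⟩
    refine ⟨O', ?_, halt, ?_⟩
    · rw [permHomProd, MonoidHom.comp_apply, hO, hO']
    · change numMin O ≤ _ at hcount'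
      rw [List.length_cons]
      omega

end Products

section AltWord

variable {x y a : Letter} {N : ℕ}

/-- The word `(x y)^N`. -/
def altWord (x y : Letter) : ℕ → List Letter
  | 0 => []
  | N + 1 => x :: y :: altWord x y N

lemma mk_altWord (x y : Letter) (N : ℕ) :
    FreeGroup.mk (altWord x y N) = FreeGroup.mk [x, y] ^ N := by
  induction N with
  | zero => rfl
  | succ N ih =>
    rw [altWord, pow_succ', ← ih, ← mk_append]
    rfl

lemma alternating_altWord (h : x.1 ≠ y.1 ∧ x.2 ≠ y.2) : ∀ N, Alternating (altWord x y N)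
  | 0 => .nil
  | 1 => .cons_cons h (.singleton y)
  | N + 2 => .cons_cons h (.cons_cons ⟨h.1.symm, h.2.symm⟩ (alternating_altWord h (N + 1)))

lemma mem_altWord (h : a ∈ altWord x y N) : a = x ∨ a = y := by
  induction N with
  | zero => simp [altWord] at h
  | succ N ih =>
    simp only [altWord, List.mem_cons] at h
    tauto

lemma not_isMin_self (x y : Letter) : ¬ IsMin x y x := by
  unfold IsMin
  omega

lemma minIn_altWord (A : Set ℤ) (x y : Letter) : ∀ N, MinIn A (altWord x y N)
  | 0 | 1 => trivial
  | N + 2 => ⟨fun h => absurd h (not_isMin_self x y), fun h => absurd h (not_isMin_self y x),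
      minIn_altWord A x y (N + 1)⟩

lemma countTriples_altWord (R : Letter → Letter → Letter → Prop) [∀ z y w, Decidable (R z y w)]
    (x y : Letter) (N : ℕ) : countTriples R (altWord x y (N + 1)) =
      N * ((if R x y x then 1 else 0) + if R y x y then 1 else 0) := by
  induction N with
  | zero => simp [altWord, countTriples]
  | succ N ih =>
    rw [add_mul, one_mul, ← ih, altWord, altWord, countTriples, countTriples, ← altWord]
    ring

lemma numMin_altWord (x y : Letter) : ∀ N, numMin (altWord x y N) = 0
  | 0 => rfl
  | N + 1 => by
    rw [numMin, countTriples_altWord, if_neg (not_isMin_self x y), if_neg (not_isMin_self y x),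
      add_zero, mul_zero]

lemma le_countTriples_altWord {R : Letter → Letter → Letter → Prop}
    [∀ z y w, Decidable (R z y w)] (h : R x y x ∨ R y x y) (N : ℕ) :
    N ≤ countTriples R (altWord x y (N + 1)) := by
  rw [countTriples_altWord]
  refine Nat.le_mul_of_pos_right N ?_
  rcases h with h | h <;> simp [h]

end AltWord

section Separates

variable {n : ℕ} {g : Equiv.Perm (Fin n)} {u c e : ℤ} {y : Letter} {l x₁ x₂ : Fin n}

lemma strandsBetween_comm (n : ℕ) (u t : ℤ) : strandsBetween n u t = strandsBetween n t u :=
  Set.ext fun _ => Or.comm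

lemma riseRelation_of_strandPoint (hx₁ : x₁ ∈ strandsBetween n u y.1)
    (hx₂ : x₂ ∈ strandsBetween n u y.1) (hl₁ : strandPoint g y.2 x₁ ≤ strandPoint g y.2 l)
    (hl₂ : strandPoint g y.2 l ≤ strandPoint g y.2 x₂)
    (hl : color g y (strandPoint g y.2 l) = false)
    (hx : color g y (strandPoint g y.2 x₂) = true) :
    RiseRelation g fun z y' w => z.1 = u ∧ y' = y ∧ w.1 = u := by
  rintro z _ w h ⟨rfl, rfl, hw⟩ Q Q' hQ hQ'
  rw [← hw, strandsBetween_comm] at hx₂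
  obtain ⟨r, hr, hr', hrise⟩ := exists_rise hl₂ hl hx
  exact ⟨r, ((hQ.isLeast h.pair).2 ⟨x₁, hx₁, rfl⟩).trans (hl₁.trans hr),
    hr'.trans_le ((hQ'.isGreatest h.tail).2 ⟨x₂, hx₂, rfl⟩), hrise⟩

/-- A strand that starts outside of the interval between the gaps `c` and `e` ends between strands
that start inside. -/
def Separates (g : Equiv.Perm (Fin n)) (c e : ℤ) : Prop :=
  ∃ l x₁ x₂ : Fin n, ¬ (c ≤ l.val ∧ l.val < e) ∧ (c ≤ x₁.val ∧ x₁.val < e) ∧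
    (c ≤ x₂.val ∧ x₂.val < e) ∧ g x₁ < g l ∧ g l < g x₂

lemma Separates.exists_riseRelation (h : Separates g c e) :
    ∃ R : Letter → Letter → Letter → Prop, RiseRelation g R ∧
      (R (c, true) (e, false) (c, true) ∨ R (e, false) (c, true) (e, false)) := by
  obtain ⟨l, x₁, x₂, hl, hx₁, hx₂, hlt₁, hlt₂⟩ := h
  rw [Fin.lt_def] at hlt₁ hlt₂
  by_cases hlc : l.val < c
  · refine ⟨_, riseRelation_of_strandPoint (u := e) (y := (c, true)) (l := l) (.inr hx₁)
      (.inr hx₂) ?_ ?_ ?_ ?_, .inr ⟨rfl, rfl, rfl⟩⟩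
    · simp [strandPoint, hlt₁.le]
    · simp [strandPoint, hlt₂.le]
    · simp [color_strandPoint, hlc]
    · simp [color_strandPoint, hx₂.1]
  · have hel : e ≤ l.val := by omega
    refine ⟨_, riseRelation_of_strandPoint (u := c) (y := (e, false)) (l := l) (.inl hx₂)
      (.inl hx₁) ?_ ?_ ?_ ?_, .inl ⟨rfl, rfl, rfl⟩⟩
    · simp only [strandPoint, Bool.false_eq_true, ↓reduceIte]; omega
    · simp only [strandPoint, Bool.false_eq_true, ↓reduceIte]; omega
    · simp [color_strandPoint, hel]
    · simp [color_strandPoint, hx₁.2]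

end Separates

section FreeReduction

variable {α : Type*}

lemma Alternating.isReduced {l : List Letter} (h : Alternating l) : FreeGroup.IsReduced l :=
  List.IsChain.imp (fun _ _ hab heq => absurd heq hab.1) h

lemma countTriples_append (R : α → α → α → Prop) [∀ z y w, Decidable (R z y w)] (z y w : α) :
    ∀ l : List α,
      countTriples R (l ++ [z, y, w]) = countTriples R (l ++ [z, y]) + if R z y w then 1 else 0
  | [] | [_] | [_, _] => by simp [countTriples, add_assoc]
  | a :: b :: c :: l => by
    have ih := countTriples_append R z y w (b :: c :: l)
    simp only [List.cons_append, countTriples] at ih ⊢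
    rw [ih, add_assoc]

lemma numMin_invRev : ∀ l : List Letter, numMin (FreeGroup.invRev l) = numMin l
  | z :: y :: w :: l => by
    have ih := numMin_invRev (y :: w :: l)
    have hmin : IsMin (w.1, !w.2) (y.1, !y.2) (z.1, !z.2) ↔ IsMin z y w := by
      unfold IsMin
      rcases y with ⟨y, _ | _⟩ <;> simp [and_comm]
    simp only [FreeGroup.invRev, List.map_cons, List.reverse_cons, List.append_assoc,
      List.cons_append, List.nil_append, numMin] at ih ⊢
    rw [countTriples_append, ih]
    simp only [hmin, countTriples]
    ring
  | [_, _] | [_] | [] => rfl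

lemma numMin_toWord_inv (x : FreeGroup ℤ) : numMin x⁻¹.toWord = numMin x.toWord := by
  rw [FreeGroup.toWord_inv, numMin_invRev]

lemma numMin_reduce_cons_le (a : Letter) {Y : List Letter} (hY : FreeGroup.reduce Y = Y) :
    numMin (FreeGroup.reduce (a :: Y)) ≤ numMin Y + 1 := by
  rw [FreeGroup.reduce.cons, hY]
  rcases Y with _ | ⟨h, Y⟩
  · exact Nat.zero_le _
  · dsimp only
    split_ifs
    · exact (countTriples_le_cons IsMin h Y).trans (Nat.le_succ _)
    · exact countTriples_cons_le IsMin a (h :: Y)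

lemma numMin_toWord_mk_mul (L : List Letter) (x : FreeGroup ℤ) :
    numMin (FreeGroup.mk L * x).toWord ≤ numMin x.toWord + L.length := by
  induction L with
  | nil => rw [← FreeGroup.one_eq_mk, one_mul, List.length_nil, add_zero]
  | cons a L ih =>
    have hcons (y : FreeGroup ℤ) :
        (FreeGroup.mk [a] * y).toWord = FreeGroup.reduce (a :: y.toWord) := by
      conv_lhs => rw [← FreeGroup.mk_toWord (x := y), ← mk_append, FreeGroup.toWord_mk]
      rfl
    rw [mk_cons, mul_assoc, hcons, List.length_cons, ← add_assoc]
    exact (numMin_reduce_cons_le a (FreeGroup.reduce_toWord _)).trans (Nat.add_le_add_right ih 1)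

lemma numMin_toWord_conj (w x : FreeGroup ℤ) :
    numMin (w * x * w⁻¹).toWord ≤ numMin x.toWord + 2 * w.toWord.length := by
  have hmul (y : FreeGroup ℤ) : numMin (w * y).toWord ≤ numMin y.toWord + w.toWord.length := by
    simpa only [FreeGroup.mk_toWord] using numMin_toWord_mk_mul w.toWord y
  have hleft := hmul (x * w⁻¹)
  have hright := hmul x⁻¹
  rw [← numMin_toWord_inv (w * x⁻¹), numMin_toWord_inv x, mul_inv_rev, inv_inv] at hright
  rw [mul_assoc]
  omega

lemma numMin_toWord_pow {c e : ℤ} (hce : c ≠ e) (N : ℕ) :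
    numMin ((FreeGroup.of c * (FreeGroup.of e)⁻¹) ^ N).toWord = 0 := by
  have hpow : (FreeGroup.of c * (FreeGroup.of e)⁻¹) ^ N =
      FreeGroup.mk (altWord (c, true) (e, false) N) := (mk_altWord _ _ N).symm
  rw [hpow, FreeGroup.toWord_mk, (alternating_altWord ⟨hce, by simp⟩ N).isReduced.reduce_eq,
    numMin_altWord]

end FreeReduction

variable {n : ℕ} {f : Equiv.Perm (Fin n)} {F : List (Equiv.Perm (Fin n))} {c e : ℤ}

lemma exists_image_pow (hF : (f :: F).IsChain LeftWeighted) (hc : 0 ≤ c) (hce : c < e)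
    (he : e ≤ n) (h : Separates f c e) (N : ℕ) :
    ∃ O, permHomProd (f :: F) ((FreeGroup.of c * (FreeGroup.of e)⁻¹) ^ (N + 1)) =
      FreeGroup.mk O ∧ Alternating O ∧ N ≤ numMin O + (F.length + 1) := by
  classical
  obtain ⟨R, hR, hR'⟩ := h.exists_riseRelation
  obtain ⟨O, hO, halt, hcount⟩ := exists_image_prod hR hF
    (W := altWord (c, true) (e, false) (N + 1))
    ⟨alternating_altWord ⟨hce.ne, by simp⟩ _, minIn_altWord _ _ _ _, fun a ha => by
      rcases mem_altWord ha with rfl | rfl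
      · exact ⟨hc, hce.le.trans he⟩
      · exact ⟨hc.trans hce.le, he⟩⟩
  exact ⟨O, by rw [← hO, mk_altWord]; rfl, halt, (le_countTriples_altWord hR' N).trans hcount⟩

/-- The powers of a conjugate of `c' e'⁻¹` have a bounded number of local minima, those of the image
of `c e⁻¹` an unbounded one. -/
theorem permHomProd_ne_conj (hF : (f :: F).IsChain LeftWeighted) (hc : 0 ≤ c) (hce : c < e)
    (he : e ≤ n) (h : Separates f c e) {c' e' : ℤ} (hce' : c' ≠ e') (w : FreeGroup ℤ) :
    permHomProd (f :: F) (FreeGroup.of c * (FreeGroup.of e)⁻¹) ≠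
      w * (FreeGroup.of c' * (FreeGroup.of e')⁻¹) * w⁻¹ := by
  intro heq
  obtain ⟨O, hO, halt, hcount⟩ := exists_image_pow hF hc hce he h
    (2 * w.toWord.length + F.length + 2)
  rw [map_pow, heq, conj_pow] at hO
  have hconj := numMin_toWord_conj w ((FreeGroup.of c' * (FreeGroup.of e')⁻¹) ^
    (2 * w.toWord.length + F.length + 3))
  rw [hO, numMin_toWord_pow hce', FreeGroup.toWord_mk, halt.isReduced.reduce_eq] at hconj
  omega

end GapWord

/-! ### Braids without standard reduction systems -/

namespace GapWord

open Braid

section TwistHom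

variable {c d : ℤ → Bool} {s t y e : ℤ}

/-- The action of an Artin generator on words in gaps. -/
def twistHom (s : ℤ) : FreeGroup ℤ →* FreeGroup ℤ :=
  FreeGroup.lift fun t =>
    if t = s + 1 then FreeGroup.of s * (FreeGroup.of (s + 1))⁻¹ * FreeGroup.of (s + 2)
    else FreeGroup.of t

lemma twistHom_of_ne (h : t ≠ s + 1) : twistHom s (FreeGroup.of t) = FreeGroup.of t := by
  rw [twistHom, FreeGroup.lift_apply_of, if_neg h]

lemma twistHom_of_self (s : ℤ) : twistHom s (FreeGroup.of (s + 1)) =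
    FreeGroup.of s * (FreeGroup.of (s + 1))⁻¹ * FreeGroup.of (s + 2) := by
  rw [twistHom, FreeGroup.lift_apply_of, if_pos rfl]

lemma mk_singleton_true (t : ℤ) : (FreeGroup.mk [(t, true)] : FreeGroup ℤ) = FreeGroup.of t := rfl

lemma mk_singleton_false (t : ℤ) :
    (FreeGroup.mk [(t, false)] : FreeGroup ℤ) = (FreeGroup.of t)⁻¹ := rfl

lemma twistHom_mk {l : List Letter} (h : ∀ a ∈ l, a.1 ≠ s + 1) :
    twistHom s (FreeGroup.mk l) = FreeGroup.mk l := by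
  induction l with
  | nil => exact map_one _
  | cons a l ih =>
    have ha : twistHom s (FreeGroup.of a.1) = FreeGroup.of a.1 :=
      twistHom_of_ne (h a List.mem_cons_self)
    rw [mk_cons, map_mul, ih fun b hb => h b (List.mem_cons_of_mem a hb)]
    congr 1
    obtain ⟨t, _ | _⟩ := a
    · rw [mk_singleton_false, map_inv, ha]
    · exact ha

lemma twistHom_mk_runTo_of_notMem (hy : y ≤ e) (h : s + 1 ∉ Set.Ico y e) :
    twistHom s (FreeGroup.mk (runTo c y e)) = FreeGroup.mk (runTo c y e) :=
  twistHom_mk fun _ ha heq => h (heq ▸ mem_Ico_of_mem_runTo hy ha)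

lemma runTo_three (c : ℤ → Bool) (s : ℤ) : runTo c s (s + 3) =
    (if c s = c (s + 1) then [] else [(s, c (s + 1))]) ++
    ((if c (s + 1) = c (s + 2) then [] else [(s + 1, c (s + 2))]) ++
    (if c (s + 2) = c (s + 3) then [] else [(s + 2, c (s + 3))])) := by
  rw [runTo_of_lt (by omega), runTo_of_lt (by omega), runTo_of_lt (by omega),
    add_assoc, add_assoc, one_add_one_eq_two, two_add_one_eq_three, runTo_self, List.append_nil]

/-- The hypothesis `hc` says that the path does not separate the strands against the direction of
their crossing. -/
lemma twistHom_mk_runTo_three (hd : d s = c s) (hd₁ : d (s + 1) = c (s + 2))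
    (hd₂ : d (s + 2) = c (s + 1)) (hd₃ : d (s + 3) = c (s + 3))
    (hc : c (s + 1) = true → c (s + 2) = true) :
    twistHom s (FreeGroup.mk (runTo c s (s + 3))) = FreeGroup.mk (runTo d s (s + 3)) := by
  have h₀ : twistHom s (FreeGroup.of s) = FreeGroup.of s := twistHom_of_ne (by omega)
  have h₂ : twistHom s (FreeGroup.of (s + 2)) = FreeGroup.of (s + 2) := twistHom_of_ne (by omega)
  rw [runTo_three, runTo_three, hd, hd₁, hd₂, hd₃]
  revert hc
  rcases c s <;> rcases c (s + 1) <;> rcases c (s + 2) <;> rcases c (s + 3) <;>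
    simp only [mk_append, map_mul, map_inv, map_one, mk_singleton_true, mk_singleton_false,
      ← FreeGroup.one_eq_mk, h₀, twistHom_of_self, h₂, if_true, if_false, Bool.false_eq_true,
      Bool.true_eq_false, IsEmpty.forall_iff, forall_const, one_mul, mul_one] <;>
    group

lemma twistHom_mk_runTo (hy : y ≤ s) (he : s + 3 ≤ e) (hd₁ : d (s + 1) = c (s + 2))
    (hd₂ : d (s + 2) = c (s + 1)) (hd : ∀ k, k ≠ s + 1 → k ≠ s + 2 → d k = c k)
    (hc : c (s + 1) = true → c (s + 2) = true) :
    twistHom s (FreeGroup.mk (runTo c y e)) = FreeGroup.mk (runTo d y e) := by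
  have hsplit (c : ℤ → Bool) :
      runTo c y e = runTo c y s ++ (runTo c s (s + 3) ++ runTo c (s + 3) e) := by
    rw [runTo_append hy (by omega), runTo_append (y := s) (by omega) he]
  have hleft : runTo d y s = runTo c y s :=
    runTo_congr hy fun k _ _ => hd k (by omega) (by omega)
  have hright : runTo d (s + 3) e = runTo c (s + 3) e :=
    runTo_congr he fun k _ _ => hd k (by omega) (by omega)
  rw [hsplit, hsplit d, mk_append, mk_append, mk_append, mk_append, map_mul, map_mul,
    twistHom_mk_runTo_of_notMem hy fun h => by linarith [h.2],
    twistHom_mk_runTo_of_notMem he fun h => by linarith [h.1],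
    twistHom_mk_runTo_three (hd s (by omega) (by omega)) hd₁ hd₂ (hd _ (by omega) (by omega)) hc,
    hleft, hright]

end TwistHom

variable {n : ℕ}

section PermHom

variable (f : Equiv.Perm (Fin n)) (s : Fin (n - 1)) (t : ℤ)

lemma baseColor_add_one_eq (l : Fin n) :
    baseColor f t (l.val + 1) = decide (t ≤ (f.symm l).val) := by
  rw [← baseColor_apply_add_one, Equiv.apply_symm_apply]

lemma baseColor_rightPos :
    baseColor f t (s.val + 2) = decide (t ≤ (f.symm (rightPos s)).val) := by
  rw [← baseColor_add_one_eq]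
  congr 1

lemma baseColor_swapEnds_of_ne {k : ℤ} (hl : k ≠ s.val + 1) (hr : k ≠ s.val + 2) :
    baseColor (swapEnds s f) t k = baseColor f t k := by
  by_cases hk : ∃ l : Fin n, k = l.val + 1
  · obtain ⟨l, rfl⟩ := hk
    rw [baseColor_add_one_eq, baseColor_add_one_eq, swapEnds_symm_of_ne]
    · rintro rfl
      exact hl rfl
    · rintro rfl
      simp [rightPos] at hr
      omega
  · rw [not_exists] at hk
    rw [baseColor_of_ne _ _ _ fun l => hk _, baseColor_of_ne _ _ _ fun l => hk _]

lemma permHom_swapEnds (h : f.symm (leftPos s) < f.symm (rightPos s)) (x : FreeGroup ℤ) :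
    permHom (swapEnds s f) x = twistHom s.1 (permHom f x) := by
  have hof (t : ℤ) : permHom (swapEnds s f) (.of t) = twistHom s.1 (permHom f (.of t)) := by
    have hs := s.2
    rw [Fin.lt_def] at h
    rw [permHom, permHom, FreeGroup.lift_apply_of, FreeGroup.lift_apply_of]
    refine (twistHom_mk_runTo (by omega) (by omega) ?_ ?_
      (fun k => baseColor_swapEnds_of_ne f s t) ?_).symm
    · rw [baseColor_rightPos, ← swapEnds_symm_left]
      exact baseColor_add_one_eq _ t (leftPos s)
    · rw [baseColor_rightPos, swapEnds_symm_right]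
      exact (baseColor_add_one_eq f t (leftPos s)).symm
    · rw [baseColor_rightPos, show baseColor f t (s.val + 1) = _ from
        baseColor_add_one_eq f t (leftPos s)]
      simp only [decide_eq_true_eq]
      omega
  exact DFunLike.congr_fun (FreeGroup.ext_hom (permHom _) ((twistHom _).comp (permHom f)) hof) x

variable {t}

lemma baseColor_one (h₀ : 0 ≤ t) (hn : t ≤ n) (k : ℤ) :
    baseColor (1 : Equiv.Perm (Fin n)) t k = decide (t < k) := by
  unfold baseColor
  split_ifs with hk
  · rw [decide_eq_decide]
    change t ≤ ((k - 1).toNat : ℤ) ↔ _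
    omega
  · rw [decide_eq_decide]
    omega

lemma permHom_one_of (h₀ : 0 ≤ t) (hn : t ≤ n) :
    permHom (1 : Equiv.Perm (Fin n)) (FreeGroup.of t) = FreeGroup.of t := by
  have hnil {y e : ℤ} (hy : y ≤ e) (ht : t ∉ Set.Ico y e) :
      runTo (baseColor (1 : Equiv.Perm (Fin n)) t) y e = [] := by
    refine List.eq_nil_iff_forall_not_mem.2 fun a ha => ht ?_
    have hcross := mem_runTo hy ha
    rw [baseColor_one h₀ hn, baseColor_one h₀ hn, Ne, decide_eq_decide] at hcross
    obtain rfl : a.1 = t := by omega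
    exact mem_Ico_of_mem_runTo hy ha
  rw [permHom, FreeGroup.lift_apply_of, runTo_append (x := t) (by omega) (by omega),
    hnil (by omega) (by simp), runTo_of_lt (by omega), hnil (by omega) (by simp),
    baseColor_one h₀ hn, baseColor_one h₀ hn]
  simp [mk_singleton_true]

end PermHom

section Artin

/-- The embedding of the fundamental group which records the gaps crossed by a loop: the loop
around the puncture `k` crosses the gaps on both sides of it. -/
def gapHom (n : ℕ) : FreeGroup (Fin n) →* FreeGroup ℤ :=
  FreeGroup.lift fun k => FreeGroup.of (k.1 : ℤ) * (FreeGroup.of ((k.1 : ℤ) + 1))⁻¹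

lemma gapHom_of (k : Fin n) : gapHom n (FreeGroup.of k) =
    FreeGroup.of (k.1 : ℤ) * (FreeGroup.of ((k.1 : ℤ) + 1))⁻¹ := FreeGroup.lift_apply_of

lemma gapHom_of_rightPos (s : Fin (n - 1)) : gapHom n (FreeGroup.of (rightPos s)) =
    FreeGroup.of (s.1 + 1 : ℤ) * (FreeGroup.of (s.1 + 2 : ℤ))⁻¹ := by
  rw [gapHom_of, show ((rightPos s).1 : ℤ) = s.1 + 1 from Nat.cast_succ _, add_assoc]
  rfl

lemma gapHom_artinAut (s : Fin (n - 1)) (x : FreeGroup (Fin n)) :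
    gapHom n (artinAut s x) = twistHom s.1 (gapHom n x) := by
  have hof (k : Fin n) :
      gapHom n (artinAut s (.of k)) = twistHom s.1 (gapHom n (.of k)) := by
    have hl : gapHom n (FreeGroup.of (leftPos s)) =
        FreeGroup.of (s.1 : ℤ) * (FreeGroup.of (s.1 + 1 : ℤ))⁻¹ := gapHom_of _
    have hr := gapHom_of_rightPos s
    have h₀ : twistHom s.1 (.of (s.1 : ℤ)) = .of (s.1 : ℤ) := twistHom_of_ne (by omega)
    have h₂ : twistHom s.1 (.of (s.1 + 2 : ℤ)) = .of (s.1 + 2 : ℤ) := twistHom_of_ne (by omega)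
    rw [artinAut_of, artinFun]
    split_ifs with hkl hkr
    · simp only [hkl, map_mul, map_inv, hl, hr, h₀, twistHom_of_self]
      group
    · simp only [hkr, map_mul, map_inv, hl, hr, h₂, twistHom_of_self]
      group
    · rw [Fin.ext_iff] at hkl hkr
      change k.1 ≠ s.1 at hkl
      change k.1 ≠ s.1 + 1 at hkr
      rw [gapHom_of, map_mul, map_inv, twistHom_of_ne (by omega), twistHom_of_ne (by omega)]
  exact DFunLike.congr_fun (FreeGroup.ext_hom ((gapHom n).comp (artinAut s).toMonoidHom)
    ((twistHom s.1).comp (gapHom n)) hof) x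

lemma permHom_one_gapHom (x : FreeGroup (Fin n)) :
    permHom (1 : Equiv.Perm (Fin n)) (gapHom n x) = gapHom n x := by
  refine DFunLike.congr_fun (FreeGroup.ext_hom ((permHom 1).comp (gapHom n)) (gapHom n)
    fun k => ?_) x
  have hk := k.2
  rw [MonoidHom.comp_apply, gapHom_of, map_mul, map_inv, permHom_one_of (by omega) (by omega),
    permHom_one_of (by omega) (by omega)]

lemma artinRep_mul (β γ : Braid n) (x : FreeGroup (Fin n)) :
    (artinRep n (β * γ)).unop x = (artinRep n γ).unop ((artinRep n β).unop x) := by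
  rw [map_mul, MulOpposite.unop_mul, MulAut.mul_apply]

lemma artinRep_σ (s : Fin (n - 1)) : (artinRep n (σ s)).unop = artinAut s := by
  rw [artinRep, σ, PresentedGroup.toGroup.of, MulOpposite.unop_op]

lemma gapHom_artinRep_permBraid (f : Equiv.Perm (Fin n)) (x : FreeGroup (Fin n)) :
    gapHom n ((artinRep n (permBraid f)).unop x) = permHom f (gapHom n x) := by
  obtain ⟨w, hw, -⟩ := exists_isReducedWord f
  induction hw with
  | nil =>
    rw [permBraid_one, map_one, permHom_one_gapHom]
    rfl
  | snoc s hw h ih =>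
    rw [permBraid_swapEnds s _ h, artinRep_mul, artinRep_σ, gapHom_artinAut, ih,
      permHom_swapEnds _ s h]

lemma gapHom_artinRep_prod (F : List (Equiv.Perm (Fin n))) (x : FreeGroup (Fin n)) :
    gapHom n ((artinRep n (F.map permBraid).prod).unop x) = permHomProd F (gapHom n x) := by
  induction F generalizing x with
  | nil =>
    rw [List.map_nil, List.prod_nil, map_one]
    rfl
  | cons f F ih =>
    rw [List.map_cons, List.prod_cons, artinRep_mul, ih, gapHom_artinRep_permBraid, permHomProd,
      MonoidHom.comp_apply]

end Artin

section Curve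

lemma prod_map_Ico_div {G : Type*} [Group G] (h : ℕ → G) {c e : ℕ} (hce : c ≤ e) :
    ((List.Ico c e).map fun k => h k * (h (k + 1))⁻¹).prod = h c * (h e)⁻¹ := by
  induction e, hce using Nat.le_induction with
  | base => simp
  | succ e hce ih =>
    rw [List.Ico.succ_top hce, List.map_append, List.prod_append, ih, List.map_singleton,
      List.prod_singleton]
    group

lemma filter_finRange_map_val (c e : Fin n) :
    ((List.finRange n).filter fun k => decide (c ≤ k ∧ k ≤ e)).map Fin.val =
      List.Ico c (e + 1) := by
  have hP : (fun k : Fin n => decide (c ≤ k ∧ k ≤ e)) =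
      (fun k => decide (c.val ≤ k) && decide (k < e.val + 1)) ∘ Fin.val := by
    ext k
    simp only [Fin.le_def, Function.comp_apply, Bool.decide_and, Nat.lt_succ_iff]
  rw [hP, ← List.filter_map, List.map_coe_finRange_eq_range, ← List.filter_filter,
    ← List.Ico.zero_bot, List.Ico.filter_lt, List.Ico.filter_le, min_eq_right (by omega),
    max_eq_right (Nat.zero_le _)]

lemma gapHom_curve {c e : Fin n} (hce : c ≤ e) :
    gapHom n (((List.finRange n).filter fun k => decide (c ≤ k ∧ k ≤ e)).map FreeGroup.of).prod =
      FreeGroup.of (c.1 : ℤ) * (FreeGroup.of (e.1 + 1 : ℤ))⁻¹ := by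
  let h : ℕ → FreeGroup ℤ := fun k => FreeGroup.of (k : ℤ)
  have hgap : gapHom n ∘ FreeGroup.of = (fun k => h k * (h (k + 1))⁻¹) ∘ Fin.val :=
    funext gapHom_of
  rw [map_list_prod, List.map_map, hgap, ← List.map_map, filter_finRange_map_val,
    prod_map_Ico_div h (Nat.le_succ_of_le hce)]
  rfl

end Curve

theorem not_exists_isStandardReductionSystem {f : Equiv.Perm (Fin n)}
    {F : List (Equiv.Perm (Fin n))} (hF : (f :: F).IsChain LeftWeighted)
    (hf : ∀ C : StandardCircle n, Separates f C.first.1 (C.last.1 + 1)) :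
    ¬ ∃ 𝒞, IsStandardReductionSystem ((f :: F).map permBraid).prod 𝒞 := by
  rintro ⟨𝒞, h𝒞⟩
  obtain ⟨C, hC⟩ := h𝒞.nonempty
  obtain ⟨C', -, hC'⟩ := h𝒞.preserved.subset (Set.mem_image_of_mem _ hC)
  have hlt : C.first.1 < C.last.1 := C.first_lt_last
  have hlt' : C'.first.1 < C'.last.1 := C'.first_lt_last
  have hne {c e : ℤ} := permHomProd_ne_conj (c' := c) (e' := e) hF (by omega) (by omega)
    (by omega) (hf C)
  simp only [← gapHom_curve C.first_lt_last.le, ← gapHom_artinRep_prod] at hne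
  rcases Quotient.exact hC' with h | h
  · obtain ⟨w, hw⟩ := isConj_iff.1 h
    refine hne (c := C'.first.1) (e := C'.last.1 + 1) (by omega) (gapHom n w) ?_
    rw [← gapHom_curve C'.first_lt_last.le, ← hw, map_mul, map_mul, map_inv]
  · obtain ⟨w, hw⟩ := isConj_iff.1 h
    refine hne (c := C'.last.1 + 1) (e := C'.first.1) (by omega) (gapHom n w) ?_
    rw [← inv_inv (FreeGroup.of _ * _), mul_inv_rev, inv_inv, ← gapHom_curve C'.first_lt_last.le,
      ← map_inv, ← map_inv, ← map_mul, ← map_mul, ← conj_inv, hw, inv_inv]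

end GapWord

/-! ### The permutations of binary rows -/

namespace BinaryBraid

open Braid GapWord

variable {p : ℕ}

/-- The left position of the `j`-th pair. -/
def pairLeft (j : Fin p) : Fin (2 * p + 2) := ⟨2 * j.1 + 1, by omega⟩

/-- The right position of the `j`-th pair. -/
def pairRight (j : Fin p) : Fin (2 * p + 2) := ⟨2 * j.1 + 2, by omega⟩

/-- The condition on the rows of an admissible matrix: a row begins with `0` and ends with `1`. -/
def IsAdmissible (a : Fin p → Fin 2) : Prop :=
  ∀ j : Fin p, (j.1 = 0 → a j = 0) ∧ (j.1 + 1 = p → a j = 1)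

section Row

variable {a : Fin p → Fin 2} {j : Fin p}

lemma val_pairLeft : (pairLeft j).1 = 2 * j.1 + 1 := rfl

lemma val_pairRight : (pairRight j).1 = 2 * j.1 + 2 := rfl

lemma rowPerm_pairLeft_of_zero (h : a j = 0) :
    rowPerm a (pairLeft j) = nextZero a (j.1 + 1) := by
  change strandEnd a (pairLeft j) = _
  have hj : (2 * j.1 + 1) % 2 = 1 := by omega
  simp [strandEnd, pairLeft, h, hj, j.2.ne]

lemma rowPerm_pairLeft_of_one (h : a j = 1) : rowPerm a (pairLeft j) = pairRight j := by
  change strandEnd a (pairLeft j) = _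
  have hj : (2 * j.1 + 1) % 2 = 1 := by omega
  simp [strandEnd, pairLeft, pairRight, h, hj, j.2.ne]

lemma rowPerm_pairRight_of_zero (h : a j = 0) : rowPerm a (pairRight j) = pairLeft j := by
  change strandEnd a (pairRight j) = _
  have hj : (2 * j.1 + 1) / 2 = j.1 := by omega
  have hne : 2 * j.1 + 1 ≠ 2 * p := by omega
  simp [strandEnd, pairLeft, pairRight, h, hj, hne]

lemma rowPerm_pairRight_of_one (h : a j = 1) : rowPerm a (pairRight j) = prevOne a j.1 := by
  change strandEnd a (pairRight j) = _
  have hj : (2 * j.1 + 1) / 2 = j.1 := by omega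
  have hne : 2 * j.1 + 1 ≠ 2 * p := by omega
  simp [strandEnd, pairRight, h, hj, hne]

lemma val_rowPerm_first (hp : 0 < p) (ha : IsAdmissible a) : (rowPerm a 0).1 = 2 := by
  change (strandEnd a 0).1 = 2
  have hle : _ ≤ 2 := nextZero_le a 0 ⟨0, hp⟩ le_rfl ((ha _).1 rfl)
  rw [strandEnd, dif_pos (Fin.val_zero _)]
  rcases nextZero_mem a 0 with h | ⟨j, -, -, h⟩ <;> omega

lemma val_rowPerm_last (hp : 0 < p) (ha : IsAdmissible a) :
    (rowPerm a (Fin.last _)).1 = 2 * p - 1 := by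
  change (strandEnd a (Fin.last _)).1 = 2 * p - 1
  have hle : 2 * (p - 1) + 1 ≤ _ := le_prevOne a p ⟨p - 1, by omega⟩ (Nat.sub_one_lt hp.ne')
    ((ha _).2 (Nat.sub_add_cancel hp))
  rw [strandEnd, dif_neg (by simp), dif_pos (by simp)]
  rcases prevOne_mem a p with h | ⟨j, -, -, h⟩ <;> omega

lemma rowPerm_symm_first_ne (hp : 0 < p) (ha : IsAdmissible a) : (rowPerm a).symm 0 ≠ 0 := by
  intro h
  simpa [← (Equiv.symm_apply_eq _).1 h] using val_rowPerm_first hp ha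

lemma rowPerm_symm_last_ne (hp : 0 < p) (ha : IsAdmissible a) :
    (rowPerm a).symm (Fin.last _) ≠ Fin.last _ := by
  intro h
  have hlast := val_rowPerm_last hp ha
  rw [← (Equiv.symm_apply_eq _).1 h, Fin.val_last] at hlast
  omega

lemma pairLeft_lt_rowPerm (a : Fin p → Fin 2) (j : Fin p) :
    pairLeft j < rowPerm a (pairLeft j) := by
  rcases (by omega : a j = 0 ∨ a j = 1) with h | h
  · have := nextZero_gt a j
    rw [rowPerm_pairLeft_of_zero h, Fin.lt_def, val_pairLeft]
    omega
  · rw [rowPerm_pairLeft_of_one h, Fin.lt_def, val_pairLeft, val_pairRight]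
    omega

lemma rowPerm_lt_pairRight (a : Fin p → Fin 2) (j : Fin p) :
    rowPerm a (pairRight j) < pairRight j := by
  rcases (by omega : a j = 0 ∨ a j = 1) with h | h
  · rw [rowPerm_pairRight_of_zero h, Fin.lt_def, val_pairLeft, val_pairRight]
    omega
  · have := prevOne_lt a j
    rw [rowPerm_pairRight_of_one h, Fin.lt_def, val_pairRight]
    omega

lemma rowPerm_symm_lt_pairRight (a : Fin p → Fin 2) (j : Fin p) :
    (rowPerm a).symm (pairRight j) < pairRight j := by
  obtain ⟨i, hi⟩ : ∃ i, (rowPerm a).symm (pairRight j) = i := ⟨_, rfl⟩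
  have hv : (strandEnd a i).1 = 2 * j.1 + 2 :=
    congrArg Fin.val ((Equiv.symm_apply_eq _).1 hi).symm
  rw [hi, Fin.lt_def, val_pairRight]
  rcases strandEnd_cases a i with ⟨h, -⟩ | ⟨-, e⟩ | ⟨j', h, -, e⟩ | ⟨j', h, -, e⟩ |
    ⟨j', -, -, e⟩ | ⟨j', -, -, e⟩
  · omega
  · exact absurd (e ▸ hv) (prevOne_ne_right a _ _)
  · have := nextZero_gt a j'
    rw [e] at hv
    omega
  · omega
  · omega
  · exact absurd (e ▸ hv) (prevOne_ne_right a _ _)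

lemma pairLeft_lt_rowPerm_symm (a : Fin p → Fin 2) (j : Fin p) :
    pairLeft j < (rowPerm a).symm (pairLeft j) := by
  obtain ⟨i, hi⟩ : ∃ i, (rowPerm a).symm (pairLeft j) = i := ⟨_, rfl⟩
  have hv : (strandEnd a i).1 = 2 * j.1 + 1 :=
    congrArg Fin.val ((Equiv.symm_apply_eq _).1 hi).symm
  rw [hi, Fin.lt_def, val_pairLeft]
  rcases strandEnd_cases a i with ⟨-, e⟩ | ⟨h, -⟩ | ⟨j', -, -, e⟩ | ⟨j', -, -, e⟩ |
    ⟨j', h, -, e⟩ | ⟨j', h, -, e⟩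
  · exact absurd (e ▸ hv) (nextZero_ne_left a _ _)
  · omega
  · exact absurd (e ▸ hv) (nextZero_ne_left a _ _)
  · omega
  · omega
  · have := prevOne_lt a j'
    rw [e] at hv
    omega

end Row

lemma rowPerm_injective : Function.Injective (rowPerm : (Fin p → Fin 2) → _) := by
  intro a a' h
  have hzero : ∀ {a : Fin p → Fin 2} {j}, a j = 0 ↔ rowPerm a (pairRight j) = pairLeft j := by
    refine fun {a j} => ⟨rowPerm_pairRight_of_zero, fun hj => ?_⟩
    by_contra h0
    rw [rowPerm_pairRight_of_one (by omega)] at hj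
    exact (prevOne_lt a j).ne (congrArg Fin.val hj)
  funext j
  have hiff : a j = 0 ↔ a' j = 0 := by rw [hzero, hzero, h]
  omega

section LeftWeighted

variable {a : Fin p → Fin 2}

lemma rowPerm_add_one_lt (hp : 0 < p) (ha : IsAdmissible a) {x y : Fin (2 * p + 2)}
    (hx : Even x.1) (hy : y.1 = x.1 + 1) : (rowPerm a x).1 + 1 < (rowPerm a y).1 := by
  obtain ⟨m, hm⟩ := hx
  have hright {i : Fin p} (hi : i.1 + 1 = m) : x = pairRight i :=
    Fin.ext (by rw [val_pairRight]; omega)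
  have hleft {i : Fin p} (hi : i.1 = m) : y = pairLeft i :=
    Fin.ext (by rw [val_pairLeft]; omega)
  rcases Nat.eq_zero_or_pos m with rfl | hm0
  · obtain rfl : x = 0 := Fin.ext hm
    have hp1 : p ≠ 1 := fun h => by simpa [(ha ⟨0, hp⟩).1 rfl] using (ha ⟨0, hp⟩).2 h.symm
    rw [val_rowPerm_first hp ha, hleft (i := ⟨0, hp⟩) rfl,
      rowPerm_pairLeft_of_zero ((ha _).1 rfl)]
    rcases nextZero_mem a (0 + 1) with h | ⟨j, hj, -, h⟩ <;> rw [h] <;> omega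
  obtain ⟨i, hi⟩ : ∃ i : Fin p, i.1 + 1 = m := ⟨⟨m - 1, by omega⟩, Nat.sub_add_cancel hm0⟩
  rcases Nat.lt_or_ge m p with hmp | hmp
  · have hlt := rowPerm_lt_pairRight a i
    have hgt := pairLeft_lt_rowPerm a ⟨m, hmp⟩
    rw [← hright hi, Fin.lt_def] at hlt
    rw [← hleft rfl, Fin.lt_def] at hgt
    omega
  · obtain rfl : y = Fin.last _ := Fin.ext (by rw [Fin.val_last]; omega)
    have hone : a i = 1 := (ha i).2 (by omega)
    have hi0 : i.1 ≠ 0 := fun h => by simp [(ha i).1 h] at hone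
    rw [val_rowPerm_last hp ha, hright hi, rowPerm_pairRight_of_one hone]
    rcases prevOne_mem a i with h | ⟨j, hj, -, h⟩ <;> rw [h] <;> omega

lemma exists_pair_of_descent (hp : 0 < p) (ha : IsAdmissible a) {s : Fin (2 * p + 2 - 1)}
    (hs : rowPerm a (rightPos s) < rowPerm a (leftPos s)) :
    ∃ j : Fin p, leftPos s = pairLeft j ∧ rightPos s = pairRight j := by
  rcases Nat.even_or_odd s.1 with hm | ⟨m, hm⟩
  · have hlt := rowPerm_add_one_lt hp ha (x := leftPos s) (y := rightPos s) hm rfl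
    rw [Fin.lt_def] at hs
    omega
  · exact ⟨⟨m, by omega⟩, Fin.ext hm, Fin.ext (congrArg (· + 1) hm)⟩

theorem leftWeighted_rowPerm (hp : 0 < p) (a : Fin p → Fin 2) {a' : Fin p → Fin 2}
    (ha' : IsAdmissible a') : LeftWeighted (rowPerm a) (rowPerm a') := by
  intro s hs
  obtain ⟨j, hl, hr⟩ := exists_pair_of_descent hp ha' hs
  rw [hl, hr]
  have hlt := rowPerm_symm_lt_pairRight a j
  have hgt := pairLeft_lt_rowPerm_symm a j
  have hne := (rowPerm a).symm.injective.ne (leftPos_ne_rightPos s)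
  rw [hl, hr, Ne, Fin.ext_iff] at hne
  rw [Fin.lt_def, val_pairLeft] at hgt
  rw [Fin.lt_def, val_pairRight] at hlt
  rw [Fin.lt_def]
  omega

end LeftWeighted

section Separates

variable {n : ℕ} {g : Equiv.Perm (Fin n)}

lemma separates_of_add_one_lt {x y : Fin n} (hy : y.1 = x.1 + 1)
    (hg : (g x).1 + 1 < (g y).1) : Separates g x.1 (x.1 + 2) := by
  obtain ⟨l, hl⟩ := g.surjective ⟨(g x).1 + 1, by omega⟩
  have hl' : (g l).1 = (g x).1 + 1 := congrArg Fin.val hl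
  have hx : l.1 ≠ x.1 := fun h => by rw [Fin.ext h] at hl'; omega
  have hy' : l.1 ≠ y.1 := fun h => by rw [Fin.ext h] at hl'; omega
  exact ⟨l, x, y, by omega, by omega, by omega, by rw [Fin.lt_def]; omega,
    by rw [Fin.lt_def]; omega⟩

variable {a : Fin p → Fin 2} {j : Fin p} {c e : ℤ}

lemma separates_of_last_pair_of_zero (hp : 0 < p) (ha : IsAdmissible a) (h0 : a j = 0)
    (hc : c ≤ 2 * j.1 + 1) (he : e = 2 * j.1 + 3 ∨ e = 2 * j.1 + 4) (hep : e < 2 * p + 2) :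
    Separates (rowPerm a) c e := by
  have hx := rowPerm_pairRight_of_zero h0
  have hy := rowPerm_pairLeft_of_zero h0
  rcases nextZero_mem a (j.1 + 1) with h | ⟨j', hj', h0', h⟩
  · have hj : j.1 + 1 ≠ p := fun hj => by simp [(ha j).2 hj] at h0
    refine ⟨Fin.last _, pairRight j, pairLeft j, ?_, ?_, ?_, ?_, ?_⟩
    all_goals simp only [Fin.lt_def, val_rowPerm_last hp ha, hx, hy, h, Fin.val_last,
      val_pairLeft, val_pairRight]
    all_goals omega
  · refine ⟨pairRight j', pairRight j, pairLeft j, ?_, ?_, ?_, ?_, ?_⟩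
    all_goals simp only [Fin.lt_def, rowPerm_pairRight_of_zero h0', hx, hy, h,
      val_pairLeft, val_pairRight]
    all_goals omega

lemma separates_of_last_pair_of_one (h1 : a j = 1)
    (hc : c ≤ 2 * j.1 + 1) (he : e = 2 * j.1 + 3 ∨ e = 2 * j.1 + 4) (hep : e < 2 * p + 2) :
    Separates (rowPerm a) c e := by
  have hl : rowPerm a ((rowPerm a).symm (pairLeft j)) = pairLeft j := Equiv.apply_symm_apply ..
  have hgt := pairLeft_lt_rowPerm_symm a j
  set l := (rowPerm a).symm (pairLeft j)
  have hlr : l.1 ≠ 2 * j.1 + 2 := fun h => by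
    have := prevOne_lt a j
    rw [show l = pairRight j from Fin.ext h, rowPerm_pairRight_of_one h1, Fin.ext_iff,
      val_pairLeft] at hl
    omega
  have hll (hj : j.1 + 1 < p) : l.1 ≠ 2 * j.1 + 3 := fun h => by
    have hlt := pairLeft_lt_rowPerm a ⟨j.1 + 1, hj⟩
    rw [← show l = pairLeft ⟨j.1 + 1, hj⟩ from Fin.ext h, hl] at hlt
    exact hlt.not_ge hgt.le
  have hlt := prevOne_lt a j
  refine ⟨l, pairRight j, pairLeft j, ?_, ?_, ?_, ?_, ?_⟩
  all_goals simp only [Fin.lt_def, hl, rowPerm_pairRight_of_one h1, rowPerm_pairLeft_of_one h1,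
    val_pairLeft, val_pairRight] at hgt ⊢
  all_goals omega

lemma separates_of_first_pair_of_zero (h0 : a j = 0)
    (hc : c = 2 * j.1 ∨ c = 2 * j.1 + 1) (hc0 : 0 < c) (he : 2 * j.1 + 3 ≤ e) :
    Separates (rowPerm a) c e := by
  have hl : rowPerm a ((rowPerm a).symm (pairRight j)) = pairRight j := Equiv.apply_symm_apply ..
  have hlt := rowPerm_symm_lt_pairRight a j
  set l := (rowPerm a).symm (pairRight j)
  have hll : l.1 ≠ 2 * j.1 + 1 := fun h => by
    have := nextZero_gt a j
    rw [show l = pairLeft j from Fin.ext h, rowPerm_pairLeft_of_zero h0, Fin.ext_iff,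
      val_pairRight] at hl
    omega
  have hlr (hj : 0 < j.1) : l.1 ≠ 2 * j.1 := fun h => by
    have hgt := rowPerm_lt_pairRight a ⟨j.1 - 1, by omega⟩
    rw [← show l = pairRight ⟨j.1 - 1, by omega⟩ from
      Fin.ext (by rw [h, val_pairRight]; simp only; omega), hl] at hgt
    exact hgt.not_ge hlt.le
  have hgt := nextZero_gt a j
  refine ⟨l, pairRight j, pairLeft j, ?_, ?_, ?_, ?_, ?_⟩
  all_goals simp only [Fin.lt_def, hl, rowPerm_pairRight_of_zero h0, rowPerm_pairLeft_of_zero h0,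
    val_pairLeft, val_pairRight] at hlt ⊢
  all_goals omega

lemma separates_of_first_pair_of_one (hp : 0 < p) (ha : IsAdmissible a) (h1 : a j = 1)
    (hc : c = 2 * j.1 ∨ c = 2 * j.1 + 1) (hc0 : 0 < c) (he : 2 * j.1 + 3 ≤ e) :
    Separates (rowPerm a) c e := by
  have hx := rowPerm_pairRight_of_one h1
  have hy := rowPerm_pairLeft_of_one h1
  rcases prevOne_mem a j.1 with h | ⟨j', hj', h1', h⟩
  · have hj : j.1 ≠ 0 := fun hj => by simp [(ha j).1 hj] at h1
    refine ⟨0, pairRight j, pairLeft j, ?_, ?_, ?_, ?_, ?_⟩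
    all_goals simp only [Fin.lt_def, val_rowPerm_first hp ha, hx, hy, h, Fin.val_zero,
      val_pairLeft, val_pairRight]
    all_goals omega
  · refine ⟨pairLeft j', pairRight j, pairLeft j, ?_, ?_, ?_, ?_, ?_⟩
    all_goals simp only [Fin.lt_def, rowPerm_pairLeft_of_one h1', hx, hy, h,
      val_pairLeft, val_pairRight]
    all_goals omega

theorem separates_rowPerm (hp : 0 < p) (ha : IsAdmissible a) (hc : 0 ≤ c) (hce : c + 2 ≤ e)
    (he : e ≤ 2 * p + 2) (hne : ¬ (c = 0 ∧ e = 2 * p + 2)) : Separates (rowPerm a) c e := by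
  lift c to ℕ using hc
  lift e to ℕ using by omega
  have hbit (i : Fin p) : a i = 0 ∨ a i = 1 := by omega
  by_cases hpair : Even c ∧ e = c + 2
  · obtain ⟨heven, rfl⟩ := hpair
    exact separates_of_add_one_lt (x := ⟨c, by omega⟩) (y := ⟨c + 1, by omega⟩) rfl
      (rowPerm_add_one_lt hp ha heven rfl)
  rw [Nat.even_iff] at hpair
  rcases Nat.eq_zero_or_pos c with hc0 | hc0
  · obtain ⟨j, hj⟩ : ∃ j : Fin p, j.1 = (e - 3) / 2 := ⟨⟨(e - 3) / 2, by omega⟩, rfl⟩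
    rcases hbit j with h | h
    · exact separates_of_last_pair_of_zero hp ha h (by omega) (by omega) (by omega)
    · exact separates_of_last_pair_of_one h (by omega) (by omega) (by omega)
  · obtain ⟨j, hj⟩ : ∃ j : Fin p, j.1 = c / 2 := ⟨⟨c / 2, by omega⟩, rfl⟩
    rcases hbit j with h | h
    · exact separates_of_first_pair_of_zero h (by omega) (by omega) (by omega)
    · exact separates_of_first_pair_of_one hp ha h (by omega) (by omega) (by omega)

end Separates

end BinaryBraid

/-! ### Adding a vertical strand -/

namespace BinaryBraid

open Braid GapWord

section InsertFixed

variable {n : ℕ} {q : Fin (n + 1)} {f g : Equiv.Perm (Fin n)}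

lemma val_succAbove_cases (q : Fin (n + 1)) (i : Fin n) :
    (i.1 < q.1 ∧ (q.succAbove i).1 = i.1) ∨ (q.1 ≤ i.1 ∧ (q.succAbove i).1 = i.1 + 1) := by
  rcases Nat.lt_or_ge i.1 q.1 with h | h
  · exact Or.inl ⟨h, congrArg Fin.val (Fin.succAbove_of_castSucc_lt q i h)⟩
  · exact Or.inr ⟨h, congrArg Fin.val (Fin.succAbove_of_le_castSucc q i h)⟩

lemma insertFixed_self (q : Fin (n + 1)) (f : Equiv.Perm (Fin n)) : insertFixed q f q = q := by
  simp [insertFixed]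

lemma insertFixed_succAbove (q : Fin (n + 1)) (f : Equiv.Perm (Fin n)) (i : Fin n) :
    insertFixed q f (q.succAbove i) = q.succAbove (f i) := by
  simp [insertFixed]

lemma insertFixed_symm (q : Fin (n + 1)) (f : Equiv.Perm (Fin n)) :
    (insertFixed q f).symm = insertFixed q f.symm := by
  simp [insertFixed, Equiv.trans_assoc]

lemma insertFixed_injective (q : Fin (n + 1)) :
    Function.Injective (insertFixed q : Equiv.Perm (Fin n) → _) := by
  refine fun f g h => Equiv.ext fun i => Fin.succAbove_right_injective (p := q) ?_
  rw [← insertFixed_succAbove, h, insertFixed_succAbove]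

lemma leftWeighted_insertFixed (hfg : LeftWeighted f g)
    (hr : ∀ x : Fin n, x.1 = q.1 → (g x).1 < q.1 → (f.symm x).1 < q.1)
    (hl : ∀ x : Fin n, x.1 + 1 = q.1 → q.1 ≤ (g x).1 → q.1 ≤ (f.symm x).1) :
    LeftWeighted (insertFixed q f) (insertFixed q g) := by
  intro s hs
  have hval : (rightPos s).1 = (leftPos s).1 + 1 := rfl
  rw [insertFixed_symm]
  rcases Fin.eq_self_or_eq_succAbove q (leftPos s) with hx | ⟨x, hx⟩ <;>
    rcases Fin.eq_self_or_eq_succAbove q (rightPos s) with hy | ⟨y, hy⟩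
  · exact absurd (hx.trans hy.symm) (leftPos_ne_rightPos s)
  all_goals
    simp only [hx, hy, insertFixed_self, insertFixed_succAbove] at hs hval ⊢
  · have := val_succAbove_cases q y
    rw [Fin.succAbove_lt_iff_castSucc_lt] at hs ⊢
    exact hr y (by omega) hs
  · have := val_succAbove_cases q x
    rw [Fin.lt_succAbove_iff_le_castSucc] at hs ⊢
    exact hl x (by omega) hs
  · have hx' := val_succAbove_cases q x
    have hy' := val_succAbove_cases q y
    rw [Fin.succAbove_lt_succAbove_iff] at hs ⊢
    have hy : y = rightPos ⟨x.1, by omega⟩ := Fin.ext (by simp only [rightPos]; omega)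
    rw [hy] at hs ⊢
    exact hfg ⟨x.1, by omega⟩ hs

lemma separates_insertFixed {c c' e e' : ℤ} (h : Separates f c' e')
    (hi : ∀ i : Fin n, (c ≤ (q.succAbove i).1 ∧ (q.succAbove i).1 < e) ↔ (c' ≤ i.1 ∧ i.1 < e')) :
    Separates (insertFixed q f) c e := by
  obtain ⟨l, x, y, hl, hx, hy, hxl, hly⟩ := h
  refine ⟨q.succAbove l, q.succAbove x, q.succAbove y, mt (hi l).1 hl, (hi x).2 hx, (hi y).2 hy,
    ?_, ?_⟩ <;> simpa only [insertFixed_succAbove, Fin.succAbove_lt_succAbove_iff]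

lemma separates_insertFixed_of_adjacent {x : Fin n} (hx : x.1 = q.1 ∨ x.1 + 1 = q.1)
    (h : (f x).1 ≠ q.1) (h' : (f x).1 + 1 ≠ q.1) :
    Separates (insertFixed q f) x.1 (x.1 + 2) := by
  have hvx := val_succAbove_cases q x
  have hvfx := val_succAbove_cases q (f x)
  rcases Nat.lt_or_gt_of_ne h with hlt | hlt
  · obtain ⟨l, hl⟩ := f.surjective ⟨q.1 - 1, by omega⟩
    have hl' : (f l).1 = q.1 - 1 := congrArg Fin.val hl
    have hlx : l.1 ≠ x.1 := fun h => by rw [Fin.ext h] at hl'; omega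
    have hvl := val_succAbove_cases q l
    have hvfl := val_succAbove_cases q (f l)
    refine ⟨q.succAbove l, q.succAbove x, q, by omega, by omega, by omega, ?_, ?_⟩ <;>
      simp only [insertFixed_self, insertFixed_succAbove, Fin.lt_def] <;> omega
  · obtain ⟨l, hl⟩ := f.surjective ⟨q.1, by omega⟩
    have hl' : (f l).1 = q.1 := congrArg Fin.val hl
    have hlx : l.1 ≠ x.1 := fun h => by rw [Fin.ext h] at hl'; omega
    have hvl := val_succAbove_cases q l
    have hvfl := val_succAbove_cases q (f l)
    refine ⟨q.succAbove l, q, q.succAbove x, by omega, by omega, by omega, ?_, ?_⟩ <;>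
      simp only [insertFixed_self, insertFixed_succAbove, Fin.lt_def] <;> omega

end InsertFixed

section RowOdd

variable {p : ℕ} {a a' : Fin p → Fin 2} {b b' : Fin (p + 1)}

/-- The position of the vertical strand of `α(a, b)`. -/
def fixedPos (b : Fin (p + 1)) : Fin (2 * p + 2 + 1) := ⟨2 * b.1 + 1, by omega⟩

/-- The permutation induced by `α(a, b)`. -/
noncomputable def rowPermOdd (a : Fin p → Fin 2) (b : Fin (p + 1)) :
    Equiv.Perm (Fin (2 * p + 3)) :=
  insertFixed (fixedPos b) (rowPerm a)

lemma val_fixedPos : (fixedPos b).1 = 2 * b.1 + 1 := rfl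

lemma exists_pairRight_of_fixedPos {x : Fin (2 * p + 2)} (hx : x.1 + 1 = (fixedPos b).1) :
    x = 0 ∨ ∃ j, x = pairRight j := by
  rw [val_fixedPos] at hx
  rcases Nat.eq_zero_or_pos b.1 with hb | hb
  · exact Or.inl (Fin.ext (by rw [Fin.val_zero]; omega))
  · exact Or.inr ⟨⟨b.1 - 1, by omega⟩, Fin.ext (by rw [val_pairRight]; simp only; omega)⟩

lemma exists_pairLeft_of_fixedPos {x : Fin (2 * p + 2)} (hx : x.1 = (fixedPos b).1) :
    x = Fin.last _ ∨ ∃ j, x = pairLeft j := by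
  rw [val_fixedPos] at hx
  rcases Nat.lt_or_ge b.1 p with hb | hb
  · exact Or.inr ⟨⟨b.1, hb⟩, Fin.ext hx⟩
  · exact Or.inl (Fin.ext (by rw [Fin.val_last]; omega))

lemma rowPerm_ne_of_fixedPos (hp : 0 < p) (ha : IsAdmissible a) {x : Fin (2 * p + 2)}
    (hx : x.1 = (fixedPos b).1 ∨ x.1 + 1 = (fixedPos b).1) :
    (rowPerm a x).1 ≠ (fixedPos b).1 ∧ (rowPerm a x).1 + 1 ≠ (fixedPos b).1 := by
  rcases hx with hx | hx
  · rw [← hx]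
    rcases exists_pairLeft_of_fixedPos hx with rfl | ⟨j, rfl⟩
    · rw [val_rowPerm_last hp ha, Fin.val_last]
      omega
    · have hlt : _ < _ := pairLeft_lt_rowPerm a j
      omega
  · rw [← hx]
    rcases exists_pairRight_of_fixedPos hx with rfl | ⟨j, rfl⟩
    · rw [val_rowPerm_first hp ha, Fin.val_zero]
      omega
    · have hlt : _ < _ := rowPerm_lt_pairRight a j
      omega

theorem leftWeighted_rowPermOdd (hp : 0 < p) (ha : IsAdmissible a) (ha' : IsAdmissible a')
    (b : Fin (p + 1)) : LeftWeighted (rowPermOdd a b) (rowPermOdd a' b) := by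
  refine leftWeighted_insertFixed (leftWeighted_rowPerm hp a ha') (fun x hx hlt => ?_)
    fun x hx hle => ?_
  · rcases exists_pairLeft_of_fixedPos hx with rfl | ⟨j, rfl⟩
    · rw [← hx, Fin.val_last]
      exact Fin.lt_last_iff_ne_last.2 (rowPerm_symm_last_ne hp ha)
    · rw [← hx] at hlt
      exact absurd (pairLeft_lt_rowPerm a' j) (Nat.lt_asymm hlt)
  · rcases exists_pairRight_of_fixedPos hx with rfl | ⟨j, rfl⟩
    · rw [← hx, Fin.val_zero]
      exact Fin.pos_iff_ne_zero.2 (rowPerm_symm_first_ne hp ha)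
    · rw [← hx] at hle
      exact absurd (rowPerm_lt_pairRight a' j) (Nat.lt_asymm hle)

theorem separates_rowPermOdd (hp : 0 < p) (ha : IsAdmissible a) (b : Fin (p + 1)) {c e : ℤ}
    (hc : 0 ≤ c) (hce : c + 2 ≤ e) (he : e ≤ 2 * p + 3) (hne : ¬ (c = 0 ∧ e = 2 * p + 3)) :
    Separates (rowPermOdd a b) c e := by
  lift c to ℕ using hc
  -- The vertical strand can be removed from every interval except those formed by it and one
  -- neighbour, which would become too short.
  by_cases hadj : e = c + 2 ∧ (c = (fixedPos b).1 ∨ c + 1 = (fixedPos b).1)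
  · obtain ⟨rfl, hc⟩ := hadj
    have hcp : c < 2 * p + 2 := by rw [val_fixedPos] at hc; omega
    have hmove := rowPerm_ne_of_fixedPos hp ha (x := ⟨c, hcp⟩) hc
    exact separates_insertFixed_of_adjacent (x := ⟨c, hcp⟩) hc hmove.1 hmove.2
  have hq := val_fixedPos (b := b)
  obtain ⟨c', hc'⟩ : ∃ c' : ℤ, (c ≤ (fixedPos b).1 ∧ c' = c) ∨
      ((fixedPos b).1 < c ∧ c' = c - 1) := by
    rcases le_or_gt c (fixedPos b).1 with h | h
    · exact ⟨c, Or.inl ⟨h, rfl⟩⟩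
    · exact ⟨c - 1, Or.inr ⟨h, rfl⟩⟩
  obtain ⟨e', he'⟩ : ∃ e' : ℤ, (e ≤ (fixedPos b).1 ∧ e' = e) ∨
      ((fixedPos b).1 < e ∧ e' = e - 1) := by
    rcases le_or_gt e (fixedPos b).1 with h | h
    · exact ⟨e, Or.inl ⟨h, rfl⟩⟩
    · exact ⟨e - 1, Or.inr ⟨h, rfl⟩⟩
  refine separates_insertFixed (separates_rowPerm hp ha (c := c') (e := e') (by omega) (by omega)
    (by omega) (by omega)) fun i => ?_
  have := val_succAbove_cases (fixedPos b) i
  omega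

lemma rowPermOdd_fixedPos_ne (a : Fin p → Fin 2) (h : b < b') :
    rowPermOdd a b' (fixedPos b) ≠ fixedPos b := by
  have hlt : b.1 < p := by omega
  have hq : (fixedPos b').succAbove (pairLeft ⟨b.1, hlt⟩) = fixedPos b := by
    refine Fin.succAbove_of_castSucc_lt _ _ ?_
    rw [Fin.lt_def, Fin.val_castSucc, val_pairLeft, val_fixedPos]
    simp only
    omega
  rw [← hq, rowPermOdd, insertFixed_succAbove]
  exact Fin.succAbove_right_injective.ne (pairLeft_lt_rowPerm a _).ne'

lemma rowPermOdd_injective (h : rowPermOdd a b = rowPermOdd a' b') : a = a' ∧ b = b' := by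
  have hfix (a : Fin p → Fin 2) (b) : rowPermOdd a b (fixedPos b) = fixedPos b :=
    insertFixed_self _ _
  rcases lt_trichotomy b b' with hlt | rfl | hlt
  · exact absurd (h ▸ hfix a b) (rowPermOdd_fixedPos_ne a' hlt)
  · exact ⟨rowPerm_injective (insertFixed_injective _ h), rfl⟩
  · exact absurd (h ▸ hfix a' b') (rowPermOdd_fixedPos_ne a hlt)

lemma val_rowPermOdd_first (hp : 0 < p) (ha : IsAdmissible a) (b : Fin (p + 1)) :
    (rowPermOdd a b 0).1 = 2 ∨ (rowPermOdd a b 0).1 = 3 := by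
  have h0 : (fixedPos b).succAbove 0 = 0 :=
    Fin.succAbove_ne_zero_zero (Fin.ne_of_val_ne (by simp [val_fixedPos]))
  have hval := val_succAbove_cases (fixedPos b) (rowPerm a 0)
  rw [val_rowPerm_first hp ha, ← insertFixed_succAbove, h0] at hval
  exact hval.imp And.right And.right

end RowOdd

end BinaryBraid

namespace Braid

open GapWord

variable {n k : ℕ} {f g : Fin k → Equiv.Perm (Fin n)}

lemma startingSet_subset_finishingSet {f g : Equiv.Perm (Fin n)} (h : LeftWeighted f g) :
    startingSet (permBraid g) ⊆ finishingSet (permBraid f) := fun s hs =>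
  mem_finishingSet_permBraid (h s (descent_of_mem_startingSet hs))

lemma isChain_ofFn_leftWeighted (hf : ∀ i j, LeftWeighted (f i) (f j)) :
    (List.ofFn f).IsChain LeftWeighted :=
  (List.pairwise_ofFn.2 fun i j _ => hf i j).isChain

lemma isLeftCanonicalForm_ofFn (hf : ∀ i j, LeftWeighted (f i) (f j)) (h1 : ∀ i, f i ≠ 1)
    (hrev : ∀ i, f i ≠ Fin.revPerm) :
    IsLeftCanonicalForm (List.ofFn fun i => permBraid (f i)).prod 0
      (List.ofFn fun i => permBraid (f i)) where
  eq_prod := by rw [zpow_zero, one_mul]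
  isPermutationBraid := List.forall_mem_ofFn_iff.2 fun i => isPermutationBraid_permBraid (f i)
  ne_one := List.forall_mem_ofFn_iff.2 fun i h =>
    h1 i (permBraid_injective (h.trans permBraid_one.symm))
  ne_halfTwist := List.forall_mem_ofFn_iff.2 fun i h => hrev i (permBraid_injective h)
  leftWeighted :=
    (List.pairwise_ofFn.2 fun i j _ => startingSet_subset_finishingSet (hf i j)).isChain

lemma isRigid_ofFn (hk : k ≠ 0) (hf : ∀ i j, LeftWeighted (f i) (f j)) (h1 : ∀ i, f i ≠ 1)
    (hrev : ∀ i, f i ≠ Fin.revPerm) : IsRigid (List.ofFn fun i => permBraid (f i)).prod := by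
  have hne : (List.ofFn fun i => permBraid (f i)) ≠ [] := mt List.ofFn_eq_nil_iff.1 hk
  refine ⟨0, _, hne, isLeftCanonicalForm_ofFn hf h1 hrev, ?_⟩
  obtain ⟨i, hi⟩ := (List.mem_ofFn' _ _).1 (List.head_mem hne)
  obtain ⟨j, hj⟩ := (List.mem_ofFn' _ _).1 (List.getLast_mem hne)
  rw [← hi, ← hj, tauPow, zpow_zero, inv_one, one_mul, mul_one]
  exact startingSet_subset_finishingSet (hf j i)

lemma not_exists_isStandardReductionSystem_ofFn (hk : k ≠ 0)
    (hf : ∀ i j, LeftWeighted (f i) (f j))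
    (hsep : ∀ i (C : StandardCircle n), Separates (f i) C.first.1 (C.last.1 + 1)) :
    ¬ ∃ 𝒞, IsStandardReductionSystem (List.ofFn fun i => permBraid (f i)).prod 𝒞 := by
  obtain ⟨k, rfl⟩ := Nat.exists_eq_succ_of_ne_zero hk
  have hchain := isChain_ofFn_leftWeighted hf
  rw [List.ofFn_succ] at hchain
  have hnot := not_exists_isStandardReductionSystem hchain (hsep 0)
  rwa [← List.ofFn_succ, List.map_ofFn] at hnot

lemma prod_ofFn_permBraid_injective (hf : ∀ i j, LeftWeighted (f i) (f j))
    (hg : ∀ i j, LeftWeighted (g i) (g j))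
    (h : (List.ofFn fun i => permBraid (f i)).prod = (List.ofFn fun i => permBraid (g i)).prod) :
    f = g := by
  refine List.ofFn_injective (leftWeighted_unique (isChain_ofFn_leftWeighted hf)
    (isChain_ofFn_leftWeighted hg) (by simp) ?_)
  rwa [List.map_ofFn, List.map_ofFn]

end Braid

namespace BinaryBraid

open Braid GapWord

variable {p : ℕ} {a : Fin p → Fin 2}

lemma rowPerm_ne_one (hp : 0 < p) (ha : IsAdmissible a) : rowPerm a ≠ 1 := fun h => by
  simpa [h] using val_rowPerm_first hp ha

lemma rowPerm_ne_revPerm (hp : 0 < p) (ha : IsAdmissible a) : rowPerm a ≠ Fin.revPerm :=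
  fun h => by
    have h0 := val_rowPerm_first hp ha
    simp only [h, Fin.revPerm_apply, Fin.val_rev, Fin.val_zero] at h0
    omega

lemma rowPermOdd_ne_one (hp : 0 < p) (ha : IsAdmissible a) (b : Fin (p + 1)) :
    rowPermOdd a b ≠ 1 := fun h => by
  simpa [h] using val_rowPermOdd_first hp ha b

lemma rowPermOdd_ne_revPerm (hp : 0 < p) (ha : IsAdmissible a) (b : Fin (p + 1)) :
    rowPermOdd a b ≠ Fin.revPerm := fun h => by
  have h0 := val_rowPermOdd_first hp ha b
  simp only [h, Fin.revPerm_apply, Fin.val_rev, Fin.val_zero] at h0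
  omega

lemma separates_circle_rowPerm (hp : 0 < p) (ha : IsAdmissible a)
    (C : StandardCircle (2 * p + 2)) : Separates (rowPerm a) C.first.1 (C.last.1 + 1) := by
  have hlt : C.first.1 < C.last.1 := C.first_lt_last
  have hper := C.not_peripheral
  exact separates_rowPerm hp ha (by omega) (by omega) (by omega) (by omega)

lemma separates_circle_rowPermOdd (hp : 0 < p) (ha : IsAdmissible a) (b : Fin (p + 1))
    (C : StandardCircle (2 * p + 3)) : Separates (rowPermOdd a b) C.first.1 (C.last.1 + 1) := by
  have hlt : C.first.1 < C.last.1 := C.first_lt_last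
  have hper := C.not_peripheral
  exact separates_rowPermOdd hp ha b (by omega) (by omega) (by omega) (by omega)

end BinaryBraid

theorem lemma2p2 (k p : ℕ) (hk : 1 ≤ k) (hp : 2 ≤ p) :
    -- braids on `n = 2p + 2` strands
    ((∀ A : BinaryBraid.AdmissibleMatrix k p,
        Braid.IsLeftCanonicalForm (BinaryBraid.alphaEven A) 0
          (List.ofFn fun i => BinaryBraid.rowBraid (A.1 i)) ∧
        Braid.IsRigid (BinaryBraid.alphaEven A) ∧
        (∀ i j : Fin k, Braid.startingSet (BinaryBraid.rowBraid (A.1 j)) ⊆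
          Braid.finishingSet (BinaryBraid.rowBraid (A.1 i))) ∧
        ¬ ∃ 𝒞 : Set (Braid.StandardCircle (2 * p + 2)),
          Braid.IsStandardReductionSystem (BinaryBraid.alphaEven A) 𝒞) ∧
      Function.Injective
        (BinaryBraid.alphaEven : BinaryBraid.AdmissibleMatrix k p → Braid (2 * p + 2))) ∧
    -- braids on `n = 2p + 3` strands
    ((∀ A : BinaryBraid.AdmissibleMatrix k p × Fin (p + 1),
        Braid.IsLeftCanonicalForm (BinaryBraid.alphaOdd A) 0
          (List.ofFn fun i => BinaryBraid.rowBraidOdd (A.1.1 i) A.2) ∧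
        Braid.IsRigid (BinaryBraid.alphaOdd A) ∧
        (∀ i j : Fin k, Braid.startingSet (BinaryBraid.rowBraidOdd (A.1.1 j) A.2) ⊆
          Braid.finishingSet (BinaryBraid.rowBraidOdd (A.1.1 i) A.2)) ∧
        ¬ ∃ 𝒞 : Set (Braid.StandardCircle (2 * p + 3)),
          Braid.IsStandardReductionSystem (BinaryBraid.alphaOdd A) 𝒞) ∧
      Function.Injective
        (BinaryBraid.alphaOdd :
          BinaryBraid.AdmissibleMatrix k p × Fin (p + 1) → Braid (2 * p + 3))) := by
  have hk0 : k ≠ 0 := by omega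
  have hp0 : 0 < p := by omega
  open Braid BinaryBraid in
  refine ⟨⟨fun A => ?_, fun A A' h => ?_⟩, ⟨fun ⟨A, b⟩ => ?_, fun ⟨A, b⟩ ⟨A', b'⟩ h => ?_⟩⟩
  · have hlw i j := leftWeighted_rowPerm hp0 (A.1 i) (A.2 j)
    have h1 i := rowPerm_ne_one hp0 (A.2 i)
    have hrev i := rowPerm_ne_revPerm hp0 (A.2 i)
    exact ⟨isLeftCanonicalForm_ofFn hlw h1 hrev, isRigid_ofFn hk0 hlw h1 hrev,
      fun i j => startingSet_subset_finishingSet (hlw i j),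
      not_exists_isStandardReductionSystem_ofFn hk0 hlw fun i =>
        separates_circle_rowPerm hp0 (A.2 i)⟩
  · have hlw (A : AdmissibleMatrix k p) i j := leftWeighted_rowPerm hp0 (A.1 i) (A.2 j)
    have hrow := congrFun (prod_ofFn_permBraid_injective (hlw A) (hlw A') h)
    exact Subtype.ext (funext fun i => rowPerm_injective (hrow i))
  · have hlw i j := leftWeighted_rowPermOdd hp0 (A.2 i) (A.2 j) b
    have h1 i := rowPermOdd_ne_one hp0 (A.2 i) b
    have hrev i := rowPermOdd_ne_revPerm hp0 (A.2 i) b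
    exact ⟨isLeftCanonicalForm_ofFn hlw h1 hrev, isRigid_ofFn hk0 hlw h1 hrev,
      fun i j => startingSet_subset_finishingSet (hlw i j),
      not_exists_isStandardReductionSystem_ofFn hk0 hlw fun i =>
        separates_circle_rowPermOdd hp0 (A.2 i) b⟩
  · have hlw (A : AdmissibleMatrix k p) b i j := leftWeighted_rowPermOdd hp0 (A.2 i) (A.2 j) b
    have hrow := congrFun (prod_ofFn_permBraid_injective (hlw A b) (hlw A' b') h)
    have hpair i := rowPermOdd_injective (hrow i)
    exact Prod.ext (Subtype.ext (funext fun i => (hpair i).1)) (hpair ⟨0, hk⟩).2
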